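/- **Conventions.** $\mathbb N=\{1,2,\dots\}$. For a finite multiset $A$ of positive integers let $\Sigma(A)$ be the sum of its elements, $\chi(A)_n$ the multiplicity of $n$ in $A$, and $z^A=\prod_{n\in A}z_n$. Order the multisets by $\Sigma$ and, among multisets with equal $\Sigma$, put $A$ before $B$ if the first entry in which $\chi(A),\chi(B)$ differ is smaller in $\chi(A)$; $M_i$ is the $i$-th multiset, so $M_1=\emptyset$, $M_2=\{1\}$, $M_3=\{2\}$, $M_4=\{1,1\}$. A *graphon* is a symmetric measurable $W:[0,1)^2\to[0,1]$. For a graph $H$ with vertices $v_1,\dots,v_n$, $$\tau(H,W)=\int_{[0,1)^{n}}\prod_{v_iv_j\in E(H)}W(x_i,x_j)\prod_{v_iv_j\notin E(H)}(1-W(x_i,x_j))\,dx .$$ A *bounding sequence* is $P=(p_j,l_j,u_j)_{j\in\mathbb N}$ where $p_j$ is a real polynomial in finitely many of the variables $z_1,z_2,\dots$ with values in $[0,1]$ and first partial derivatives in $[-1,1]$ on $[0,1]^{\mathbb N}$, the coefficient $\pi_{j,i}$ of $z^{M_i}$ in $p_j$ satisfies $|\pi_{j,i}|\le 2^{-2^i}/9$,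 and $0\le l_j\le u_j\le1$. Two polynomials are *$\varepsilon$-close* if on $[0,1]^{\mathbb N}$ their values differ by at most $\varepsilon$ and so do all their first partial derivatives. Write $\langle x\rangle$ for the $k\in\mathbb N$ with $x-\lfloor x\rfloor\in[1-2^{-k+1},1-2^{-k})$; $\pi^{\pm}$ are the positive and negative parts of $\pi$. **The graphon $W_F$ of $P$.** It is symmetric. On $[0,2/3)^2\setminus[1/3,2/3)^2$ it is $1$ if $x,y\in[1/6,1/3)$ and $\langle3x\rangle=\langle3y\rangle$, or if (up to swapping $x,y$) $x\in[1/3,2/3)$, $y\in[1/6,1/3)$ and $M_{\langle3x\rangle}$ is $\{\min M_{\langle3y\rangle}\}$ or $M_{\langle3y\rangle}$ with one copy of its minimum removed; otherwise it is $0$ there. For $x\in[2/3,1)$ it is $9\cdot2^{2\langle3y\rangle}\pi^+_{\langle3x\rangle,\langle3y\rangle}$ if $y\in[0,1/3)$ and $9\cdot2^{2\langle3y\rangle}\pi^-_{\langle3x\rangle,\langle3y\rangle}$ if $y\in[1/3,2/3)$. If $\langle3x\rangle=\langle3y\rangle$, it is $1-u_{\langle3x\rangle}$ on $[1/3,2/3)^2$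 and $l_{\langle3x\rangle}$ on $[2/3,1)^2$; if $\langle3x\rangle\ne\langle3y\rangle$ it is $0$ on these two squares. **The graphon $W_0$.** Fix any rule that assigns to every graphon $W$ a graphon $\mathcal U(W)$ such that $\mathcal U(W)\big(\tfrac{6+x}{13},\tfrac{6+y}{13}\big)=W(x,y)$ for all $x,y\in[0,1)$ (for instance a rule with all $\mathcal U(W)$ finitely forcible, as provided by the universality theorem for finitely forcible graphons), and put $W_0=\mathcal U(W_F)$. For $Z\in\{A,\dots,G\}$ let $\iota^0_Z(x)=(k+x)/13$, where $k=0,\dots,6$ for $Z=A,\dots,G$. **The graphon $W_P(z)$, $z\in[0,1]^{\mathbb N}$.** Split $[0,1)$ into consecutive half-open intervals $A,B,C,D_A,\dots,D_G,E,F,Q,R$, where $Q$ has length $12/25$ and all others $1/25$; $\iota_X:[0,1)\to X$ is the increasing linear bijection. $W_P(z)$ is symmetric, and its value at $(\iota_X(x),\iota_Y(y))$ is as follows (it is $0$ wherever nothing is said). Put $p=p_{\langle3x\rangle}(z)$, $v_k=2^{k}(3y-1)+2$, $w_k=2^{k}(3y-2)+2$. * $A\times Y$, $Y\in\{A,B,C,D_A,\dots,D_G,E\}$: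 $1$ if $\lfloor3x\rfloor=\lfloor3y\rfloor$. $B\times Y$, $Y\in\{B,C,D_A,\dots,D_G,E\}$: $1$ if $\lfloor3x\rfloor=\lfloor3y\rfloor$ and $\langle3x\rangle=\langle3y\rangle$. * $C\times C$, when $\langle3x\rangle=\langle3y\rangle$: $z^{M_{\langle3x\rangle}}$ on $[0,\frac13)^2\cup[\frac13,\frac23)^2$ and $1-z^{M_{\langle3x\rangle}}$ on $[0,\frac13)\times[\frac13,\frac23)$ and $[\frac13,\frac23)\times[0,\frac13)$. * $C\times D_A$ (resp. $C\times D_B$): $1$ if $\langle3x\rangle=\langle3y\rangle$, $x\in[0,\frac13)$ and $y\in[\frac13,\frac23)$ (resp. $y\in[\frac23,1)$). $C\times D_C$: $1$ on $[0,\frac16)^2$. $C\times D_G$: $W_F(x,y)$ on $[0,\frac13)\times[0,\frac23)$ and on $[0,\frac23)\times[\frac23,1)$. * $C\times E$, with $k=\langle3x\rangle$: $1$ in the four cases: $x,y\in[0,\frac13)$, $0\le v_k\le p$; $x\in[0,\frac13)$, $y\in[\frac13,\frac23)$, $0\le w_k\le1-p$; $x\in[\frac13,\frac23)$, $y\in[0,\frac13)$,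 $p\le v_k\le1$; $x,y\in[\frac13,\frac23)$, $1-p\le w_k\le1$. * $D_Z\times D_{Z'}$: $W_0(\iota^0_Z(x),\iota^0_{Z'}(y))$. $D_G\times E$, when $\langle3x\rangle=\langle3y\rangle=k$ and $y\in[0,\frac13)$: $1$ if $x\in[\frac13,\frac23)$ and $v_k\le u_k$, or $x\in[\frac23,1)$ and $v_k\le l_k$. * $X\times F$, $X\in\{A,B,D_A,\dots,D_G,F\}$: $1$ if $x+y\ge1$. * $X\times Q$, $X\in\{A,B,C,D_A,\dots,D_G,E,F\}$: $\frac1{12}\big(12-\sum_{Z}\int_0^1W_P(z)(\iota_X(x),\iota_Z(t))\,dt\big)$, the sum over the same twelve parts. $Q\times Q$, $Q\times R$: $1$. $A\times R,B\times R,C\times R,D_A\times R,\dots,D_G\times R,E\times R,F\times R$: $\frac1{25},\frac2{25},\dots,\frac{12}{25}$, respectively. The *$L_1$-distance* of bounding sequences $P,P'$ is $\sup_{z\in[0,1]^{\mathbb N}}\int_{[0,1)^2}|W_P(z)(x,y)-W_{P'}(z)(x,y)|\,dx\,dy$. **Lemma.** For every finite graph $H$ there exist a countable set $\mathcal H$,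 a constant $c_H\in(0,1)$ and constants $\beta_{H',i}$ ($H'\in\mathcal H$, $i\in\mathbb N$), depending only on $H$ (not on $\mathcal U$), such that $\sum_{H'\in\mathcal H}\beta_{H',i}$ is finite for every $i$ and at most $c_H^{\Sigma(M_i)}$ for all but finitely many $i$, and such that for every bounding sequence $P$ there are polynomials $q_{P,H'}(z)=\sum_{i}\alpha_{P,H',i}z^{M_i}$, $H'\in\mathcal H$, with the following properties. 1. $\tau(H,W_P(z))=\sum_{H'\in\mathcal H}q_{P,H'}(z)$ (a convergent sum) for every $z\in[0,1]^{\mathbb N}$ with $p_j(z)\in[l_j,u_j]$ for all $j\in\mathbb N$. 2. $|\alpha_{P,H',i}|\le\beta_{H',i}$ for all $H'\in\mathcal H$ and $i\in\mathbb N$. 3. For every $P$, every $H'\in\mathcal H$ and every $\varepsilon>0$ there are an integer $k_{P,H'}$ and a real $\varepsilon_{P,H'}>0$ such that, if $P'$ is a bounding sequence that agrees with $P$ on the first $k_{P,H'}$ elements and has $L_1$-distance at most $\varepsilon_{P,H'}$ from $P$, then $q_{P,H'}$ and $q_{P',H'}$ are $\varepsilon$-close. -/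

import Mathlib

open MeasureTheory

noncomputable section

namespace GraphonFamily

/-! ### Finite multisets of positive integers and their enumeration

A finite multiset of positive integers is given by its multiplicity vector, an element
of `ℕ+ →₀ ℕ`.  These are also the exponent vectors of the monomials of
`MvPolynomial ℕ+ ℝ`. -/

/-- The sum `Σ(A)` of the elements of the multiset `A`. -/
def weight (A : ℕ+ →₀ ℕ) : ℕ := A.sum fun n e => (n : ℕ) * e

/-- The strict order on multisets: first compare the sums, then the first entry in which the
multiplicity vectors differ. -/
def Precedes (A B : ℕ+ →₀ ℕ) : Prop :=
  weight A < weight B ∨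
    (weight A = weight B ∧ ∃ n : ℕ+, (∀ m < n, A m = B m) ∧ A n < B n)

/-- The number of multisets strictly before `A`. -/
def position (A : ℕ+ →₀ ℕ) : ℕ := Set.ncard {B | Precedes B A}

theorem Precedes.trans {A B C : ℕ+ →₀ ℕ} (h : Precedes A B) (h' : Precedes B C) :
    Precedes A C := by
  rcases h with h | ⟨h, n, hn, hn'⟩
  · rcases h' with h' | ⟨h', -⟩
    · exact Or.inl (h.trans h')
    · exact Or.inl (h' ▸ h)
  · rcases h' with h' | ⟨h', m, hm, hm'⟩
    · exact Or.inl (h ▸ h')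
    · refine Or.inr ⟨h.trans h', ?_⟩
      rcases lt_trichotomy n m with hlt | rfl | hlt
      · exact ⟨n, fun k hk => (hn k hk).trans (hm k (hk.trans hlt)), (hm n hlt) ▸ hn'⟩
      · exact ⟨n, fun k hk => (hn k hk).trans (hm k hk), hn'.trans hm'⟩
      · exact ⟨m, fun k hk => (hn k (hk.trans hlt)).trans (hm k hk), (hn m hlt) ▸ hm'⟩

theorem not_precedes_self (A : ℕ+ →₀ ℕ) : ¬ Precedes A A := by
  rintro (h | ⟨-, n, -, h⟩)
  · exact lt_irrefl _ h
  · exact lt_irrefl _ h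

theorem precedes_or_of_ne {A B : ℕ+ →₀ ℕ} (h : A ≠ B) : Precedes A B ∨ Precedes B A := by
  rcases lt_trichotomy (weight A) (weight B) with hw | hw | hw
  · exact Or.inl (Or.inl hw)
  · have hex : ∃ n : ℕ+, A n ≠ B n := by
      by_contra hcon
      push Not at hcon
      exact h (Finsupp.ext hcon)
    let n := WellFounded.min (wellFounded_lt (α := ℕ+)) {n | A n ≠ B n} hex
    have hn : A n ≠ B n := WellFounded.min_mem (wellFounded_lt (α := ℕ+)) {n | A n ≠ B n} hex
    have hmin : ∀ m < n, A m = B m := by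
      intro m hm
      by_contra hne
      exact WellFounded.not_lt_min (wellFounded_lt (α := ℕ+)) {n | A n ≠ B n} hne hm
    rcases lt_or_gt_of_ne hn with hlt | hlt
    · exact Or.inl (Or.inr ⟨hw, n, hmin, hlt⟩)
    · exact Or.inr (Or.inr ⟨hw.symm, n, fun m hm => (hmin m hm).symm, hlt⟩)
  · exact Or.inr (Or.inl hw)

theorem finite_weight_le (w : ℕ) : {A : ℕ+ →₀ ℕ | weight A ≤ w}.Finite := by
  have hterm : ∀ A : ℕ+ →₀ ℕ, ∀ n : ℕ+, (n : ℕ) * A n ≤ weight A := by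
    intro A n
    by_cases hn : n ∈ A.support
    · exact Finset.single_le_sum (f := fun n : ℕ+ => (n : ℕ) * A n)
        (fun _ _ => Nat.zero_le _) hn
    · simp [Finsupp.notMem_support_iff.mp hn]
  refine (Set.finite_Iic (Finsupp.indicator (Finset.Icc 1 (Nat.toPNat' w))
    (fun _ _ => w))).subset ?_
  intro A hA n
  have h1 := (hterm A n).trans hA
  by_cases h0 : A n = 0
  · rw [h0]; exact Nat.zero_le _
  · have h2 : (n : ℕ) ≤ w := (Nat.le_mul_of_pos_right _ (Nat.pos_of_ne_zero h0)).trans h1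
    have h3 : A n ≤ w := (Nat.le_mul_of_pos_left _ n.pos).trans h1
    have h4 : n ∈ Finset.Icc 1 (Nat.toPNat' w) := by
      rw [Finset.mem_Icc]
      refine ⟨one_le, ?_⟩
      have hw : 0 < w := lt_of_lt_of_le n.pos h2
      rw [← PNat.coe_le_coe, Nat.toPNat'_coe, if_pos hw]
      exact h2
    rw [Finsupp.indicator_of_mem h4]
    exact h3

theorem finite_precedes (A : ℕ+ →₀ ℕ) : {B | Precedes B A}.Finite := by
  refine (finite_weight_le (weight A)).subset ?_
  rintro B (h | ⟨h, -⟩)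
  · exact h.le
  · exact h.le

theorem position_lt {A B : ℕ+ →₀ ℕ} (h : Precedes A B) : position A < position B := by
  refine Set.ncard_lt_ncard ⟨fun C hC => Precedes.trans hC h, fun hsub => ?_⟩
    (finite_precedes B)
  exact not_precedes_self A (hsub h)

theorem position_injective : Function.Injective position := by
  intro A B h
  by_contra hne
  rcases precedes_or_of_ne hne with h' | h'
  · exact absurd (position_lt h') (by omega)
  · exact absurd (position_lt h') (by omega)

theorem position_surjective : Function.Surjective position := by
  have hdown : ∀ A : ℕ+ →₀ ℕ, ∀ r < position A, ∃ B, position B = r := by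
    intro A r hr
    have himg : position '' {B | Precedes B A} = Set.Iio (position A) := by
      refine Set.eq_of_subset_of_ncard_le ?_ ?_ (Set.finite_Iio _)
      · rintro _ ⟨B, hB, rfl⟩
        exact position_lt hB
      · rw [Set.ncard_image_of_injective _ position_injective]
        have : (Set.Iio (position A)).ncard = position A := by
          rw [← Finset.coe_Iio, Set.ncard_coe_finset, Nat.card_Iio]
        rw [this]
        exact le_rfl
    have hr' : r ∈ position '' {B | Precedes B A} := by rw [himg]; exact hr
    obtain ⟨B, -, hB⟩ := hr'
    exact ⟨B, hB⟩
  intro r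
  have hinf : (Set.range position).Infinite := Set.infinite_range_of_injective position_injective
  obtain ⟨_, ⟨A, rfl⟩, hA⟩ := hinf.exists_gt r
  exact hdown A r hA

theorem position_bijective : Function.Bijective position :=
  ⟨position_injective, position_surjective⟩

/-- `M i` is the `i`-th multiset, `i = 1, 2, …`: the one with exactly `i - 1` predecessors. -/
def M (i : ℕ+) : ℕ+ →₀ ℕ :=
  (Equiv.ofBijective position position_bijective).symm i.natPred

theorem position_M (i : ℕ+) : position (M i) = i.natPred :=
  (Equiv.ofBijective position position_bijective).apply_symm_apply i.natPred

/-! ### Polynomials and bounding sequences -/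

/-- The cube `[0,1]^ℕ`. -/
def cube : Set (ℕ+ → ℝ) := {z | ∀ n, z n ∈ Set.Icc (0 : ℝ) 1}

/-- The value `z^A`. -/
def monomialValue (A : ℕ+ →₀ ℕ) (z : ℕ+ → ℝ) : ℝ := A.prod fun n e => z n ^ e

/-- Two polynomials are `ε`-close if their values and the values of all their first partial
derivatives differ by at most `ε` on the cube. -/
def EpsClose (ε : ℝ) (q q' : MvPolynomial ℕ+ ℝ) : Prop :=
  ∀ z ∈ cube, |MvPolynomial.eval z q - MvPolynomial.eval z q'| ≤ ε ∧
    ∀ n : ℕ+, |MvPolynomial.eval z (MvPolynomial.pderiv n q) -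
      MvPolynomial.eval z (MvPolynomial.pderiv n q')| ≤ ε

/-- Bounding sequences `(p_i, l_i, u_i)`, `i = 1, 2, …`. -/
structure BoundingSequence where
  p : ℕ+ → MvPolynomial ℕ+ ℝ
  l : ℕ+ → ℝ
  u : ℕ+ → ℝ
  p_mem : ∀ i, ∀ z ∈ cube, MvPolynomial.eval z (p i) ∈ Set.Icc (0 : ℝ) 1
  coeff_le : ∀ i j, |MvPolynomial.coeff (M j) (p i)| ≤ ((2 : ℝ) ^ (2 ^ (j : ℕ)))⁻¹ / 9
  pderiv_le : ∀ i n, ∀ z ∈ cube,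
    |MvPolynomial.eval z (MvPolynomial.pderiv n (p i))| ≤ 1
  l_mem : ∀ i, l i ∈ Set.Icc (0 : ℝ) 1
  u_mem : ∀ i, u i ∈ Set.Icc (0 : ℝ) 1
  l_le_u : ∀ i, l i ≤ u i

/-- `z` satisfies the constraints `p_j(z) ∈ [l_j, u_j]`. -/
def Feasible (P : BoundingSequence) (z : ℕ+ → ℝ) : Prop :=
  ∀ j, MvPolynomial.eval z (P.p j) ∈ Set.Icc (P.l j) (P.u j)

/-- `P` and `P'` agree on the first `k` elements. -/
def AgreeUpTo (k : ℕ) (P P' : BoundingSequence) : Prop :=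
  ∀ i : ℕ+, (i : ℕ) ≤ k → P.p i = P'.p i ∧ P.l i = P'.l i ∧ P.u i = P'.u i

/-! ### Graphons -/

/-- A graphon: a symmetric measurable function from `[0,1)²` to `[0,1]`.  Only the values on
`[0,1)²` matter. -/
structure IsGraphon (W : ℝ → ℝ → ℝ) : Prop where
  meas : Measurable fun s : Set.Ico (0 : ℝ) 1 × Set.Ico (0 : ℝ) 1 => W s.1 s.2
  symm : ∀ x ∈ Set.Ico (0 : ℝ) 1, ∀ y ∈ Set.Ico (0 : ℝ) 1, W x y = W y x
  mem : ∀ x ∈ Set.Ico (0 : ℝ) 1, ∀ y ∈ Set.Ico (0 : ℝ) 1, W x y ∈ Set.Icc (0 : ℝ) 1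

open Classical in
/-- The labelled density `τ(H, W)`: the probability that the `W`-random graph on the vertices
of `H` is `H`. -/
def tau {n : ℕ} (H : SimpleGraph (Fin n)) (W : ℝ → ℝ → ℝ) : ℝ :=
  ∫ x in Set.univ.pi (fun _ : Fin n => Set.Ico (0 : ℝ) 1),
    ∏ e : Fin n × Fin n with e.1 < e.2,
      if H.Adj e.1 e.2 then W (x e.1) (x e.2) else 1 - W (x e.1) (x e.2)

/-! ### Dyadic coordinates -/

/-- `⟨x⟩`: the unique positive integer `k` such that the fractional part of `x` lies in
`[1 - 2^{-k+1}, 1 - 2^{-k})`. -/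
def coord (x : ℝ) : ℕ+ := Nat.succPNat ⌊-Real.logb 2 (1 - Int.fract x)⌋₊

theorem coord_spec (x : ℝ) :
    1 - 2 * ((2 : ℝ) ^ (coord x : ℕ))⁻¹ ≤ Int.fract x ∧
      Int.fract x < 1 - ((2 : ℝ) ^ (coord x : ℕ))⁻¹ := by
  set t := 1 - Int.fract x with ht
  have h0 : 0 < t := by linarith [Int.fract_lt_one x]
  have h1 : t ≤ 1 := by linarith [Int.fract_nonneg x]
  have hl : 0 ≤ -Real.logb 2 t := by
    have := Real.logb_nonpos (b := 2) (by norm_num) h0.le h1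
    linarith
  set m := ⌊-Real.logb 2 t⌋₊ with hm
  have hc : ((coord x : ℕ+) : ℕ) = m + 1 := by simp [coord, hm, ht]
  have ha : (m : ℝ) ≤ -Real.logb 2 t := Nat.floor_le hl
  have hb : -Real.logb 2 t < (m : ℝ) + 1 := Nat.lt_floor_add_one _
  have ha' : t ≤ ((2 : ℝ) ^ m)⁻¹ := by
    have : Real.logb 2 t ≤ -(m : ℝ) := by linarith
    rw [Real.logb_le_iff_le_rpow (by norm_num) h0, Real.rpow_neg (by norm_num),
      Real.rpow_natCast] at this
    exact this
  have hb' : ((2 : ℝ) ^ (m + 1))⁻¹ < t := by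
    have : -((m + 1 : ℕ) : ℝ) < Real.logb 2 t := by push_cast; linarith
    rw [Real.lt_logb_iff_rpow_lt (by norm_num) h0, Real.rpow_neg (by norm_num),
      Real.rpow_natCast] at this
    exact this
  rw [hc]
  have hpow : 2 * ((2 : ℝ) ^ (m + 1))⁻¹ = ((2 : ℝ) ^ m)⁻¹ := by
    rw [pow_succ]; field_simp
  constructor
  · rw [hpow]; linarith
  · linarith

/-! ### The graphon `W_F` encoding a bounding sequence -/

/-- `B` is nonempty and `A` is either `B` without one copy of `min B`, or `{min B}`. -/
def IsMinFactor (A B : ℕ+ →₀ ℕ) : Prop :=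
  ∃ m ∈ B.support, (∀ n ∈ B.support, m ≤ n) ∧
    (A = B - Finsupp.single m 1 ∨ A = Finsupp.single m 1)

/-- The positive part of the coefficient of `z^{M_j}` in `p_i`. -/
def coeffPos (P : BoundingSequence) (i j : ℕ+) : ℝ :=
  max (MvPolynomial.coeff (M j) (P.p i)) 0

/-- The negative part of the coefficient of `z^{M_j}` in `p_i`. -/
def coeffNeg (P : BoundingSequence) (i j : ℕ+) : ℝ :=
  max (-MvPolynomial.coeff (M j) (P.p i)) 0

open Classical in
/-- The part of `W_F` on `[0,2/3)² \ [1/3,2/3)²`. -/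
def WFstructure (x y : ℝ) : ℝ :=
  if (x ∈ Set.Ico (1 / 6 : ℝ) (1 / 3) ∧ y ∈ Set.Ico (1 / 6 : ℝ) (1 / 3) ∧
        coord (3 * x) = coord (3 * y)) ∨
      (x ∈ Set.Ico (1 / 3 : ℝ) (2 / 3) ∧ y ∈ Set.Ico (1 / 6 : ℝ) (1 / 3) ∧
        IsMinFactor (M (coord (3 * x))) (M (coord (3 * y)))) ∨
      (y ∈ Set.Ico (1 / 3 : ℝ) (2 / 3) ∧ x ∈ Set.Ico (1 / 6 : ℝ) (1 / 3) ∧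
        IsMinFactor (M (coord (3 * y))) (M (coord (3 * x))))
  then 1 else 0

open Classical in
/-- The graphon `W_F`; the floors `⌊3x⌋`, `⌊3y⌋` (which are `0`, `1` or `2` for points of
`[0,1)`) tell in which third the two coordinates lie. -/
def WF (P : BoundingSequence) (x y : ℝ) : ℝ :=
  if ⌊3 * x⌋ = 2 ∧ ⌊3 * y⌋ = 0 then
    9 * 2 ^ (2 * (coord (3 * y) : ℕ)) * coeffPos P (coord (3 * x)) (coord (3 * y))
  else if ⌊3 * x⌋ = 2 ∧ ⌊3 * y⌋ = 1 then
    9 * 2 ^ (2 * (coord (3 * y) : ℕ)) * coeffNeg P (coord (3 * x)) (coord (3 * y))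
  else if ⌊3 * x⌋ = 0 ∧ ⌊3 * y⌋ = 2 then
    9 * 2 ^ (2 * (coord (3 * x) : ℕ)) * coeffPos P (coord (3 * y)) (coord (3 * x))
  else if ⌊3 * x⌋ = 1 ∧ ⌊3 * y⌋ = 2 then
    9 * 2 ^ (2 * (coord (3 * x) : ℕ)) * coeffNeg P (coord (3 * y)) (coord (3 * x))
  else if ⌊3 * x⌋ = 1 ∧ ⌊3 * y⌋ = 1 then
    if coord (3 * x) = coord (3 * y) then 1 - P.u (coord (3 * x)) else 0
  else if ⌊3 * x⌋ = 2 ∧ ⌊3 * y⌋ = 2 then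
    if coord (3 * x) = coord (3 * y) then P.l (coord (3 * x)) else 0
  else WFstructure x y

/-- An embedding of graphons into larger graphons: to every graphon `W` it assigns a graphon
`U W` in which `W` sits, linearly rescaled, on the seventh of the consecutive parts
`A, …, G = [k/13, (k+1)/13)`, `k = 0, …, 6`.  The assignment of a finitely forcible
graphon `W_0` to `W_F` given by the universality theorem for finitely forcible graphons is
of this form; finite forcibility is not required here. -/
def IsUniversalEmbedding (U : (ℝ → ℝ → ℝ) → ℝ → ℝ → ℝ) : Prop :=
  ∀ W, IsGraphon W → IsGraphon (U W) ∧
    ∀ x ∈ Set.Ico (0 : ℝ) 1, ∀ y ∈ Set.Ico (0 : ℝ) 1,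
      U W ((6 + x) / 13) ((6 + y) / 13) = W x y

/-! ### The graphon `W_P(z)` -/

/-- The parts `A, B, C, D_A, …, D_G, E, F, Q, R`; `D 0, …, D 6` stand for
`D_A, …, D_G`. -/
inductive GPart where
  | A | B | C
  | D (k : Fin 7)
  | E | F | Q | R

/-- The left end of a part. -/
def GPart.left : GPart → ℝ
  | .A => 0
  | .B => 1 / 25
  | .C => 2 / 25
  | .D k => (3 + ((k : ℕ) : ℝ)) / 25
  | .E => 10 / 25
  | .F => 11 / 25
  | .Q => 12 / 25
  | .R => 24 / 25

/-- The length of a part. -/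
def GPart.size : GPart → ℝ
  | .Q => 12 / 25
  | _ => 1 / 25

/-- The linear map `ι_X` from `[0,1)` to the part `X`. -/
def GPart.iota (X : GPart) (x : ℝ) : ℝ := X.left + X.size * x

/-- The part containing the point `s` of `[0,1)`. -/
def partOf (s : ℝ) : GPart :=
  if s < 1 / 25 then .A
  else if s < 2 / 25 then .B
  else if s < 3 / 25 then .C
  else if s < 4 / 25 then .D 0
  else if s < 5 / 25 then .D 1
  else if s < 6 / 25 then .D 2
  else if s < 7 / 25 then .D 3
  else if s < 8 / 25 then .D 4
  else if s < 9 / 25 then .D 5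
  else if s < 10 / 25 then .D 6
  else if s < 11 / 25 then .E
  else if s < 12 / 25 then .F
  else if s < 24 / 25 then .Q
  else .R

/-- The relative coordinate of `s` in its part, i.e. `ι_X⁻¹(s)`. -/
def relCoord (s : ℝ) : ℝ := (s - (partOf s).left) / (partOf s).size

theorem partOf_iota (X : GPart) (x : ℝ) (hx : x ∈ Set.Ico (0 : ℝ) 1) :
    partOf (X.iota x) = X ∧ relCoord (X.iota x) = x := by
  obtain ⟨h0, h1⟩ := hx
  have h : partOf (X.iota x) = X := by
    obtain ⟨s, hs⟩ : ∃ s, s = GPart.iota X x := ⟨_, rfl⟩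
    rw [← hs]
    cases X with
    | D k =>
      have h2 : s = (3 + ((k : ℕ) : ℝ)) / 25 + 1 / 25 * x := hs
      clear hs
      unfold partOf
      fin_cases k <;> norm_num only [Nat.cast_ofNat, Nat.cast_zero, Nat.cast_one] at h2 <;>
        (repeat refine (if_neg (by linarith)).trans ?_) <;> exact if_pos (by linarith)
    | _ =>
      simp only [GPart.iota, GPart.left, GPart.size] at hs
      unfold partOf
      (repeat refine (if_neg (by linarith)).trans ?_) <;>
        first | rfl | exact if_pos (by linarith)
  refine ⟨h, ?_⟩
  have hs : X.size ≠ 0 := by cases X <;> norm_num [GPart.size]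
  rw [relCoord, h, GPart.iota]
  field_simp
  ring

open Classical in
/-- The tiles `A×A, …, A×E`. -/
def tileA (x y : ℝ) : ℝ := if ⌊3 * x⌋ = ⌊3 * y⌋ then 1 else 0

open Classical in
/-- The tiles `B×B, …, B×E`. -/
def tileB (x y : ℝ) : ℝ :=
  if ⌊3 * x⌋ = ⌊3 * y⌋ ∧ coord (3 * x) = coord (3 * y) then 1 else 0

open Classical in
/-- The half-graphon, on the tiles `X×F`. -/
def tileHalf (x y : ℝ) : ℝ := if 1 ≤ x + y then 1 else 0

open Classical in
/-- The tile `C×C`. -/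
def tileCC (z : ℕ+ → ℝ) (x y : ℝ) : ℝ :=
  if coord (3 * x) = coord (3 * y) then
    if (⌊3 * x⌋ = 0 ∧ ⌊3 * y⌋ = 0) ∨ (⌊3 * x⌋ = 1 ∧ ⌊3 * y⌋ = 1) then
      monomialValue (M (coord (3 * x))) z
    else if (⌊3 * x⌋ = 0 ∧ ⌊3 * y⌋ = 1) ∨ (⌊3 * x⌋ = 1 ∧ ⌊3 * y⌋ = 0) then
      1 - monomialValue (M (coord (3 * x))) z
    else 0
  else 0

open Classical in
/-- The tiles `C×D_A, …, C×D_G`. -/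
def tileCD (P : BoundingSequence) (k : Fin 7) (x y : ℝ) : ℝ :=
  if k = 0 then
    if ⌊3 * x⌋ = 0 ∧ ⌊3 * y⌋ = 1 ∧ coord (3 * x) = coord (3 * y) then 1 else 0
  else if k = 1 then
    if ⌊3 * x⌋ = 0 ∧ ⌊3 * y⌋ = 2 ∧ coord (3 * x) = coord (3 * y) then 1 else 0
  else if k = 2 then
    if x ∈ Set.Ico (0 : ℝ) (1 / 6) ∧ y ∈ Set.Ico (0 : ℝ) (1 / 6) then 1 else 0
  else if k = 6 then
    if (x ∈ Set.Ico (0 : ℝ) (1 / 3) ∧ y ∈ Set.Ico (0 : ℝ) (2 / 3)) ∨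
        (x ∈ Set.Ico (0 : ℝ) (2 / 3) ∧ y ∈ Set.Ico (2 / 3 : ℝ) 1) then WF P x y else 0
  else 0

open Classical in
/-- The tile `C×E`. -/
def tileCE (P : BoundingSequence) (z : ℕ+ → ℝ) (x y : ℝ) : ℝ :=
  let k := coord (3 * x)
  let p := MvPolynomial.eval z (P.p k)
  let v := (2 : ℝ) ^ (k : ℕ) * (3 * y - 1) + 2
  let w := (2 : ℝ) ^ (k : ℕ) * (3 * y - 2) + 2
  if (⌊3 * x⌋ = 0 ∧ ⌊3 * y⌋ = 0 ∧ 0 ≤ v ∧ v ≤ p) ∨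
      (⌊3 * x⌋ = 0 ∧ ⌊3 * y⌋ = 1 ∧ 0 ≤ w ∧ w ≤ 1 - p) ∨
      (⌊3 * x⌋ = 1 ∧ ⌊3 * y⌋ = 0 ∧ v ≤ 1 ∧ p ≤ v) ∨
      (⌊3 * x⌋ = 1 ∧ ⌊3 * y⌋ = 1 ∧ w ≤ 1 ∧ 1 - p ≤ w)
  then 1 else 0

open Classical in
/-- The tile `D_G×E`. -/
def tileDGE (P : BoundingSequence) (x y : ℝ) : ℝ :=
  let k := coord (3 * y)
  let v := (2 : ℝ) ^ (k : ℕ) * (3 * y - 1) + 2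
  if ⌊3 * y⌋ = 0 ∧ coord (3 * x) = k ∧
      ((⌊3 * x⌋ = 1 ∧ v ≤ P.u k) ∨ (⌊3 * x⌋ = 2 ∧ v ≤ P.l k))
  then 1 else 0

/-- The values of `W_P(z)` on the tiles `X×Y`, in relative coordinates, where `X` precedes or
equals `Y` and neither of them is `Q` or `R`. -/
def upperTile (U : (ℝ → ℝ → ℝ) → ℝ → ℝ → ℝ) (P : BoundingSequence) (z : ℕ+ → ℝ) :
    GPart → GPart → ℝ → ℝ → ℝ
  | .A, .F => tileHalf
  | .A, _ => tileA
  | .B, .F => tileHalf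
  | .B, _ => tileB
  | .C, .C => tileCC z
  | .C, .D k => tileCD P k
  | .C, .E => tileCE P z
  | .D j, .D k => fun x y =>
      U (WF P) ((((j : ℕ) : ℝ) + x) / 13) ((((k : ℕ) : ℝ) + y) / 13)
  | .D j, .E => fun x y => if j = 6 then tileDGE P x y else 0
  | .D _, .F => tileHalf
  | .F, .F => tileHalf
  | _, _ => fun _ _ => 0

/-- The values of `W_P(z)` on the tiles `X×Y`, `X, Y ∈ {A, B, C, D_A, …, D_G, E, F}`. -/
def innerTile (U : (ℝ → ℝ → ℝ) → ℝ → ℝ → ℝ) (P : BoundingSequence) (z : ℕ+ → ℝ)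
    (X Y : GPart) (x y : ℝ) : ℝ :=
  if X.left ≤ Y.left then upperTile U P z X Y x y else upperTile U P z Y X y x

/-- `∫_{[0,1)} W_P(ι_X(x), ι_Z(t)) dt`. -/
def relDeg (U : (ℝ → ℝ → ℝ) → ℝ → ℝ → ℝ) (P : BoundingSequence) (z : ℕ+ → ℝ)
    (X Z : GPart) (x : ℝ) : ℝ :=
  ∫ t in Set.Ico (0 : ℝ) 1, innerTile U P z X Z x t

/-- The value of `W_P(z)` at `(ι_X(x), ι_Q(y))`, for `X ∈ {A, B, C, D_A, …, D_G, E, F}`. -/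
def tileQ (U : (ℝ → ℝ → ℝ) → ℝ → ℝ → ℝ) (P : BoundingSequence) (z : ℕ+ → ℝ)
    (X : GPart) (x : ℝ) : ℝ :=
  (1 / 12) * (12 - (relDeg U P z X .A x + relDeg U P z X .B x + relDeg U P z X .C x +
    (∑ k : Fin 7, relDeg U P z X (.D k) x) + relDeg U P z X .E x + relDeg U P z X .F x))

/-- The value of `W_P(z)` on the tile `X×R`: `1/25, …, 12/25` for the twelve parts
`A, …, F`, then `1` for `Q` and `0` for `R`. -/
def tileR : GPart → ℝ
  | .Q => 1
  | .R => 0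
  | X => X.left + 1 / 25

/-- The values of `W_P(z)` on all tiles, in relative coordinates. -/
def tile (U : (ℝ → ℝ → ℝ) → ℝ → ℝ → ℝ) (P : BoundingSequence) (z : ℕ+ → ℝ) :
    GPart → GPart → ℝ → ℝ → ℝ
  | X, .R => fun _ _ => tileR X
  | .R, Y => fun _ _ => tileR Y
  | .Q, .Q => fun _ _ => 1
  | X, .Q => fun x _ => tileQ U P z X x
  | .Q, Y => fun _ y => tileQ U P z Y y
  | X, Y => innerTile U P z X Y

/-- The graphon `W_P(z)`, with `U (WF P)` in the role of `W_0`. -/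
def WP (U : (ℝ → ℝ → ℝ) → ℝ → ℝ → ℝ) (P : BoundingSequence) (z : ℕ+ → ℝ) (s t : ℝ) : ℝ :=
  tile U P z (partOf s) (partOf t) (relCoord s) (relCoord t)

/-- The `L_1`-distance of two bounding sequences. -/
def l1Dist (U : (ℝ → ℝ → ℝ) → ℝ → ℝ → ℝ) (P P' : BoundingSequence) : ℝ :=
  ⨆ z : cube, ∫ s in Set.Ico (0 : ℝ) 1 ×ˢ Set.Ico (0 : ℝ) 1,
    |WP U P z s.1 s.2 - WP U P' z s.1 s.2|

end GraphonFamily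

end

/-!
Cut `[0,1)` into countably many cells: the dyadic classes of the first two thirds of `C` and
of `E`, each class of `E` being cut further at the levels where `C × E` may jump, and one
remaining cell.  Assigning cells to the vertices of `H` splits `τ(H, W_P(z))` into countably many
integrals, which are the `q_{P,H'}(z)`.

The columns of `C × C` and `C × E` over one class have measures adding up to a value that does not
depend on `z`.  So `z` enters `W_P(z)` only through the values on `C × C` and the position of the
jump on `C × E`; neither the degrees nor the tiles with `Q` feel it.  Given the cells of two points,
the `z`-dependent value of `W_P(z)` is therefore one fixed polynomial, and replacing a cell with
`z`-dependent ends by the `z`-independent hull of its class costs the polynomial factor by which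
their lengths differ.  Hence each integral is a number independent of `z` times a polynomial.

Let `‖q‖_ρ` be the `ℓ¹` norm of the coefficients with weights `ρ ^ Σ(M_i)`, so that the `i`-th
coefficient is at most `‖q‖_ρ ρ ^ (-Σ(M_i))`.  A cell of index `k` has length of order `2 ^ (-k)`,
while the polynomials at its at most `n` incident pairs have norm of order `ρ ^ (n k)` altogether:
for `ρ = 2 ^ (1 / (n + 1))` their product is still summable over all assignments.
-/

noncomputable section

namespace GraphonFamily

open Set MvPolynomial

/-! ### Weighted `ℓ¹` norms of polynomials -/

section WeightedNorm

variable {σ R : Type*} [SeminormedCommRing R]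

/-- The `ℓ¹` norm of the coefficients of `q`, with the weight `ρ ^ d` on the monomials of weighted
degree `d`, where the variable `z_i` has degree `w i`. -/
def weightedNorm (w : σ → ℕ) (ρ : ℝ) (q : MvPolynomial σ R) : ℝ :=
  ∑ m ∈ q.support, ‖coeff m q‖ * ρ ^ Finsupp.weight w m

variable (w : σ → ℕ) (ρ : ℝ)

theorem weightedNorm_eq_sum {q : MvPolynomial σ R} {s : Finset (σ →₀ ℕ)} (hs : q.support ⊆ s) :
    weightedNorm w ρ q = ∑ m ∈ s, ‖coeff m q‖ * ρ ^ Finsupp.weight w m :=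
  Finset.sum_subset hs fun m _ hm => by rw [notMem_support_iff.mp hm, norm_zero, zero_mul]

theorem weightedNorm_zero : weightedNorm w ρ (0 : MvPolynomial σ R) = 0 := by
  simp [weightedNorm]

theorem weightedNorm_neg (q : MvPolynomial σ R) : weightedNorm w ρ (-q) = weightedNorm w ρ q := by
  simp [weightedNorm]

theorem weightedNorm_monomial (m : σ →₀ ℕ) (a : R) :
    weightedNorm w ρ (monomial m a) = ‖a‖ * ρ ^ Finsupp.weight w m := by
  classical
  rw [weightedNorm_eq_sum w ρ support_monomial_subset, Finset.sum_singleton, coeff_monomial,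
    if_pos rfl]

theorem weightedNorm_C (a : R) : weightedNorm w ρ (C a) = ‖a‖ := by
  rw [← monomial_zero', weightedNorm_monomial, map_zero, pow_zero, mul_one]

theorem weightedNorm_one [NormOneClass R] : weightedNorm w ρ (1 : MvPolynomial σ R) = 1 := by
  rw [← C_1, weightedNorm_C, norm_one]

variable {ρ}

theorem weightedNorm_nonneg (hρ : 0 ≤ ρ) (q : MvPolynomial σ R) : 0 ≤ weightedNorm w ρ q :=
  Finset.sum_nonneg fun _ _ => by positivity

theorem weightedNorm_add_le (hρ : 0 ≤ ρ) (p q : MvPolynomial σ R) :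
    weightedNorm w ρ (p + q) ≤ weightedNorm w ρ p + weightedNorm w ρ q := by
  classical
  rw [weightedNorm_eq_sum w ρ support_add, weightedNorm_eq_sum w ρ Finset.subset_union_left,
    weightedNorm_eq_sum (q := q) w ρ Finset.subset_union_right, ← Finset.sum_add_distrib]
  refine Finset.sum_le_sum fun m _ => ?_
  rw [coeff_add, ← add_mul]
  gcongr
  exact norm_add_le _ _

theorem weightedNorm_sub_le (hρ : 0 ≤ ρ) (p q : MvPolynomial σ R) :
    weightedNorm w ρ (p - q) ≤ weightedNorm w ρ p + weightedNorm w ρ q := by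
  rw [sub_eq_add_neg, ← weightedNorm_neg w ρ q]
  exact weightedNorm_add_le w hρ p (-q)

theorem weightedNorm_sum_le (hρ : 0 ≤ ρ) {ι : Type*} (s : Finset ι) (f : ι → MvPolynomial σ R) :
    weightedNorm w ρ (∑ i ∈ s, f i) ≤ ∑ i ∈ s, weightedNorm w ρ (f i) :=
  Finset.le_sum_of_subadditive _ (weightedNorm_zero w ρ).le (weightedNorm_add_le w hρ) s f

theorem weightedNorm_mul_le (hρ : 0 ≤ ρ) (p q : MvPolynomial σ R) :
    weightedNorm w ρ (p * q) ≤ weightedNorm w ρ p * weightedNorm w ρ q := by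
  have expand : p * q = ∑ m ∈ p.support, ∑ m' ∈ q.support,
      monomial (m + m') (coeff m p * coeff m' q) := by
    conv_lhs => rw [p.as_sum, q.as_sum]
    simp only [Finset.sum_mul_sum, monomial_mul]
  calc weightedNorm w ρ (p * q)
      ≤ ∑ m ∈ p.support, ∑ m' ∈ q.support,
          weightedNorm w ρ (monomial (m + m') (coeff m p * coeff m' q)) := by
        rw [expand]
        exact (weightedNorm_sum_le w hρ _ _).trans
          (Finset.sum_le_sum fun m _ => weightedNorm_sum_le w hρ _ _)
    _ ≤ ∑ m ∈ p.support, ∑ m' ∈ q.support, (‖coeff m p‖ * ρ ^ Finsupp.weight w m) *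
          (‖coeff m' q‖ * ρ ^ Finsupp.weight w m') := by
        gcongr with m _ m' _
        rw [weightedNorm_monomial, map_add, pow_add, mul_mul_mul_comm]
        gcongr
        exact norm_mul_le _ _
    _ = weightedNorm w ρ p * weightedNorm w ρ q := (Finset.sum_mul_sum _ _ _ _).symm

theorem weightedNorm_prod_le [NormOneClass R] (hρ : 0 ≤ ρ) {ι : Type*} (s : Finset ι)
    (f : ι → MvPolynomial σ R) :
    weightedNorm w ρ (∏ i ∈ s, f i) ≤ ∏ i ∈ s, weightedNorm w ρ (f i) :=
  Finset.le_prod_of_submultiplicative_of_nonneg _ (weightedNorm_nonneg w hρ)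
    (weightedNorm_one w ρ).le (weightedNorm_mul_le w hρ) s f

theorem norm_coeff_mul_pow_le_weightedNorm (hρ : 0 ≤ ρ) (q : MvPolynomial σ R) (m : σ →₀ ℕ) :
    ‖coeff m q‖ * ρ ^ Finsupp.weight w m ≤ weightedNorm w ρ q := by
  classical
  rw [weightedNorm_eq_sum w ρ (Finset.subset_insert m q.support)]
  exact Finset.single_le_sum (f := fun m => ‖coeff m q‖ * ρ ^ Finsupp.weight w m)
    (fun _ _ => by positivity) (Finset.mem_insert_self m _)

theorem norm_eval_le_weightedNorm_one [NormOneClass R] {z : σ → R} (hz : ∀ i, ‖z i‖ ≤ 1)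
    (q : MvPolynomial σ R) : ‖eval z q‖ ≤ weightedNorm w 1 q := by
  rw [eval_eq]
  refine (norm_sum_le _ _).trans (Finset.sum_le_sum fun m _ => (norm_mul_le _ _).trans ?_)
  have hpow (i : σ) : ‖z i ^ m i‖ ≤ 1 :=
    (norm_pow_le _ _).trans (pow_le_one₀ (norm_nonneg _) (hz i))
  rw [one_pow]
  gcongr
  exact Finset.prod_induction _ (‖·‖ ≤ 1)
    (fun _ _ ha hb => (norm_mul_le _ _).trans (mul_le_one₀ ha (norm_nonneg _) hb))
    norm_one.le fun i _ => hpow i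

theorem exists_forall_norm_eval_and_pderiv_le [NormOneClass R] (q : MvPolynomial σ R) :
    ∃ B, 0 ≤ B ∧ ∀ z : σ → R, (∀ i, ‖z i‖ ≤ 1) →
      ‖eval z q‖ ≤ B ∧ ∀ i, ‖eval z (pderiv i q)‖ ≤ B := by
  let N (p : MvPolynomial σ R) : ℝ := weightedNorm 0 1 p
  have hN (p : MvPolynomial σ R) : 0 ≤ N p := weightedNorm_nonneg 0 zero_le_one p
  have hsum : 0 ≤ ∑ i ∈ q.vars, N (pderiv i q) := Finset.sum_nonneg fun i _ => hN _
  refine ⟨N q + ∑ i ∈ q.vars, N (pderiv i q), add_nonneg (hN q) hsum, fun z hz =>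
    ⟨(norm_eval_le_weightedNorm_one 0 hz q).trans (le_add_of_nonneg_right hsum), fun i => ?_⟩⟩
  by_cases hi : i ∈ q.vars
  · calc ‖eval z (pderiv i q)‖ ≤ N (pderiv i q) := norm_eval_le_weightedNorm_one 0 hz _
      _ ≤ ∑ i ∈ q.vars, N (pderiv i q) :=
        Finset.single_le_sum (f := fun i => N (pderiv i q)) (fun _ _ => hN _) hi
      _ ≤ N q + ∑ i ∈ q.vars, N (pderiv i q) := le_add_of_nonneg_left (hN q)
  · rw [pderiv_eq_zero_of_notMem_vars hi, map_zero, norm_zero]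
    exact add_nonneg (hN q) hsum

end WeightedNorm

/-! ### Products -/

theorem norm_prod_sub_prod_le {R ι : Type*} [NormedCommRing R] [NormOneClass R]
    (s : Finset ι) {a b : ι → R} (ha : ∀ i ∈ s, ‖a i‖ ≤ 1) (hb : ∀ i ∈ s, ‖b i‖ ≤ 1) :
    ‖∏ i ∈ s, a i - ∏ i ∈ s, b i‖ ≤ ∑ i ∈ s, ‖a i - b i‖ := by
  classical
  induction s using Finset.induction_on with
  | empty => simp
  | insert i s hi ih =>
    rw [Finset.forall_mem_insert] at ha hb
    have ha_prod : ‖∏ j ∈ s, a j‖ ≤ 1 :=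
      (Finset.norm_prod_le s a).trans (Finset.prod_le_one (fun _ _ => norm_nonneg _) ha.2)
    rw [Finset.prod_insert hi, Finset.prod_insert hi, Finset.sum_insert hi]
    calc ‖a i * ∏ j ∈ s, a j - b i * ∏ j ∈ s, b j‖
        = ‖(a i - b i) * ∏ j ∈ s, a j + b i * (∏ j ∈ s, a j - ∏ j ∈ s, b j)‖ := by ring_nf
      _ ≤ ‖a i - b i‖ * ‖∏ j ∈ s, a j‖ + ‖b i‖ * ‖∏ j ∈ s, a j - ∏ j ∈ s, b j‖ :=
          norm_add_le_of_le (norm_mul_le _ _) (norm_mul_le _ _)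
      _ ≤ ‖a i - b i‖ * 1 + 1 * ∑ j ∈ s, ‖a j - b j‖ := by
          gcongr
          exacts [hb.1, ih ha.2 hb.2]
      _ = ‖a i - b i‖ + ∑ j ∈ s, ‖a j - b j‖ := by rw [mul_one, one_mul]

theorem prod_mem_Icc_zero_one {ι : Type*} {s : Finset ι} {f : ι → ℝ}
    (hf : ∀ i ∈ s, f i ∈ Icc (0 : ℝ) 1) : ∏ i ∈ s, f i ∈ Icc (0 : ℝ) 1 :=
  ⟨Finset.prod_nonneg fun i hi => (hf i hi).1,
    Finset.prod_le_one (fun i hi => (hf i hi).1) fun i hi => (hf i hi).2⟩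

theorem abs_le_one_of_mem_Icc {a : ℝ} (ha : a ∈ Icc (0 : ℝ) 1) : |a| ≤ 1 :=
  abs_le.mpr ⟨neg_one_lt_zero.le.trans ha.1, ha.2⟩

theorem one_sub_mem_Icc_zero_one {a : ℝ} (ha : a ∈ Icc (0 : ℝ) 1) : 1 - a ∈ Icc (0 : ℝ) 1 :=
  ⟨sub_nonneg.mpr ha.2, sub_le_self _ ha.1⟩

theorem summable_prod_apply {κ : Type*} [Fintype κ] {ι : κ → Type*} {g : ∀ k, ι k → ℝ}
    (hg_nonneg : ∀ k c, 0 ≤ g k c) (hg : ∀ k, Summable (g k)) :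
    Summable fun h : ∀ k, ι k => ∏ k, g k (h k) := by
  classical
  refine summable_of_sum_le (c := ∏ k, ∑' c, g k c)
    (fun _ => Finset.prod_nonneg fun k _ => hg_nonneg k _) fun s => ?_
  have hs : s ⊆ Fintype.piFinset fun k => s.image (· k) := fun h hh =>
    Fintype.mem_piFinset.mpr fun k => Finset.mem_image_of_mem _ hh
  calc ∑ h ∈ s, ∏ k, g k (h k)
      ≤ ∑ h ∈ Fintype.piFinset fun k => s.image (· k), ∏ k, g k (h k) :=
        Finset.sum_le_sum_of_subset_of_nonneg hs fun _ _ _ =>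
          Finset.prod_nonneg fun k _ => hg_nonneg k _
    _ = ∏ k, ∑ c ∈ s.image (· k), g k c := (Finset.prod_univ_sum _ _).symm
    _ ≤ ∏ k, ∑' c, g k c := by
        gcongr with k
        · exact fun k _ => Finset.sum_nonneg fun c _ => hg_nonneg k c
        · exact (hg k).sum_le_tsum _ fun c _ => hg_nonneg k c

/-! ### Integrals over products -/

section ProductIntegrals

variable {κ : Type*} [Fintype κ]

theorem pi_nnreal_smul {α : κ → Type*} [∀ i, MeasurableSpace (α i)] (r : κ → NNReal)
    (μ : ∀ i, Measure (α i)) [∀ i, SigmaFinite (μ i)] :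
    Measure.pi (fun i => r i • μ i) = (∏ i, r i) • Measure.pi μ := by
  refine Measure.pi_eq fun s _ => ?_
  simp only [Measure.smul_apply, Measure.pi_pi, ENNReal.smul_def, smul_eq_mul,
    Finset.prod_mul_distrib, ENNReal.ofNNReal_finsetProd]

theorem integral_pi_eq_prod_mul_of_map_eq_smul {α : κ → Type*} [∀ i, MeasurableSpace (α i)]
    (μ ν : ∀ i, Measure (α i)) [∀ i, IsFiniteMeasure (μ i)] [∀ i, IsFiniteMeasure (ν i)]
    {c : ∀ i, α i → α i} (hc : ∀ i, Measurable (c i)) {r : κ → NNReal}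
    (hr : ∀ i, (μ i).map (c i) = r i • (ν i).map (c i)) {F : (∀ i, α i) → ℝ} (hF : Measurable F)
    (hμ : ∀ᵐ x ∂Measure.pi μ, F x = F fun i => c i (x i))
    (hν : ∀ᵐ x ∂Measure.pi ν, F x = F fun i => c i (x i)) :
    ∫ x, F x ∂Measure.pi μ = (∏ i, (r i : ℝ)) * ∫ x, F x ∂Measure.pi ν := by
  have hm : Measurable fun (x : ∀ i, α i) i => c i (x i) :=
    measurable_pi_lambda _ fun i => (hc i).comp (measurable_pi_apply i)
  rw [integral_congr_ae hμ, integral_congr_ae hν,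
    ← integral_map hm.aemeasurable hF.aestronglyMeasurable,
    ← integral_map hm.aemeasurable hF.aestronglyMeasurable,
    Measure.pi_map_pi fun i => (hc i).aemeasurable, Measure.pi_map_pi fun i => (hc i).aemeasurable]
  simp only [hr]
  rw [pi_nnreal_smul, integral_smul_nnreal_measure, NNReal.smul_def, smul_eq_mul, NNReal.coe_prod]

theorem ae_pi_of_forall_ae {α : κ → Type*} [∀ i, MeasurableSpace (α i)] {μ : ∀ i, Measure (α i)}
    [∀ i, SigmaFinite (μ i)] {p : ∀ i, α i → Prop} (hp : ∀ i, ∀ᵐ s ∂μ i, p i s) :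
    ∀ᵐ x ∂Measure.pi μ, ∀ i, p i (x i) :=
  ae_all_iff.mpr fun i => Measure.tendsto_eval_ae_ae.eventually (hp i)

theorem measurePreserving_eval_prodMk_eval {α : κ → Type*} [∀ i, MeasurableSpace (α i)]
    (μ : ∀ i, Measure (α i)) [∀ i, IsProbabilityMeasure (μ i)] {i j : κ} (hij : i ≠ j) :
    MeasurePreserving (fun x : ∀ i, α i => (x i, x j)) (Measure.pi μ) ((μ i).prod (μ j)) := by
  have hindep := (ProbabilityTheory.iIndepFun_pi (μ := μ) (X := fun _ x => x)
    fun _ => aemeasurable_id).indepFun hij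
  refine ⟨(measurable_pi_apply i).prodMk (measurable_pi_apply j), ?_⟩
  rw [(ProbabilityTheory.indepFun_iff_map_prod_eq_prod_map_map
    (measurable_pi_apply i).aemeasurable (measurable_pi_apply j).aemeasurable).mp hindep]
  exact congrArg₂ _ (measurePreserving_eval μ i).map_eq (measurePreserving_eval μ j).map_eq

end ProductIntegrals

theorem hasSum_integral_pi_iUnion {κ α ι : Type*} [Finite κ] [MeasurableSpace α]
    [Countable ι]
    {ν : Measure (κ → α)} {A : ι → Set α} (hA : ∀ c, MeasurableSet (A c))
    (hdisj : Pairwise (Function.onFun Disjoint A)) {F : (κ → α) → ℝ}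
    (hF : IntegrableOn F (univ.pi fun _ => ⋃ c, A c) ν) :
    HasSum (fun h : κ → ι => ∫ x in univ.pi fun i => A (h i), F x ∂ν)
      (∫ x in univ.pi fun _ => ⋃ c, A c, F x ∂ν) := by
  rw [← iUnion_univ_pi] at hF ⊢
  refine hasSum_integral_iUnion (fun h => .univ_pi fun i => hA (h i)) (fun h h' hne => ?_) hF
  obtain ⟨i, hi⟩ := Function.ne_iff.mp hne
  exact disjoint_univ_pi.mpr ⟨i, hdisj hi⟩

theorem setIntegral_Ico_mem_Icc {f : ℝ → ℝ} (hf : ∀ x, f x ∈ Icc (0 : ℝ) 1) :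
    ∫ t in Ico (0 : ℝ) 1, f t ∈ Icc (0 : ℝ) 1 := by
  refine ⟨integral_nonneg fun t => (hf t).1, (Real.le_norm_self _).trans ?_⟩
  simpa using norm_setIntegral_le_of_norm_le_const (μ := volume) (s := Ico (0 : ℝ) 1) (C := 1)
    measure_Ico_lt_top fun t _ => (Real.norm_eq_abs (f t)).trans_le (abs_le_one_of_mem_Icc (hf t))

instance : IsProbabilityMeasure (volume.restrict (Ico (0 : ℝ) 1)) := ⟨by simp⟩

theorem integrableOn_pi_Ico_of_abs_le {κ : Type*} [Fintype κ] {f : (κ → ℝ) → ℝ}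
    (hf : Measurable f) {C : ℝ} (hC : ∀ x, |f x| ≤ C) :
    IntegrableOn f (univ.pi fun _ => Ico 0 1) := by
  have : IsFiniteMeasure
      ((volume : Measure (κ → ℝ)).restrict (univ.pi fun _ => Ico (0 : ℝ) 1)) := by
    rw [volume_pi, Measure.restrict_pi_pi]
    infer_instance
  exact Integrable.of_bound hf.aestronglyMeasurable C (ae_of_all _ hC)

theorem setIntegral_pi_Ico_eval_pair {κ : Type*} [Fintype κ] {i j : κ} (hij : i ≠ j)
    {g : ℝ × ℝ → ℝ} (hg : Measurable g) :
    ∫ x in univ.pi fun _ : κ => Ico (0 : ℝ) 1, g (x i, x j) =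
      ∫ s in Ico (0 : ℝ) 1 ×ˢ Ico (0 : ℝ) 1, g s := by
  have hpreserving := measurePreserving_eval_prodMk_eval
    (fun _ : κ => volume.restrict (Ico (0 : ℝ) 1)) hij
  rw [volume_pi, Measure.restrict_pi_pi, Measure.volume_eq_prod, ← Measure.prod_restrict,
    ← hpreserving.map_eq,
    integral_map hpreserving.measurable.aemeasurable hg.aestronglyMeasurable]

/-! ### The enumeration of multisets -/

theorem weight_eq_finsuppWeight (A : ℕ+ →₀ ℕ) :
    weight A = Finsupp.weight (fun n : ℕ+ => (n : ℕ)) A := by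
  simp only [weight, Finsupp.weight_apply, smul_eq_mul, mul_comm]

theorem weight_le_position (A : ℕ+ →₀ ℕ) : weight A ≤ position A := by
  have hcard : (Finsupp.single (1 : ℕ+) '' Iio (weight A)).ncard = weight A := by
    rw [ncard_image_of_injective _ (Finsupp.single_injective 1), ncard_eq_toFinset_card',
      toFinset_Iio, Nat.card_Iio]
  rw [← hcard]
  refine ncard_le_ncard ?_ (finite_precedes A)
  rintro _ ⟨i, hi, rfl⟩
  exact Or.inl (by simpa [weight] using hi)

theorem weight_M_lt (i : ℕ+) : weight (M i) < i := by
  have h := weight_le_position (M i)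
  rw [position_M] at h
  exact h.trans_lt ((Nat.lt_succ_self _).trans_eq i.natPred_add_one)

theorem monomialValue_mem (A : ℕ+ →₀ ℕ) {z : ℕ+ → ℝ} (hz : z ∈ cube) :
    monomialValue A z ∈ Icc (0 : ℝ) 1 :=
  prod_mem_Icc_zero_one fun n _ => ⟨pow_nonneg (hz n).1 _, pow_le_one₀ (hz n).1 (hz n).2⟩

theorem eval_monomial_one (A : ℕ+ →₀ ℕ) (z : ℕ+ → ℝ) :
    eval z (monomial A (1 : ℝ)) = monomialValue A z := by
  rw [eval_monomial, one_mul, monomialValue]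

theorem zero_mem_cube : (0 : ℕ+ → ℝ) ∈ cube := fun _ => ⟨le_rfl, zero_le_one⟩

/-! ### Dyadic coordinates and parts -/

instance : MeasurableSpace ℕ+ := ⊤

instance : DiscreteMeasurableSpace ℕ+ := ⟨fun _ => trivial⟩

instance : MeasurableSpace GPart := ⊤

instance : DiscreteMeasurableSpace GPart := ⟨fun _ => trivial⟩

instance : Finite GPart :=
  Finite.of_surjective (Sum.elim GPart.D ![.A, .B, .C, .E, .F, .Q, .R]) fun X =>
    match X with
    | .D k => ⟨.inl k, rfl⟩
    | .A => ⟨.inr 0, rfl⟩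
    | .B => ⟨.inr 1, rfl⟩
    | .C => ⟨.inr 2, rfl⟩
    | .E => ⟨.inr 3, rfl⟩
    | .F => ⟨.inr 4, rfl⟩
    | .Q => ⟨.inr 5, rfl⟩
    | .R => ⟨.inr 6, rfl⟩

theorem two_mul_inv_two_pow_le {i j : ℕ} (hij : i < j) :
    2 * ((2 : ℝ) ^ j)⁻¹ ≤ ((2 : ℝ) ^ i)⁻¹ := by
  have h : (2 : ℝ) ^ i * 2 ≤ 2 ^ j := (pow_succ (2 : ℝ) i).symm.trans_le
    (pow_le_pow_right₀ one_le_two hij)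
  rw [← div_eq_mul_inv, ← one_div, div_le_div_iff₀ (by positivity) (by positivity)]
  linarith

theorem coord_eq_iff {x : ℝ} {k : ℕ+} :
    coord x = k ↔ 1 - 2 * ((2 : ℝ) ^ (k : ℕ))⁻¹ ≤ Int.fract x ∧
      Int.fract x < 1 - ((2 : ℝ) ^ (k : ℕ))⁻¹ := by
  refine ⟨fun h => h ▸ coord_spec x, fun hmem => ?_⟩
  obtain ⟨hle, hlt⟩ := hmem
  obtain ⟨hle', hlt'⟩ := coord_spec x
  refine le_antisymm (not_lt.mp fun h => ?_) (not_lt.mp fun h => ?_)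
  all_goals linarith [two_mul_inv_two_pow_le (PNat.coe_lt_coe _ _ |>.mpr h)]

theorem measurable_coord : Measurable coord := by
  refine measurable_to_countable' fun k => ?_
  have : coord ⁻¹' {k} = {x | 1 - 2 * ((2 : ℝ) ^ (k : ℕ))⁻¹ ≤ Int.fract x} ∩
      {x | Int.fract x < 1 - ((2 : ℝ) ^ (k : ℕ))⁻¹} := ext fun _ => coord_eq_iff
  rw [this]
  exact (measurableSet_le measurable_const measurable_fract).inter
    (measurableSet_lt measurable_fract measurable_const)

theorem measurable_third : Measurable fun x : ℝ => ⌊3 * x⌋ :=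
  Int.measurable_floor.comp (measurable_const_mul 3)

theorem measurable_coord_third : Measurable fun x : ℝ => coord (3 * x) :=
  measurable_coord.comp (measurable_const_mul 3)

theorem measurable_of_third_coord {β : Type*} [MeasurableSpace β] (f : ℤ → ℤ → ℕ+ → ℕ+ → β) :
    Measurable fun s : ℝ × ℝ => f ⌊3 * s.1⌋ ⌊3 * s.2⌋ (coord (3 * s.1)) (coord (3 * s.2)) :=
  (measurable_of_countable fun q : (ℤ × ℤ) × (ℕ+ × ℕ+) => f q.1.1 q.1.2 q.2.1 q.2.2).comp <|
    ((measurable_third.comp measurable_fst).prodMk (measurable_third.comp measurable_snd)).prodMk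
      ((measurable_coord_third.comp measurable_fst).prodMk
        (measurable_coord_third.comp measurable_snd))

theorem measurableSet_of_third_coord (p : ℤ → ℤ → ℕ+ → ℕ+ → Prop) :
    MeasurableSet {s : ℝ × ℝ | p ⌊3 * s.1⌋ ⌊3 * s.2⌋ (coord (3 * s.1)) (coord (3 * s.2))} :=
  measurableSet_setOfPred.mpr (measurable_of_third_coord p)

theorem measurable_partOf : Measurable partOf := by
  unfold partOf
  repeat refine Measurable.ite measurableSet_Iio measurable_const ?_
  exact measurable_const

theorem measurable_relCoord : Measurable relCoord :=
  (measurable_id.sub ((measurable_of_countable GPart.left).comp measurable_partOf)).div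
    ((measurable_of_countable GPart.size).comp measurable_partOf)

theorem left_injective : Function.Injective GPart.left := by
  have partOf_left (X : GPart) : partOf X.left = X := by
    simpa [GPart.iota] using (partOf_iota X 0 ⟨le_rfl, one_pos⟩).1
  exact Function.LeftInverse.injective partOf_left

theorem size_pos (X : GPart) : 0 < X.size := by
  cases X <;> norm_num [GPart.size]

theorem mem_Ico_partOf {s : ℝ} (hs : s ∈ Ico (0 : ℝ) 1) :
    s ∈ Ico (partOf s).left ((partOf s).left + (partOf s).size) := by
  have mem_ite {c : Prop} [Decidable c] {X Y : GPart} (hX : c → s ∈ Ico X.left (X.left + X.size))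
      (hY : ¬c → s ∈ Ico Y.left (Y.left + Y.size)) :
      s ∈ Ico (if c then X else Y).left
        ((if c then X else Y).left + (if c then X else Y).size) := by
    split_ifs with h
    exacts [hX h, hY h]
  obtain ⟨h0, h1⟩ := hs
  unfold partOf
  repeat' refine mem_ite (fun _ => ?_) fun _ => ?_
  all_goals constructor <;> norm_num [GPart.left, GPart.size] <;> linarith

theorem relCoord_mem {s : ℝ} (hs : s ∈ Ico (0 : ℝ) 1) : relCoord s ∈ Ico (0 : ℝ) 1 := by
  obtain ⟨hle, hlt⟩ := mem_Ico_partOf hs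
  have hsize := size_pos (partOf s)
  exact ⟨div_nonneg (sub_nonneg.mpr hle) hsize.le, (div_lt_one hsize).mpr (by linarith)⟩

theorem iota_relCoord (s : ℝ) : (partOf s).iota (relCoord s) = s := by
  rw [GPart.iota, relCoord, mul_div_cancel₀ _ (size_pos _).ne', add_sub_cancel]

/-! ### Graphons on the plane -/

/-- A graphon extended to the plane: symmetric and measurable, with values in `[0,1]`, everywhere
rather than on `[0,1)²` only. -/
structure IsPlaneGraphon (W : ℝ → ℝ → ℝ) : Prop where
  meas : Measurable (Function.uncurry W)
  symm : ∀ x y, W x y = W y x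
  mem : ∀ x y, W x y ∈ Icc (0 : ℝ) 1

theorem IsPlaneGraphon.isGraphon {W : ℝ → ℝ → ℝ} (hW : IsPlaneGraphon W) : IsGraphon W where
  meas := hW.meas.comp ((measurable_subtype_coe.comp measurable_fst).prodMk
    (measurable_subtype_coe.comp measurable_snd))
  symm x _ y _ := hW.symm x y
  mem x _ y _ := hW.mem x y

open Classical in
/-- The function that is `W` on `[0,1)²` and `0` elsewhere.  A graphon is unconstrained outside
`[0,1)²`; extending it by zero makes it measurable on the plane without changing any integral. -/
def zeroExtension (W : ℝ → ℝ → ℝ) (x y : ℝ) : ℝ :=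
  if x ∈ Ico (0 : ℝ) 1 ∧ y ∈ Ico (0 : ℝ) 1 then W x y else 0

theorem zeroExtension_of_mem (W : ℝ → ℝ → ℝ) {x y : ℝ} (hx : x ∈ Ico (0 : ℝ) 1)
    (hy : y ∈ Ico (0 : ℝ) 1) : zeroExtension W x y = W x y :=
  if_pos ⟨hx, hy⟩

theorem IsGraphon.isPlaneGraphon_zeroExtension {W : ℝ → ℝ → ℝ} (hW : IsGraphon W) :
    IsPlaneGraphon (zeroExtension W) where
  meas := by
    have hembed : MeasurableEmbedding
        fun s : Ico (0 : ℝ) 1 × Ico (0 : ℝ) 1 => ((s.1 : ℝ), (s.2 : ℝ)) :=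
      (MeasurableEmbedding.subtype_coe measurableSet_Ico).prodMap
        (MeasurableEmbedding.subtype_coe measurableSet_Ico)
    convert hembed.measurable_extend hW.meas (measurable_const (a := (0 : ℝ))) using 1
    ext s
    by_cases h : s.1 ∈ Ico (0 : ℝ) 1 ∧ s.2 ∈ Ico (0 : ℝ) 1
    · have hext := hembed.injective.extend_apply
        (fun s : Ico (0 : ℝ) 1 × Ico (0 : ℝ) 1 => W s.1 s.2) (fun _ => 0) (⟨_, h.1⟩, ⟨_, h.2⟩)
      exact (if_pos h).trans hext.symm
    · refine (if_neg h).trans (Function.extend_apply' (f := fun s : Ico (0 : ℝ) 1 × Ico (0 : ℝ) 1 =>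
        ((s.1 : ℝ), (s.2 : ℝ))) _ (fun _ => (0 : ℝ)) _ ?_).symm
      rintro ⟨a, rfl⟩
      exact h ⟨a.1.2, a.2.2⟩
  symm x y := by
    by_cases h : x ∈ Ico (0 : ℝ) 1 ∧ y ∈ Ico (0 : ℝ) 1
    · rw [zeroExtension, zeroExtension, if_pos h, if_pos h.symm, hW.symm x h.1 y h.2]
    · rw [zeroExtension, zeroExtension, if_neg h, if_neg fun h' => h h'.symm]
  mem x y := ite_mem.mpr ⟨fun h => hW.mem x h.1 y h.2, fun _ => ⟨le_rfl, zero_le_one⟩⟩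

/-! ### The graphon `W_F` -/

theorem two_pow_two_mul_mul_inv_le_one {k : ℕ} (hk : k ≠ 0) :
    (2 : ℝ) ^ (2 * k) * ((2 : ℝ) ^ (2 ^ k))⁻¹ ≤ 1 := by
  obtain ⟨m, rfl⟩ := Nat.exists_eq_succ_of_ne_zero hk
  have h : 2 * (m + 1) ≤ 2 ^ (m + 1) := by
    rw [pow_succ']
    exact Nat.mul_le_mul_left 2 Nat.lt_two_pow_self
  rw [← div_eq_mul_inv, div_le_one (by positivity)]
  exact pow_le_pow_right₀ one_le_two h

theorem nine_mul_two_pow_mul_max_mem {a : ℝ} (k : ℕ+)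
    (ha : |a| ≤ ((2 : ℝ) ^ (2 ^ (k : ℕ)))⁻¹ / 9) :
    9 * 2 ^ (2 * (k : ℕ)) * max a 0 ∈ Icc (0 : ℝ) 1 := by
  have hmax : max a 0 ≤ ((2 : ℝ) ^ (2 ^ (k : ℕ)))⁻¹ / 9 :=
    max_le ((le_abs_self a).trans ha) (by positivity)
  refine ⟨by positivity, ?_⟩
  calc 9 * 2 ^ (2 * (k : ℕ)) * max a 0
      ≤ 9 * 2 ^ (2 * (k : ℕ)) * (((2 : ℝ) ^ (2 ^ (k : ℕ)))⁻¹ / 9) := by gcongr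
    _ = (2 : ℝ) ^ (2 * (k : ℕ)) * ((2 : ℝ) ^ (2 ^ (k : ℕ)))⁻¹ := by ring
    _ ≤ 1 := two_pow_two_mul_mul_inv_le_one k.ne_zero

theorem WF_mem (P : BoundingSequence) (x y : ℝ) : WF P x y ∈ Icc (0 : ℝ) 1 := by
  have coeffPos_mem (i j : ℕ+) : 9 * 2 ^ (2 * (j : ℕ)) * coeffPos P i j ∈ Icc (0 : ℝ) 1 :=
    nine_mul_two_pow_mul_max_mem j (P.coeff_le i j)
  have coeffNeg_mem (i j : ℕ+) : 9 * 2 ^ (2 * (j : ℕ)) * coeffNeg P i j ∈ Icc (0 : ℝ) 1 :=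
    nine_mul_two_pow_mul_max_mem j ((abs_neg _).trans_le (P.coeff_le i j))
  unfold WF WFstructure
  split_ifs
  all_goals first
    | exact coeffPos_mem _ _
    | exact coeffNeg_mem _ _
    | exact P.l_mem _
    | exact one_sub_mem_Icc_zero_one (P.u_mem _)
    | norm_num

theorem WFstructure_symm (x y : ℝ) : WFstructure x y = WFstructure y x := by
  classical
  refine if_congr (or_congr ?_ or_comm) rfl rfl
  exact ⟨fun ⟨hx, hy, h⟩ => ⟨hy, hx, h.symm⟩, fun ⟨hx, hy, h⟩ => ⟨hy, hx, h.symm⟩⟩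

theorem WF_symm (P : BoundingSequence) (x y : ℝ) : WF P x y = WF P y x := by
  have third_cases (a : ℤ) : a = 0 ∨ a = 1 ∨ a = 2 ∨ a ≠ 0 ∧ a ≠ 1 ∧ a ≠ 2 := by omega
  unfold WF
  rw [WFstructure_symm x y]
  by_cases hcoord : coord (3 * x) = coord (3 * y)
  · rcases third_cases ⌊3 * x⌋ with hx | hx | hx | hx <;>
      rcases third_cases ⌊3 * y⌋ with hy | hy | hy | hy <;> simp [hx, hy, hcoord]
  · rcases third_cases ⌊3 * x⌋ with hx | hx | hx | hx <;>
      rcases third_cases ⌊3 * y⌋ with hy | hy | hy | hy <;> simp [hx, hy, hcoord, Ne.symm hcoord]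

theorem measurable_WFstructure : Measurable (Function.uncurry WFstructure) := by
  have measurableSet_fst (a b : ℝ) : MeasurableSet {s : ℝ × ℝ | s.1 ∈ Ico a b} :=
    measurable_fst measurableSet_Ico
  have measurableSet_snd (a b : ℝ) : MeasurableSet {s : ℝ × ℝ | s.2 ∈ Ico a b} :=
    measurable_snd measurableSet_Ico
  unfold WFstructure Function.uncurry
  refine Measurable.ite (.union ?_ (.union ?_ ?_)) measurable_const measurable_const
  · exact (measurableSet_fst _ _).inter ((measurableSet_snd _ _).inter
      (measurableSet_of_third_coord fun _ _ k l => k = l))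
  · exact (measurableSet_fst _ _).inter ((measurableSet_snd _ _).inter
      (measurableSet_of_third_coord fun _ _ k l => IsMinFactor (M k) (M l)))
  · exact (measurableSet_snd _ _).inter ((measurableSet_fst _ _).inter
      (measurableSet_of_third_coord fun _ _ k l => IsMinFactor (M l) (M k)))

theorem measurable_WF (P : BoundingSequence) : Measurable (Function.uncurry (WF P)) := by
  unfold WF Function.uncurry
  refine Measurable.ite (measurableSet_of_third_coord fun a b _ _ => a = 2 ∧ b = 0)
    (measurable_of_third_coord fun _ _ k l => 9 * 2 ^ (2 * (l : ℕ)) * coeffPos P k l) ?_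
  refine Measurable.ite (measurableSet_of_third_coord fun a b _ _ => a = 2 ∧ b = 1)
    (measurable_of_third_coord fun _ _ k l => 9 * 2 ^ (2 * (l : ℕ)) * coeffNeg P k l) ?_
  refine Measurable.ite (measurableSet_of_third_coord fun a b _ _ => a = 0 ∧ b = 2)
    (measurable_of_third_coord fun _ _ k l => 9 * 2 ^ (2 * (k : ℕ)) * coeffPos P l k) ?_
  refine Measurable.ite (measurableSet_of_third_coord fun a b _ _ => a = 1 ∧ b = 2)
    (measurable_of_third_coord fun _ _ k l => 9 * 2 ^ (2 * (k : ℕ)) * coeffNeg P l k) ?_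
  refine Measurable.ite (measurableSet_of_third_coord fun a b _ _ => a = 1 ∧ b = 1)
    (measurable_of_third_coord fun _ _ k l => if k = l then 1 - P.u k else 0) ?_
  exact Measurable.ite (measurableSet_of_third_coord fun a b _ _ => a = 2 ∧ b = 2)
    (measurable_of_third_coord fun _ _ k l => if k = l then P.l k else 0) measurable_WFstructure

theorem isPlaneGraphon_WF (P : BoundingSequence) : IsPlaneGraphon (WF P) :=
  ⟨measurable_WF P, WF_symm P, WF_mem P⟩

/-! ### The tiles of `W_P(z)` -/

theorem measurable_tileA : Measurable (Function.uncurry tileA) := by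
  unfold tileA Function.uncurry
  exact measurable_of_third_coord fun a b _ _ => if a = b then (1 : ℝ) else 0

theorem measurable_tileB : Measurable (Function.uncurry tileB) := by
  unfold tileB Function.uncurry
  exact measurable_of_third_coord fun a b k l => if a = b ∧ k = l then (1 : ℝ) else 0

theorem measurable_tileHalf : Measurable (Function.uncurry tileHalf) := by
  unfold tileHalf Function.uncurry
  exact Measurable.ite (measurableSet_le measurable_const (measurable_fst.add measurable_snd))
    measurable_const measurable_const

open Classical in
theorem measurable_tileCC (z : ℕ+ → ℝ) : Measurable (Function.uncurry (tileCC z)) := by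
  unfold tileCC Function.uncurry
  exact measurable_of_third_coord fun a b k l =>
    if k = l then
      if (a = 0 ∧ b = 0) ∨ (a = 1 ∧ b = 1) then monomialValue (M k) z
      else if (a = 0 ∧ b = 1) ∨ (a = 1 ∧ b = 0) then 1 - monomialValue (M k) z
      else 0
    else 0

theorem measurable_tileCD (P : BoundingSequence) (k : Fin 7) :
    Measurable (Function.uncurry (tileCD P k)) := by
  have measurableSet_rect (a b c d : ℝ) :
      MeasurableSet {s : ℝ × ℝ | s.1 ∈ Ico a b ∧ s.2 ∈ Ico c d} :=
    measurableSet_Ico.prod measurableSet_Ico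
  unfold tileCD Function.uncurry
  refine Measurable.ite (.const _) (measurable_of_third_coord fun a b k l =>
    if a = 0 ∧ b = 1 ∧ k = l then (1 : ℝ) else 0) ?_
  refine Measurable.ite (.const _) (measurable_of_third_coord fun a b k l =>
    if a = 0 ∧ b = 2 ∧ k = l then (1 : ℝ) else 0) ?_
  refine Measurable.ite (.const _) (Measurable.ite (measurableSet_rect _ _ _ _)
    measurable_const measurable_const) ?_
  exact Measurable.ite (.const _) (Measurable.ite
    ((measurableSet_rect _ _ _ _).union (measurableSet_rect _ _ _ _)) (measurable_WF P)
    measurable_const) measurable_const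

theorem measurable_tileCE (P : BoundingSequence) (z : ℕ+ → ℝ) :
    Measurable (Function.uncurry (tileCE P z)) := by
  have hp : Measurable fun s : ℝ × ℝ => eval z (P.p (coord (3 * s.1))) :=
    measurable_of_third_coord fun _ _ k _ => eval z (P.p k)
  have hpow : Measurable fun s : ℝ × ℝ => (2 : ℝ) ^ (coord (3 * s.1) : ℕ) :=
    measurable_of_third_coord fun _ _ k _ => (2 : ℝ) ^ (k : ℕ)
  have hv (c : ℝ) : Measurable fun s : ℝ × ℝ =>
      (2 : ℝ) ^ (coord (3 * s.1) : ℕ) * (3 * s.2 - c) + 2 :=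
    (hpow.mul ((measurable_const.mul measurable_snd).sub measurable_const)).add measurable_const
  have hthird (i j : ℤ) : MeasurableSet {s : ℝ × ℝ | ⌊3 * s.1⌋ = i ∧ ⌊3 * s.2⌋ = j} :=
    measurableSet_of_third_coord fun a b _ _ => a = i ∧ b = j
  unfold tileCE Function.uncurry
  refine Measurable.ite ?_ measurable_const measurable_const
  simp only [← and_assoc]
  exact (((hthird 0 0).inter (measurableSet_le measurable_const (hv 1))).inter
      (measurableSet_le (hv 1) hp)).union
    ((((hthird 0 1).inter (measurableSet_le measurable_const (hv 2))).inter
      (measurableSet_le (hv 2) (measurable_const.sub hp))).union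
    ((((hthird 1 0).inter (measurableSet_le (hv 1) measurable_const)).inter
      (measurableSet_le hp (hv 1))).union
    (((hthird 1 1).inter (measurableSet_le (hv 2) measurable_const)).inter
      (measurableSet_le (measurable_const.sub hp) (hv 2)))))

theorem measurable_tileDGE (P : BoundingSequence) :
    Measurable (Function.uncurry (tileDGE P)) := by
  have hpow : Measurable fun s : ℝ × ℝ => (2 : ℝ) ^ (coord (3 * s.2) : ℕ) :=
    measurable_of_third_coord fun _ _ _ k => (2 : ℝ) ^ (k : ℕ)
  have hv : Measurable fun s : ℝ × ℝ => (2 : ℝ) ^ (coord (3 * s.2) : ℕ) * (3 * s.2 - 1) + 2 :=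
    (hpow.mul ((measurable_const.mul measurable_snd).sub measurable_const)).add measurable_const
  have hthird (i : ℤ) : MeasurableSet {s : ℝ × ℝ | ⌊3 * s.1⌋ = i} :=
    measurableSet_of_third_coord fun a _ _ _ => a = i
  unfold tileDGE Function.uncurry
  refine Measurable.ite ?_ measurable_const measurable_const
  exact (measurableSet_of_third_coord fun _ b _ _ => b = 0).inter
    ((measurableSet_of_third_coord fun _ _ k l => k = l).inter
      (((hthird 1).inter
        (measurableSet_le hv (measurable_of_third_coord fun _ _ _ k => P.u k))).union
        ((hthird 2).inter
          (measurableSet_le hv (measurable_of_third_coord fun _ _ _ k => P.l k)))))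

theorem tileCC_symm (z : ℕ+ → ℝ) (x y : ℝ) : tileCC z x y = tileCC z y x := by
  unfold tileCC
  by_cases hcoord : coord (3 * x) = coord (3 * y)
  · rw [if_pos hcoord, if_pos hcoord.symm, hcoord]
    congr 1
    · simp only [and_comm]
    · simp only [and_comm, or_comm]
  · rw [if_neg hcoord, if_neg (Ne.symm hcoord)]

theorem tileR_mem (X : GPart) : tileR X ∈ Icc (0 : ℝ) 1 := by
  cases X with
  | D k =>
    have hk : ((k : ℕ) : ℝ) ≤ 6 := by exact_mod_cast Nat.lt_succ_iff.mp k.2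
    simp only [tileR, GPart.left]
    constructor
    · positivity
    · linarith
  | _ => norm_num [tileR, GPart.left]

theorem tile_R_right (U : (ℝ → ℝ → ℝ) → ℝ → ℝ → ℝ) (P : BoundingSequence) (z : ℕ+ → ℝ)
    (X : GPart) : tile U P z X .R = fun _ _ => tileR X := by
  cases X <;> rfl

theorem tile_R_left (U : (ℝ → ℝ → ℝ) → ℝ → ℝ → ℝ) (P : BoundingSequence) (z : ℕ+ → ℝ)
    (Y : GPart) : tile U P z .R Y = fun _ _ => tileR Y := by
  cases Y <;> rfl

theorem tile_cases (X Y : GPart) :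
    (∃ c ∈ Icc (0 : ℝ) 1, ∀ U P z, tile U P z X Y = fun _ _ => c) ∨
    (Y = .Q ∧ ∀ U P z, tile U P z X Y = fun x _ => tileQ U P z X x) ∨
    (X = .Q ∧ ∀ U P z, tile U P z X Y = fun _ y => tileQ U P z Y y) ∨
    (∀ U P z, tile U P z X Y = innerTile U P z X Y) := by
  cases Y with
  | R => exact Or.inl ⟨_, tileR_mem X, fun U P z => tile_R_right U P z X⟩
  | Q =>
    cases X with
    | R => exact Or.inl ⟨_, tileR_mem .Q, fun U P z => tile_R_left U P z .Q⟩
    | Q => exact Or.inl ⟨1, ⟨zero_le_one, le_rfl⟩, fun _ _ _ => rfl⟩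
    | _ => exact Or.inr (Or.inl ⟨rfl, fun _ _ _ => rfl⟩)
  | _ =>
    cases X with
    | R => exact Or.inl ⟨_, tileR_mem _, fun U P z => tile_R_left U P z _⟩
    | Q => exact Or.inr (Or.inr (Or.inl ⟨rfl, fun _ _ _ => rfl⟩))
    | _ => exact Or.inr (Or.inr (Or.inr fun _ _ _ => rfl))

section PlaneGraphon

variable {U : (ℝ → ℝ → ℝ) → ℝ → ℝ → ℝ} {P : BoundingSequence} {z : ℕ+ → ℝ}

theorem measurable_upperTile (hU : IsPlaneGraphon (U (WF P))) (z : ℕ+ → ℝ) (X Y : GPart) :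
    Measurable (Function.uncurry (upperTile U P z X Y)) := by
  have measurable_zero : Measurable (Function.uncurry fun _ _ : ℝ => (0 : ℝ)) := measurable_const
  have measurable_DD (j k : Fin 7) : Measurable (Function.uncurry fun x y : ℝ =>
      U (WF P) ((((j : ℕ) : ℝ) + x) / 13) ((((k : ℕ) : ℝ) + y) / 13)) :=
    hU.meas.comp (((measurable_const.add measurable_fst).div_const _).prodMk
      ((measurable_const.add measurable_snd).div_const _))
  have measurable_DE (j : Fin 7) :
      Measurable (Function.uncurry fun x y : ℝ => if j = 6 then tileDGE P x y else 0) :=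
    Measurable.ite (.const _) (measurable_tileDGE P) measurable_const
  cases X <;> cases Y <;> first
    | exact measurable_zero
    | exact measurable_tileHalf
    | exact measurable_tileA
    | exact measurable_tileB
    | exact measurable_tileCC z
    | exact measurable_tileCD P _
    | exact measurable_tileCE P z
    | exact measurable_DD _ _
    | exact measurable_DE _

theorem upperTile_mem (hU : IsPlaneGraphon (U (WF P))) (hz : z ∈ cube) (X Y : GPart) (x y : ℝ) :
    upperTile U P z X Y x y ∈ Icc (0 : ℝ) 1 := by
  have zero_mem : (0 : ℝ) ∈ Icc (0 : ℝ) 1 := ⟨le_rfl, zero_le_one⟩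
  have one_mem : (1 : ℝ) ∈ Icc (0 : ℝ) 1 := ⟨zero_le_one, le_rfl⟩
  have ite_mem_Icc {c : Prop} {_ : Decidable c} {a b : ℝ} (ha : a ∈ Icc (0 : ℝ) 1)
      (hb : b ∈ Icc (0 : ℝ) 1) : (if c then a else b) ∈ Icc (0 : ℝ) 1 :=
    ite_mem.mpr ⟨fun _ => ha, fun _ => hb⟩
  have tileCC_mem : tileCC z x y ∈ Icc (0 : ℝ) 1 := by
    have hmem := monomialValue_mem (M (coord (3 * x))) hz
    exact ite_mem_Icc
      (ite_mem_Icc hmem (ite_mem_Icc (one_sub_mem_Icc_zero_one hmem) zero_mem)) zero_mem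
  have tileCD_mem (k : Fin 7) : tileCD P k x y ∈ Icc (0 : ℝ) 1 :=
    ite_mem_Icc (ite_mem_Icc one_mem zero_mem) <| ite_mem_Icc (ite_mem_Icc one_mem zero_mem) <|
      ite_mem_Icc (ite_mem_Icc one_mem zero_mem) <|
        ite_mem_Icc (ite_mem_Icc (WF_mem P x y) zero_mem) zero_mem
  cases X <;> cases Y <;> first
    | exact zero_mem
    | exact tileCC_mem
    | exact tileCD_mem _
    | exact hU.mem _ _
    | exact ite_mem_Icc one_mem zero_mem
    | exact ite_mem_Icc (ite_mem_Icc one_mem zero_mem) zero_mem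

theorem upperTile_self_symm (hU : IsPlaneGraphon (U (WF P))) (z : ℕ+ → ℝ) (X : GPart) (x y : ℝ) :
    upperTile U P z X X x y = upperTile U P z X X y x := by
  cases X with
  | A => exact if_congr eq_comm rfl rfl
  | B => exact if_congr (and_congr eq_comm eq_comm) rfl rfl
  | C => exact tileCC_symm z x y
  | D k => exact hU.symm _ _
  | F => exact if_congr (by rw [add_comm]) rfl rfl
  | _ => rfl

theorem measurable_innerTile (hU : IsPlaneGraphon (U (WF P))) (z : ℕ+ → ℝ) (X Y : GPart) :
    Measurable (Function.uncurry (innerTile U P z X Y)) := by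
  unfold innerTile
  by_cases h : X.left ≤ Y.left
  · simp only [if_pos h]
    exact measurable_upperTile hU z X Y
  · simp only [if_neg h]
    exact (measurable_upperTile hU z Y X).comp measurable_swap

theorem innerTile_mem (hU : IsPlaneGraphon (U (WF P))) (hz : z ∈ cube) (X Y : GPart) (x y : ℝ) :
    innerTile U P z X Y x y ∈ Icc (0 : ℝ) 1 :=
  ite_mem.mpr ⟨fun _ => upperTile_mem hU hz X Y x y, fun _ => upperTile_mem hU hz Y X y x⟩

theorem innerTile_symm (hU : IsPlaneGraphon (U (WF P))) (z : ℕ+ → ℝ) (X Y : GPart) (x y : ℝ) :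
    innerTile U P z X Y x y = innerTile U P z Y X y x := by
  unfold innerTile
  rcases lt_trichotomy X.left Y.left with h | h | h
  · rw [if_pos h.le, if_neg h.not_ge]
  · obtain rfl := left_injective h
    rw [if_pos le_rfl, if_pos le_rfl]
    exact upperTile_self_symm hU z X x y
  · rw [if_pos h.le, if_neg h.not_ge]

theorem measurable_relDeg (hU : IsPlaneGraphon (U (WF P))) (z : ℕ+ → ℝ) (X Z : GPart) :
    Measurable (relDeg U P z X Z) :=
  (StronglyMeasurable.integral_prod_right
    (measurable_innerTile hU z X Z).stronglyMeasurable).measurable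

theorem relDeg_mem (hU : IsPlaneGraphon (U (WF P))) (hz : z ∈ cube) (X Z : GPart) (x : ℝ) :
    relDeg U P z X Z x ∈ Icc (0 : ℝ) 1 :=
  setIntegral_Ico_mem_Icc fun t => innerTile_mem hU hz X Z x t

theorem measurable_tileQ (hU : IsPlaneGraphon (U (WF P))) (z : ℕ+ → ℝ) (X : GPart) :
    Measurable (tileQ U P z X) := by
  have hdeg := measurable_relDeg hU z X
  unfold tileQ
  exact measurable_const.mul (measurable_const.sub ((((((hdeg _).add (hdeg _)).add (hdeg _)).add
    (Finset.measurable_sum _ fun k _ => hdeg _)).add (hdeg _)).add (hdeg _)))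

theorem tileQ_mem (hU : IsPlaneGraphon (U (WF P))) (hz : z ∈ cube) (X : GPart) (x : ℝ) :
    tileQ U P z X x ∈ Icc (0 : ℝ) 1 := by
  have hdeg Z := relDeg_mem hU hz X Z x
  have hsum_nonneg : 0 ≤ ∑ k : Fin 7, relDeg U P z X (.D k) x :=
    Finset.sum_nonneg fun k _ => (hdeg _).1
  have hsum_le : ∑ k : Fin 7, relDeg U P z X (.D k) x ≤ 7 := by
    simpa using Finset.sum_le_card_nsmul Finset.univ _ 1 fun k _ => (hdeg (.D k)).2
  unfold tileQ
  constructor <;> linarith [(hdeg .A).1, (hdeg .A).2, (hdeg .B).1, (hdeg .B).2, (hdeg .C).1,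
    (hdeg .C).2, (hdeg .E).1, (hdeg .E).2, (hdeg .F).1, (hdeg .F).2]

theorem measurable_tile (hU : IsPlaneGraphon (U (WF P))) (z : ℕ+ → ℝ) (X Y : GPart) :
    Measurable (Function.uncurry (tile U P z X Y)) := by
  rcases tile_cases X Y with ⟨c, -, h⟩ | ⟨-, h⟩ | ⟨-, h⟩ | h <;> rw [h]
  · exact measurable_const
  · exact (measurable_tileQ hU z X).comp measurable_fst
  · exact (measurable_tileQ hU z Y).comp measurable_snd
  · exact measurable_innerTile hU z _ _

theorem tile_mem (hU : IsPlaneGraphon (U (WF P))) (hz : z ∈ cube) (X Y : GPart) (x y : ℝ) :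
    tile U P z X Y x y ∈ Icc (0 : ℝ) 1 := by
  rcases tile_cases X Y with ⟨c, hc, h⟩ | ⟨-, h⟩ | ⟨-, h⟩ | h <;> rw [h]
  · exact hc
  · exact tileQ_mem hU hz _ _
  · exact tileQ_mem hU hz _ _
  · exact innerTile_mem hU hz _ _ _ _

theorem tile_symm (hU : IsPlaneGraphon (U (WF P))) (z : ℕ+ → ℝ) (X Y : GPart) (x y : ℝ) :
    tile U P z X Y x y = tile U P z Y X y x := by
  cases X <;> cases Y <;> first
    | rfl
    | exact innerTile_symm hU z _ _ _ _

theorem isPlaneGraphon_WP (hU : IsPlaneGraphon (U (WF P))) (hz : z ∈ cube) :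
    IsPlaneGraphon (WP U P z) where
  meas := by
    have htile : Measurable fun q : (GPart × GPart) × (ℝ × ℝ) =>
        tile U P z q.1.1 q.1.2 q.2.1 q.2.2 :=
      measurable_from_prod_countable_right fun q => measurable_tile hU z q.1 q.2
    exact htile.comp (((measurable_partOf.comp measurable_fst).prodMk
      (measurable_partOf.comp measurable_snd)).prodMk
      ((measurable_relCoord.comp measurable_fst).prodMk
        (measurable_relCoord.comp measurable_snd)))
  symm s t := tile_symm hU z _ _ _ _
  mem s t := tile_mem hU hz _ _ _ _

end PlaneGraphon

section ZeroExtension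

variable {U V : (ℝ → ℝ → ℝ) → ℝ → ℝ → ℝ} {P : BoundingSequence}

theorem natCast_fin_add_div_mem (k : Fin 7) {x : ℝ} (hx : x ∈ Ico (0 : ℝ) 1) :
    (((k : ℕ) : ℝ) + x) / 13 ∈ Ico (0 : ℝ) 1 := by
  have hk : ((k : ℕ) : ℝ) ≤ 6 := by exact_mod_cast Nat.lt_succ_iff.mp k.2
  exact ⟨div_nonneg (add_nonneg (Nat.cast_nonneg _) hx.1) (by norm_num), by linarith [hx.2]⟩

theorem upperTile_congr
    (hUV : ∀ x ∈ Ico (0 : ℝ) 1, ∀ y ∈ Ico (0 : ℝ) 1, U (WF P) x y = V (WF P) x y)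
    (z : ℕ+ → ℝ) (X Y : GPart) {x y : ℝ} (hx : x ∈ Ico (0 : ℝ) 1) (hy : y ∈ Ico (0 : ℝ) 1) :
    upperTile U P z X Y x y = upperTile V P z X Y x y := by
  cases X <;> cases Y <;> first
    | rfl
    | exact hUV _ (natCast_fin_add_div_mem _ hx) _ (natCast_fin_add_div_mem _ hy)

theorem innerTile_congr
    (hUV : ∀ x ∈ Ico (0 : ℝ) 1, ∀ y ∈ Ico (0 : ℝ) 1, U (WF P) x y = V (WF P) x y)
    (z : ℕ+ → ℝ) (X Y : GPart) {x y : ℝ} (hx : x ∈ Ico (0 : ℝ) 1) (hy : y ∈ Ico (0 : ℝ) 1) :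
    innerTile U P z X Y x y = innerTile V P z X Y x y := by
  unfold innerTile
  rw [upperTile_congr hUV z X Y hx hy, upperTile_congr hUV z Y X hy hx]

theorem tileQ_congr
    (hUV : ∀ x ∈ Ico (0 : ℝ) 1, ∀ y ∈ Ico (0 : ℝ) 1, U (WF P) x y = V (WF P) x y)
    (z : ℕ+ → ℝ) (X : GPart) {x : ℝ} (hx : x ∈ Ico (0 : ℝ) 1) :
    tileQ U P z X x = tileQ V P z X x := by
  have hdeg Z : relDeg U P z X Z x = relDeg V P z X Z x :=
    setIntegral_congr_fun measurableSet_Ico fun t ht => innerTile_congr hUV z X Z hx ht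
  simp only [tileQ, hdeg]

theorem WP_congr
    (hUV : ∀ x ∈ Ico (0 : ℝ) 1, ∀ y ∈ Ico (0 : ℝ) 1, U (WF P) x y = V (WF P) x y)
    (z : ℕ+ → ℝ) {s t : ℝ} (hs : s ∈ Ico (0 : ℝ) 1) (ht : t ∈ Ico (0 : ℝ) 1) :
    WP U P z s t = WP V P z s t := by
  unfold WP
  rcases tile_cases (partOf s) (partOf t) with ⟨c, -, h⟩ | ⟨-, h⟩ | ⟨-, h⟩ | h <;> rw [h, h]
  · exact tileQ_congr hUV z _ (relCoord_mem hs)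
  · exact tileQ_congr hUV z _ (relCoord_mem ht)
  · exact innerTile_congr hUV z _ _ (relCoord_mem hs) (relCoord_mem ht)

theorem WP_zeroExtension (U : (ℝ → ℝ → ℝ) → ℝ → ℝ → ℝ) (P : BoundingSequence) (z : ℕ+ → ℝ)
    {s t : ℝ} (hs : s ∈ Ico (0 : ℝ) 1) (ht : t ∈ Ico (0 : ℝ) 1) :
    WP (fun W => zeroExtension (U W)) P z s t = WP U P z s t :=
  WP_congr (fun _ hx _ hy => zeroExtension_of_mem _ hx hy) z hs ht

theorem tau_congr {n : ℕ} (H : SimpleGraph (Fin n)) {W W' : ℝ → ℝ → ℝ}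
    (h : ∀ x ∈ Ico (0 : ℝ) 1, ∀ y ∈ Ico (0 : ℝ) 1, W x y = W' x y) : tau H W = tau H W' := by
  unfold tau
  refine setIntegral_congr_fun (MeasurableSet.univ_pi fun _ => measurableSet_Ico) fun x hx => ?_
  refine Finset.prod_congr rfl fun e _ => ?_
  rw [h _ (hx e.1 trivial) _ (hx e.2 trivial)]

theorem l1Dist_zeroExtension (U : (ℝ → ℝ → ℝ) → ℝ → ℝ → ℝ) (P P' : BoundingSequence) :
    l1Dist (fun W => zeroExtension (U W)) P P' = l1Dist U P P' := by
  unfold l1Dist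
  refine iSup_congr fun z => setIntegral_congr_fun (measurableSet_Ico.prod measurableSet_Ico)
    fun s hs => ?_
  simp only [WP_zeroExtension U _ z hs.1 hs.2]

end ZeroExtension

/-! ### Levels within the dyadic classes -/

/-- The relative position of `y` within its dyadic class, a number in `[0,1)`.  It is the quantity
`v_k` or `w_k` of the definition of `C × E`. -/
def level (y : ℝ) : ℝ := 2 ^ (coord (3 * y) : ℕ) * (Int.fract (3 * y) - 1) + 2

theorem level_mem (y : ℝ) : level y ∈ Ico (0 : ℝ) 1 := by
  obtain ⟨hle, hlt⟩ := coord_spec (3 * y)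
  have hpow : (0 : ℝ) < 2 ^ (coord (3 * y) : ℕ) := by positivity
  have hinv := mul_inv_cancel₀ hpow.ne'
  have hle' := mul_le_mul_of_nonneg_left hle hpow.le
  have hlt' := mul_lt_mul_of_pos_left hlt hpow
  constructor <;> (unfold level; linarith)

theorem measurable_level : Measurable level :=
  (((measurable_of_countable fun k : ℕ+ => (2 : ℝ) ^ (k : ℕ)).comp
    measurable_coord_third).mul ((measurable_fract.comp
      (measurable_const_mul 3)).sub measurable_const)).add measurable_const

/-- The point of level `a` in the `k`-th dyadic class of the third with index `i`. -/
def levelPoint (i : ℤ) (k : ℕ+) (a : ℝ) : ℝ := (i + 1 + (a - 2) / 2 ^ (k : ℕ)) / 3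

theorem levelPoint_level (y : ℝ) : levelPoint ⌊3 * y⌋ (coord (3 * y)) (level y) = y := by
  have hpow : (2 : ℝ) ^ (coord (3 * y) : ℕ) ≠ 0 := by positivity
  unfold levelPoint level
  rw [add_sub_cancel_right, mul_div_cancel_left₀ _ hpow]
  linarith [Int.floor_add_fract (3 * y)]

theorem levelPoint_mul_add (i : ℤ) (k : ℕ+) (y : ℝ) :
    levelPoint i k (2 ^ (k : ℕ) * (3 * y - (i + 1)) + 2) = y := by
  unfold levelPoint
  field_simp
  ring

theorem levelPoint_spec (i : ℤ) (k : ℕ+) {a : ℝ} (ha : a ∈ Ico (0 : ℝ) 1) :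
    ⌊3 * levelPoint i k a⌋ = i ∧ coord (3 * levelPoint i k a) = k ∧
      level (levelPoint i k a) = a := by
  obtain ⟨ha0, ha1⟩ := ha
  have hpow : (0 : ℝ) < 2 ^ (k : ℕ) := by positivity
  have htwo_le : (2 : ℝ) ≤ 2 ^ (k : ℕ) := le_self_pow₀ one_le_two k.ne_zero
  have hpoint : 3 * levelPoint i k a = i + (1 + (a - 2) / 2 ^ (k : ℕ)) := by
    unfold levelPoint
    ring
  have hlow : -1 ≤ (a - 2) / 2 ^ (k : ℕ) := by
    rw [le_div_iff₀ hpow]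
    linarith
  have hup : (a - 2) / 2 ^ (k : ℕ) < 0 := div_neg_of_neg_of_pos (by linarith) hpow
  have hfloor : ⌊3 * levelPoint i k a⌋ = i := by
    rw [Int.floor_eq_iff, hpoint]
    constructor <;> linarith
  have hfract : Int.fract (3 * levelPoint i k a) = 1 + (a - 2) / 2 ^ (k : ℕ) := by
    rw [← Int.self_sub_floor, hfloor, hpoint]
    ring
  have hcoord : coord (3 * levelPoint i k a) = k := by
    rw [coord_eq_iff, hfract, div_eq_mul_inv]
    have hinv := inv_pos.mpr hpow
    constructor <;> nlinarith
  refine ⟨hfloor, hcoord, ?_⟩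
  rw [level, hcoord, hfract]
  field_simp
  ring

theorem levelPoint_strictMono (i : ℤ) (k : ℕ+) : StrictMono (levelPoint i k) := fun a b hab => by
  unfold levelPoint
  gcongr

/-- The points of the third with index `i` in the `k`-th dyadic class with level
in `[a, b)`. -/
def levelSet (i : ℤ) (k : ℕ+) (a b : ℝ) : Set ℝ :=
  {y | ⌊3 * y⌋ = i ∧ coord (3 * y) = k ∧ a ≤ level y ∧ level y < b}

theorem levelSet_eq_Ico (i : ℤ) (k : ℕ+) {a b : ℝ} (ha : 0 ≤ a) (hb : b ≤ 1) :
    levelSet i k a b = Ico (levelPoint i k a) (levelPoint i k b) := by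
  have hmono := levelPoint_strictMono i k
  ext y
  constructor
  · rintro ⟨rfl, rfl, hle, hlt⟩
    have hy := levelPoint_level y
    exact ⟨(hmono.monotone hle).trans_eq hy, hy.symm.trans_lt (hmono hlt)⟩
  · intro hy
    rw [← levelPoint_mul_add i k y, mem_Ico, hmono.le_iff_le, hmono.lt_iff_lt] at hy
    obtain ⟨hfloor, hcoord, hlevel⟩ := levelPoint_spec i k ⟨ha.trans hy.1, hy.2.trans_le hb⟩
    rw [levelPoint_mul_add] at hfloor hcoord hlevel
    exact ⟨hfloor, hcoord, hlevel ▸ hy.1, hlevel ▸ hy.2⟩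

theorem measurableSet_levelSet (i : ℤ) (k : ℕ+) (a b : ℝ) : MeasurableSet (levelSet i k a b) :=
  (measurable_third (measurableSet_singleton i)).inter
    ((measurable_coord_third (measurableSet_singleton k)).inter
      ((measurableSet_le measurable_const measurable_level).inter
        (measurableSet_lt measurable_level measurable_const)))

theorem volume_levelSet (i : ℤ) (k : ℕ+) {a b : ℝ} (ha : 0 ≤ a) (hab : a ≤ b) (hb : b ≤ 1) :
    volume.real (levelSet i k a b) = (b - a) / (3 * 2 ^ (k : ℕ)) := by
  rw [levelSet_eq_Ico i k ha hb,
    Real.volume_real_Ico_of_le ((levelPoint_strictMono i k).monotone hab)]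
  unfold levelPoint
  field_simp
  ring

/-- The index of the first third (`false`) or of the second third (`true`); nothing in the last
third depends on `z`. -/
def third (b : Bool) : ℤ := if b then 1 else 0

theorem third_injective : Function.Injective third := by
  decide

theorem eq_zero_or_one_iff (i : ℤ) : (i = 0 ∨ i = 1) ↔ ∃ b, i = third b := by
  simp [third]

theorem levelSet_third_subset (b : Bool) (k : ℕ+) (l u : ℝ) :
    levelSet (third b) k l u ⊆ Ico (0 : ℝ) 1 := by
  rintro y ⟨hfloor, -⟩
  rw [Int.floor_eq_iff] at hfloor
  cases b <;> norm_num [third] at hfloor <;> constructor <;> linarith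

open Classical in
theorem setIntegral_eq_of_ae_eq_levelSet {f : ℝ → ℝ} {k : ℕ+} {lo hi a : Bool → ℝ}
    (hlo : ∀ θ, 0 ≤ lo θ) (hle : ∀ θ, lo θ ≤ hi θ) (hhi : ∀ θ, hi θ ≤ 1)
    (hzero : ∀ t, (¬∃ θ, ⌊3 * t⌋ = third θ) → f t = 0)
    (hf : ∀ᵐ t, ∀ θ, ⌊3 * t⌋ = third θ →
      f t = if coord (3 * t) = k ∧ lo θ ≤ level t ∧ level t < hi θ then a θ else 0) :
    ∫ t in Ico (0 : ℝ) 1, f t = (∑ θ, a θ * (hi θ - lo θ)) / (3 * 2 ^ (k : ℕ)) := by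
  let S θ := levelSet (third θ) k (lo θ) (hi θ)
  have hS θ : MeasurableSet (S θ) := measurableSet_levelSet _ _ _ _
  have hae : ∀ᵐ t ∂volume.restrict (Ico (0 : ℝ) 1),
      f t = ∑ θ, (S θ).indicator (fun _ => a θ) t := by
    filter_upwards [ae_restrict_of_ae hf] with t ht
    by_cases hthird : ∃ θ, ⌊3 * t⌋ = third θ
    · obtain ⟨θ, hθ⟩ := hthird
      rw [ht θ hθ, Finset.sum_eq_single_of_mem θ (Finset.mem_univ _) fun θ' _ hne =>
        indicator_of_notMem (fun h => hne (third_injective (h.1.symm.trans hθ))) _]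
      exact if_congr (and_iff_right hθ).symm rfl rfl
    · rw [hzero t hthird]
      exact (Finset.sum_eq_zero fun θ _ =>
        indicator_of_notMem (fun h => hthird ⟨θ, h.1⟩) _).symm
  rw [integral_congr_ae hae,
    integral_finsetSum _ fun θ _ => (integrable_const (a θ)).indicator (hS θ), Finset.sum_div]
  refine Finset.sum_congr rfl fun θ _ => ?_
  rw [setIntegral_indicator (hS θ), inter_eq_right.mpr (levelSet_third_subset _ _ _ _),
    setIntegral_const, smul_eq_mul, volume_levelSet _ _ (hlo θ) (hle θ) (hhi θ)]
  ring

/-! ### The tiles that depend on `z` -/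

theorem tileCC_eq_zero_left (z : ℕ+ → ℝ) {x : ℝ} (y : ℝ) (hx : ¬∃ b, ⌊3 * x⌋ = third b) :
    tileCC z x y = 0 := by
  rw [← eq_zero_or_one_iff, not_or] at hx
  simp [tileCC, hx.1, hx.2]

theorem tileCC_eq_zero_right (z : ℕ+ → ℝ) (x : ℝ) {y : ℝ} (hy : ¬∃ b, ⌊3 * y⌋ = third b) :
    tileCC z x y = 0 := by
  rw [tileCC_symm, tileCC_eq_zero_left z x hy]

theorem tileCC_eq (z : ℕ+ → ℝ) {x y : ℝ} {b θ : Bool} (hx : ⌊3 * x⌋ = third b)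
    (hy : ⌊3 * y⌋ = third θ) :
    tileCC z x y = if coord (3 * x) = coord (3 * y) then
      if b = θ then monomialValue (M (coord (3 * x))) z
      else 1 - monomialValue (M (coord (3 * x))) z else 0 := by
  unfold tileCC
  rw [hx, hy]
  cases b <;> cases θ <;> simp [third]

/-- The polynomial giving the threshold for the level in `E`: `p_k` in the first third and
`1 - p_k` in the second third. -/
def threshold (P : BoundingSequence) (θ : Bool) (k : ℕ+) : MvPolynomial ℕ+ ℝ :=
  if θ then 1 - P.p k else P.p k

theorem eval_threshold_true (P : BoundingSequence) (k : ℕ+) (z : ℕ+ → ℝ) :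
    eval z (threshold P true k) = 1 - eval z (threshold P false k) := by
  simp [threshold]

theorem threshold_mem (P : BoundingSequence) (θ : Bool) (k : ℕ+) {z : ℕ+ → ℝ} (hz : z ∈ cube) :
    eval z (threshold P θ k) ∈ Icc (0 : ℝ) 1 := by
  have hp : eval z (threshold P false k) ∈ Icc (0 : ℝ) 1 := P.p_mem k z hz
  cases θ
  · exact hp
  · exact eval_threshold_true P k z ▸ one_sub_mem_Icc_zero_one hp

/-- The level of `y` is none of `0`, `l_k` and the thresholds, where the closed conditions defining
the tiles of `W_P(z)` disagree with the half-open ones defining the cells. -/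
structure Generic (P : BoundingSequence) (z : ℕ+ → ℝ) (y : ℝ) : Prop where
  ne_zero : level y ≠ 0
  ne_threshold : ∀ θ, level y ≠ eval z (threshold P θ (coord (3 * y)))
  ne_l : level y ≠ P.l (coord (3 * y))

theorem countable_not_generic (P : BoundingSequence) (z : ℕ+ → ℝ) :
    {y | ¬Generic P z y}.Countable := by
  have hsubset : {y | ¬Generic P z y} ⊆ ⋃ (i : ℤ) (k : ℕ+), levelPoint i k ''
      {0, eval z (threshold P false k), eval z (threshold P true k), P.l k} := by
    intro y hy
    simp only [mem_iUnion]
    refine ⟨⌊3 * y⌋, coord (3 * y), level y, ?_, levelPoint_level y⟩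
    by_contra hcon
    simp only [mem_insert_iff, mem_singleton_iff, not_or] at hcon
    obtain ⟨h0, hfalse, htrue, hl⟩ := hcon
    exact hy ⟨h0, fun θ => by cases θ <;> assumption, hl⟩
  exact Countable.mono hsubset <| countable_iUnion fun i => countable_iUnion fun k =>
    (toFinite _).countable.image _

theorem coord_eq_of_scaled_mem {y : ℝ} {k : ℕ+} {i : ℤ} (hy : level y ≠ 0)
    (h0 : 0 ≤ (2 : ℝ) ^ (k : ℕ) * (3 * y - (i + 1)) + 2)
    (h1 : (2 : ℝ) ^ (k : ℕ) * (3 * y - (i + 1)) + 2 ≤ 1) : coord (3 * y) = k := by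
  rcases h1.lt_or_eq with h1 | h1
  · rw [← levelPoint_mul_add i k y]
    exact (levelPoint_spec i k ⟨h0, h1⟩).2.1
  · have hnext : y = levelPoint i (k + 1) 0 := by
      rw [← levelPoint_mul_add i k y, h1]
      unfold levelPoint
      rw [PNat.add_coe, PNat.one_coe, pow_succ]
      field_simp
      ring
    exact absurd (hnext ▸ (levelPoint_spec i (k + 1) ⟨le_rfl, one_pos⟩).2.2) hy

theorem tileCE_eq_zero_left (P : BoundingSequence) (z : ℕ+ → ℝ) {x : ℝ} (y : ℝ)
    (hx : ¬∃ b, ⌊3 * x⌋ = third b) : tileCE P z x y = 0 := by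
  rw [← eq_zero_or_one_iff, not_or] at hx
  simp [tileCE, hx.1, hx.2]

theorem tileCE_eq_zero_right (P : BoundingSequence) (z : ℕ+ → ℝ) (x : ℝ) {y : ℝ}
    (hy : ¬∃ b, ⌊3 * y⌋ = third b) : tileCE P z x y = 0 := by
  rw [← eq_zero_or_one_iff, not_or] at hy
  simp [tileCE, hy.1, hy.2]

theorem tileCE_eq_zero_of_coord_ne (P : BoundingSequence) {z : ℕ+ → ℝ} (hz : z ∈ cube) {x y : ℝ}
    (hy : level y ≠ 0) (hne : coord (3 * x) ≠ coord (3 * y)) : tileCE P z x y = 0 := by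
  obtain ⟨hp0, hp1⟩ := P.p_mem (coord (3 * x)) z hz
  have hscaled (i : ℤ) (h0 : 0 ≤ (2 : ℝ) ^ (coord (3 * x) : ℕ) * (3 * y - (i + 1)) + 2)
      (h1 : (2 : ℝ) ^ (coord (3 * x) : ℕ) * (3 * y - (i + 1)) + 2 ≤ 1) : False :=
    hne (coord_eq_of_scaled_mem hy h0 h1).symm
  have hfirst := hscaled 0
  have hsecond := hscaled 1
  norm_num at hfirst hsecond
  refine if_neg ?_
  rintro (⟨-, -, h0, h1⟩ | ⟨-, -, h0, h1⟩ | ⟨-, -, h1, h0⟩ | ⟨-, -, h1, h0⟩)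
  · linarith [hfirst h0]
  · linarith [hsecond h0]
  · linarith [hfirst (by linarith)]
  · linarith [hsecond (by linarith)]

theorem scaled_eq_level {y : ℝ} {i : ℤ} (hi : ⌊3 * y⌋ = i) :
    (2 : ℝ) ^ (coord (3 * y) : ℕ) * (3 * y - (i + 1)) + 2 = level y := by
  rw [level, ← Int.self_sub_floor, hi]
  ring

open Classical in
theorem tileCE_eq (P : BoundingSequence) {z : ℕ+ → ℝ} (hz : z ∈ cube) {x y : ℝ} {b θ : Bool}
    (hx : ⌊3 * x⌋ = third b) (hy : ⌊3 * y⌋ = third θ) (hlevel : level y ≠ 0) :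
    tileCE P z x y = if coord (3 * x) = coord (3 * y) ∧
      ((b = false ∧ level y ≤ eval z (threshold P θ (coord (3 * y)))) ∨
        (b = true ∧ eval z (threshold P θ (coord (3 * y))) ≤ level y))
      then 1 else 0 := by
  by_cases hcoord : coord (3 * x) = coord (3 * y)
  · obtain ⟨h0, h1⟩ := level_mem y
    have hfirst : θ = false → (2 : ℝ) ^ (coord (3 * y) : ℕ) * (3 * y - 1) + 2 = level y := by
      rintro rfl
      norm_num [← scaled_eq_level hy, third]
    have hsecond : θ = true → (2 : ℝ) ^ (coord (3 * y) : ℕ) * (3 * y - 2) + 2 = level y := by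
      rintro rfl
      norm_num [← scaled_eq_level hy, third]
    refine if_congr ?_ rfl rfl
    rw [hcoord, hx, hy]
    cases b <;> cases θ <;> simp [third, threshold, hfirst, hsecond, h0, h1.le]
  · rw [tileCE_eq_zero_of_coord_ne P hz hlevel hcoord, if_neg fun h => hcoord h.1]

/-! ### Relative degrees -/

section Degrees

variable (U : (ℝ → ℝ → ℝ) → ℝ → ℝ → ℝ) (P : BoundingSequence) {z z' : ℕ+ → ℝ}

theorem integral_tileCC (z : ℕ+ → ℝ) {x : ℝ} {b : Bool} (hx : ⌊3 * x⌋ = third b) :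
    ∫ t in Ico (0 : ℝ) 1, tileCC z x t = 1 / (3 * 2 ^ (coord (3 * x) : ℕ)) := by
  let m := monomialValue (M (coord (3 * x))) z
  rw [setIntegral_eq_of_ae_eq_levelSet (k := coord (3 * x)) (lo := fun _ => 0) (hi := fun _ => 1)
    (a := fun θ => if b = θ then m else 1 - m) (fun _ => le_rfl) (fun _ => zero_le_one)
    (fun _ => le_rfl) fun t => tileCC_eq_zero_right z x]
  · cases b <;> simp
  · filter_upwards with t θ hθ
    obtain ⟨h0, h1⟩ := level_mem t
    simp [tileCC_eq z hx hθ, h0, h1, m, eq_comm]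

theorem integral_tileCE_left (hz : z ∈ cube) {y : ℝ} (hy : Generic P z y) {θ : Bool}
    (hθ : ⌊3 * y⌋ = third θ) :
    ∫ t in Ico (0 : ℝ) 1, tileCE P z t y = 1 / (3 * 2 ^ (coord (3 * y) : ℕ)) := by
  let c := eval z (threshold P θ (coord (3 * y)))
  rw [setIntegral_eq_of_ae_eq_levelSet (k := coord (3 * y)) (lo := fun _ => 0) (hi := fun _ => 1)
    (a := fun b => if b = decide (c < level y) then 1 else 0) (fun _ => le_rfl)
    (fun _ => zero_le_one) (fun _ => le_rfl) fun t => tileCE_eq_zero_left P z y]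
  · rw [Fintype.sum_bool]
    by_cases hlt : c < level y <;> simp [hlt]
  · filter_upwards with t b hb
    obtain ⟨h0, h1⟩ := level_mem t
    rw [tileCE_eq P hz hb hθ hy.ne_zero]
    rcases lt_or_gt_of_ne (hy.ne_threshold θ) with hlt | hlt <;>
      cases b <;> simp [c, h0, h1, hlt.le, hlt.not_ge, hlt]

theorem integral_tileCE_right (hz : z ∈ cube) {x : ℝ} {b : Bool} (hx : ⌊3 * x⌋ = third b) :
    ∫ t in Ico (0 : ℝ) 1, tileCE P z x t = 1 / (3 * 2 ^ (coord (3 * x) : ℕ)) := by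
  let c θ := eval z (threshold P θ (coord (3 * x)))
  have hc θ : c θ ∈ Icc (0 : ℝ) 1 := threshold_mem P θ _ hz
  rw [setIntegral_eq_of_ae_eq_levelSet (k := coord (3 * x)) (lo := fun θ => if b then c θ else 0)
    (hi := fun θ => if b then 1 else c θ) (a := fun _ => 1) (fun θ => ?_) (fun θ => ?_)
    (fun θ => ?_) fun t => tileCE_eq_zero_right P z x]
  · have hsum : c true = 1 - c false := eval_threshold_true P _ z
    cases b <;> norm_num [hsum]
  · filter_upwards [(countable_not_generic P z).ae_notMem volume] with t ht θ hθ
    have ht : Generic P z t := not_not.mp ht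
    obtain ⟨h0, h1⟩ := level_mem t
    rw [tileCE_eq P hz hx hθ ht.ne_zero]
    by_cases hcoord : coord (3 * x) = coord (3 * t)
    · have hne : level t ≠ c θ := by simpa only [c, hcoord] using ht.ne_threshold θ
      cases b <;> simp [c, ← hcoord, h0, h1, hne.le_iff_lt]
    · simp [hcoord, Ne.symm hcoord]
  all_goals cases b <;> simp [(hc θ).1, (hc θ).2]

theorem relDeg_CC (z : ℕ+ → ℝ) (x : ℝ) :
    relDeg U P z .C .C x =
      if ⌊3 * x⌋ = 0 ∨ ⌊3 * x⌋ = 1 then 1 / (3 * 2 ^ (coord (3 * x) : ℕ)) else 0 := by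
  have htile t : innerTile U P z .C .C x t = tileCC z x t := if_pos le_rfl
  simp only [relDeg, htile]
  split_ifs with h <;> rw [eq_zero_or_one_iff] at h
  · obtain ⟨b, hb⟩ := h
    exact integral_tileCC z hb
  · simp [tileCC_eq_zero_left z _ h]

theorem relDeg_EC (hz : z ∈ cube) {y : ℝ} (hy : Generic P z y) :
    relDeg U P z .E .C y =
      if ⌊3 * y⌋ = 0 ∨ ⌊3 * y⌋ = 1 then 1 / (3 * 2 ^ (coord (3 * y) : ℕ)) else 0 := by
  have htile t : innerTile U P z .E .C y t = tileCE P z t y := if_neg (by norm_num [GPart.left])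
  simp only [relDeg, htile]
  split_ifs with h <;> rw [eq_zero_or_one_iff] at h
  · obtain ⟨θ, hθ⟩ := h
    exact integral_tileCE_left P hz hy hθ
  · simp [tileCE_eq_zero_right P z _ h]

theorem relDeg_CE (hz : z ∈ cube) (x : ℝ) :
    relDeg U P z .C .E x =
      if ⌊3 * x⌋ = 0 ∨ ⌊3 * x⌋ = 1 then 1 / (3 * 2 ^ (coord (3 * x) : ℕ)) else 0 := by
  have htile t : innerTile U P z .C .E x t = tileCE P z x t := if_pos (by norm_num [GPart.left])
  simp only [relDeg, htile]
  split_ifs with h <;> rw [eq_zero_or_one_iff] at h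
  · obtain ⟨b, hb⟩ := h
    exact integral_tileCE_right P hz hb
  · simp [tileCE_eq_zero_left P z _ h]

theorem relDeg_eq_of_generic (hz : z ∈ cube) (hz' : z' ∈ cube) (X Z : GPart) {x : ℝ}
    (hx : X = .E → Generic P z x ∧ Generic P z' x) :
    relDeg U P z X Z x = relDeg U P z' X Z x := by
  cases X with
  | C =>
    cases Z with
    | C => rw [relDeg_CC, relDeg_CC]
    | E => rw [relDeg_CE U P hz, relDeg_CE U P hz']
    | _ => rfl
  | E =>
    cases Z with
    | C => rw [relDeg_EC U P hz (hx rfl).1, relDeg_EC U P hz' (hx rfl).2]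
    | _ => rfl
  | _ => cases Z <;> rfl

theorem tileQ_eq_of_generic (hz : z ∈ cube) (hz' : z' ∈ cube) (X : GPart) {x : ℝ}
    (hx : X = .E → Generic P z x ∧ Generic P z' x) :
    tileQ U P z X x = tileQ U P z' X x := by
  simp only [tileQ, fun Z => relDeg_eq_of_generic U P hz hz' X Z hx]

end Degrees

/-! ### Where `W_P(z)` depends on `z` -/

/-- The points `x` of the part `X` and `y` of the part `Y` form a coding pair if the value of
`W_P(z)` there is prescribed by `z^{M_k}` or by a threshold `p_k(z)` or `1 - p_k(z)`. -/
def IsCodingPair (X Y : GPart) (x y : ℝ) : Prop :=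
  ((X = .C ∧ (Y = .C ∨ Y = .E)) ∨ (X = .E ∧ Y = .C)) ∧
    (∃ b, ⌊3 * x⌋ = third b) ∧ ∃ θ, ⌊3 * y⌋ = third θ

theorem IsCodingPair.symm {X Y : GPart} {x y : ℝ} (h : IsCodingPair X Y x y) :
    IsCodingPair Y X y x := by
  obtain ⟨hparts, hx, hy⟩ := h
  exact ⟨by tauto, hy, hx⟩

theorem tileCC_eq_zero (z : ℕ+ → ℝ) {x y : ℝ} (h : ¬IsCodingPair .C .C x y) :
    tileCC z x y = 0 := by
  by_cases hx : ∃ b, ⌊3 * x⌋ = third b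
  · exact tileCC_eq_zero_right z x fun hy => h ⟨.inl ⟨rfl, .inl rfl⟩, hx, hy⟩
  · exact tileCC_eq_zero_left z y hx

theorem tileCE_eq_zero (P : BoundingSequence) (z : ℕ+ → ℝ) {x y : ℝ}
    (h : ¬IsCodingPair .C .E x y) : tileCE P z x y = 0 := by
  by_cases hx : ∃ b, ⌊3 * x⌋ = third b
  · exact tileCE_eq_zero_right P z x fun hy => h ⟨.inl ⟨rfl, .inr rfl⟩, hx, hy⟩
  · exact tileCE_eq_zero_left P z y hx

section Independence

variable (U : (ℝ → ℝ → ℝ) → ℝ → ℝ → ℝ) {P : BoundingSequence} {z z' : ℕ+ → ℝ}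

theorem upperTile_eq_of_not_isCodingPair (P : BoundingSequence) (z z' : ℕ+ → ℝ) {X Y : GPart}
    {x y : ℝ} (h : ¬IsCodingPair X Y x y) : upperTile U P z X Y x y = upperTile U P z' X Y x y := by
  cases X with
  | C =>
    cases Y with
    | C => exact (tileCC_eq_zero z h).trans (tileCC_eq_zero z' h).symm
    | E => exact (tileCE_eq_zero P z h).trans (tileCE_eq_zero P z' h).symm
    | _ => rfl
  | _ => cases Y <;> rfl

theorem WP_eq_of_not_isCodingPair (hz : z ∈ cube) (hz' : z' ∈ cube) {s t : ℝ}
    (hs : Generic P z (relCoord s) ∧ Generic P z' (relCoord s))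
    (ht : Generic P z (relCoord t) ∧ Generic P z' (relCoord t))
    (h : ¬IsCodingPair (partOf s) (partOf t) (relCoord s) (relCoord t)) :
    WP U P z s t = WP U P z' s t := by
  unfold WP
  rcases tile_cases (partOf s) (partOf t) with ⟨c, -, h'⟩ | ⟨-, h'⟩ | ⟨-, h'⟩ | h' <;> rw [h', h']
  · exact tileQ_eq_of_generic U P hz hz' _ fun _ => hs
  · exact tileQ_eq_of_generic U P hz hz' _ fun _ => ht
  · unfold innerTile
    rw [upperTile_eq_of_not_isCodingPair U P z z' h,
      upperTile_eq_of_not_isCodingPair U P z z' fun h' => h h'.symm]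

/-- The points `y` and `y'` lie in the same third and in the same dyadic class and, in the first
third, both have a level strictly between the bounds `l_k` and `u_k`.  Such points of `E` are
twins in `W_P(z)` apart from the coding pairs. -/
structure SameClass (P : BoundingSequence) (y y' : ℝ) : Prop where
  floor_eq : ⌊3 * y⌋ = ⌊3 * y'⌋
  coord_eq : coord (3 * y) = coord (3 * y')
  level_mem : ⌊3 * y⌋ = 0 → level y ∈ Ioo (P.l (coord (3 * y))) (P.u (coord (3 * y)))
  level_mem' : ⌊3 * y⌋ = 0 → level y' ∈ Ioo (P.l (coord (3 * y))) (P.u (coord (3 * y)))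

theorem tileDGE_eq_of_sameClass {y y' : ℝ} (h : SameClass P y y') (x : ℝ) :
    tileDGE P x y = tileDGE P x y' := by
  unfold tileDGE
  refine if_congr ?_ rfl rfl
  rw [← h.floor_eq, ← h.coord_eq]
  by_cases h0 : ⌊3 * y⌋ = 0
  · have hlevel := scaled_eq_level h0
    have hlevel' := scaled_eq_level (h.floor_eq.symm.trans h0)
    rw [← h.coord_eq] at hlevel'
    norm_num only [Int.cast_zero, zero_add] at hlevel hlevel'
    obtain ⟨hl, hu⟩ := h.level_mem h0
    obtain ⟨hl', hu'⟩ := h.level_mem' h0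
    simp [hlevel, hlevel', hu.le, hu'.le, hl.not_ge, hl'.not_ge]
  · simp [h0]

theorem upperTile_eq_of_sameClass (z : ℕ+ → ℝ) {y y' : ℝ} (h : SameClass P y y') {X : GPart}
    {x : ℝ} (hX : ¬IsCodingPair X .E x y) :
    upperTile U P z X .E x y = upperTile U P z X .E x y' := by
  cases X with
  | A => exact if_congr (by rw [h.floor_eq]) rfl rfl
  | B => exact if_congr (by rw [h.floor_eq, h.coord_eq]) rfl rfl
  | C =>
    have hX' : ¬IsCodingPair .C .E x y' := by
      rwa [IsCodingPair, ← h.floor_eq]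
    exact (tileCE_eq_zero P z hX).trans (tileCE_eq_zero P z hX').symm
  | D j => exact if_congr Iff.rfl (tileDGE_eq_of_sameClass h x) rfl
  | _ => rfl

theorem innerTile_eq_of_sameClass (z : ℕ+ → ℝ) {y y' : ℝ} (h : SameClass P y y') {X : GPart}
    {x : ℝ} (hX : ¬IsCodingPair .E X y x) :
    innerTile U P z .E X y x = innerTile U P z .E X y' x := by
  refine if_congr Iff.rfl ?_ (upperTile_eq_of_sameClass U z h fun h' => hX h'.symm)
  cases X <;> rfl

theorem relDeg_eq_of_sameClass (hz : z ∈ cube) {y y' : ℝ} (h : SameClass P y y')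
    (hy : Generic P z y) (hy' : Generic P z y') (Z : GPart) :
    relDeg U P z .E Z y = relDeg U P z .E Z y' := by
  by_cases hZ : Z = .C
  · rw [hZ, relDeg_EC U P hz hy, relDeg_EC U P hz hy', h.floor_eq, h.coord_eq]
  · unfold relDeg
    congr 1
    funext t
    exact innerTile_eq_of_sameClass U z h fun h' => by simp [IsCodingPair, hZ] at h'

theorem WP_eq_of_sameClass (hz : z ∈ cube) {s s' t : ℝ} (hs : partOf s = .E)
    (hs' : partOf s' = .E) (h : SameClass P (relCoord s) (relCoord s'))
    (hg : Generic P z (relCoord s)) (hg' : Generic P z (relCoord s'))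
    (hst : ¬IsCodingPair (partOf s) (partOf t) (relCoord s) (relCoord t)) :
    WP U P z s t = WP U P z s' t := by
  unfold WP
  rw [hs, hs']
  rw [hs] at hst
  rcases tile_cases .E (partOf t) with ⟨c, -, h'⟩ | ⟨-, h'⟩ | ⟨-, h'⟩ | h' <;> rw [h']
  · simp only [tileQ, relDeg_eq_of_sameClass U hz h hg hg']
  · exact innerTile_eq_of_sameClass U z h hst

end Independence

/-! ### Cells -/

/-- The four ranges into which the levels of a dyadic class of `E` are divided by the lower bound,
the threshold and the upper bound. -/
inductive Band where
  | below | low | high | above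

/-- The cells into which the unit interval is divided: the dyadic classes of the first two
thirds of `C`, the bands of the dyadic classes of the first two thirds of `E`, and the set of all
remaining points. -/
inductive Cell where
  | C (b : Bool) (k : ℕ+)
  | E (θ : Bool) (k : ℕ+) (β : Band)
  | rest

instance : Finite Band :=
  Finite.of_injective (Band.rec (0 : Fin 4) 1 2 3) fun β β' h => by
    cases β <;> cases β' <;> first | rfl | simp at h

instance : Countable Cell := by
  let f : Cell → Option ((Bool × ℕ+) ⊕ (Bool × ℕ+ × Band)) := fun c =>
    match c with
    | .C b k => some (.inl (b, k))
    | .E θ k β => some (.inr (θ, k, β))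
    | .rest => none
  refine Function.Injective.countable (f := f) ?_
  rintro (_ | _ | _) (_ | _ | _) h <;> simp_all [f]

/-- The least possible value of a threshold for feasible `z`. -/
def lowerBound (P : BoundingSequence) (θ : Bool) (k : ℕ+) : ℝ := if θ then 0 else P.l k

/-- The largest possible value of a threshold for feasible `z`. -/
def upperBound (P : BoundingSequence) (θ : Bool) (k : ℕ+) : ℝ := if θ then 1 else P.u k

theorem lowerBound_nonneg (P : BoundingSequence) (θ : Bool) (k : ℕ+) : 0 ≤ lowerBound P θ k := by
  cases θ
  · exact (P.l_mem k).1
  · exact le_rfl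

theorem upperBound_le_one (P : BoundingSequence) (θ : Bool) (k : ℕ+) : upperBound P θ k ≤ 1 := by
  cases θ
  · exact (P.u_mem k).2
  · exact le_rfl

theorem lowerBound_le_upperBound (P : BoundingSequence) (θ : Bool) (k : ℕ+) :
    lowerBound P θ k ≤ upperBound P θ k := by
  cases θ
  · exact P.l_le_u k
  · exact zero_le_one

theorem threshold_mem_bounds {P : BoundingSequence} {z : ℕ+ → ℝ} (hz : z ∈ cube)
    (hf : Feasible P z) (θ : Bool) (k : ℕ+) :
    eval z (threshold P θ k) ∈ Icc (lowerBound P θ k) (upperBound P θ k) := by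
  cases θ
  · exact hf k
  · exact threshold_mem P true k hz

theorem iota_mem (X : GPart) {y : ℝ} (hy : y ∈ Ico (0 : ℝ) 1) : X.iota y ∈ Ico (0 : ℝ) 1 := by
  obtain ⟨h0, h1⟩ := hy
  cases X with
  | D j =>
    have hj : ((j : ℕ) : ℝ) ≤ 6 := by exact_mod_cast Nat.lt_succ_iff.mp j.2
    simp only [GPart.iota, GPart.left, GPart.size]
    constructor
    · positivity
    · linarith
  | _ =>
    simp only [GPart.iota, GPart.left, GPart.size]
    constructor <;> linarith

/-- The points of the part `X` with relative coordinate in the third with index `b`, in the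
`k`-th dyadic class and with level in `[a, c)`. -/
def region (X : GPart) (b : Bool) (k : ℕ+) (a c : ℝ) : Set ℝ :=
  {s | s ∈ Ico (0 : ℝ) 1 ∧ partOf s = X ∧ relCoord s ∈ levelSet (third b) k a c}

theorem measurableSet_region (X : GPart) (b : Bool) (k : ℕ+) (a c : ℝ) :
    MeasurableSet (region X b k a c) :=
  measurableSet_Ico.inter ((measurable_partOf (measurableSet_singleton X)).inter
    (measurable_relCoord (measurableSet_levelSet _ _ _ _)))

theorem region_eq_image_iota (X : GPart) (b : Bool) (k : ℕ+) (a c : ℝ) :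
    region X b k a c = X.iota '' levelSet (third b) k a c := by
  ext s
  constructor
  · rintro ⟨-, rfl, hs⟩
    exact ⟨relCoord s, hs, iota_relCoord s⟩
  · rintro ⟨y, hy, rfl⟩
    have hmem := levelSet_third_subset b k a c hy
    obtain ⟨hpart, hrel⟩ := partOf_iota X y hmem
    exact ⟨iota_mem X hmem, hpart, hrel.symm ▸ hy⟩

theorem volume_region (X : GPart) (b : Bool) (k : ℕ+) {a c : ℝ} (ha : 0 ≤ a) (hac : a ≤ c)
    (hc : c ≤ 1) :
    volume.real (region X b k a c) = X.size * ((c - a) / (3 * 2 ^ (k : ℕ))) := by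
  have hiota : X.iota = fun y => X.size * y + X.left := funext fun y => add_comm _ _
  have hle := (levelPoint_strictMono (third b) k).monotone hac
  rw [region_eq_image_iota, ← volume_levelSet (third b) k ha hac hc, levelSet_eq_Ico _ _ ha hc,
    hiota, image_affine_Ico (size_pos X), Real.volume_real_Ico_of_le hle,
    Real.volume_real_Ico_of_le (by gcongr; exact (size_pos X).le)]
  ring

theorem region_mono {X : GPart} {b : Bool} {k : ℕ+} {a c a' c' : ℝ} (ha : a' ≤ a)
    (hc : c ≤ c') : region X b k a c ⊆ region X b k a' c' :=
  fun _ ⟨hs, hpart, hfloor, hcoord, hle, hlt⟩ =>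
    ⟨hs, hpart, hfloor, hcoord, ha.trans hle, hlt.trans_le hc⟩

/-- The points of the unit interval outside the first two thirds of `C` and of `E`. -/
def restSet : Set ℝ :=
  {s | s ∈ Ico (0 : ℝ) 1 ∧
    ¬((partOf s = .C ∨ partOf s = .E) ∧ ∃ b, ⌊3 * relCoord s⌋ = third b)}

theorem measurableSet_restSet : MeasurableSet restSet := by
  have hthird : MeasurableSet {i : ℤ | ∃ b, i = third b} := .of_discrete
  have hcell : MeasurableSet {s | (partOf s = .C ∨ partOf s = .E) ∧
      ∃ b, ⌊3 * relCoord s⌋ = third b} :=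
    ((measurable_partOf (measurableSet_singleton GPart.C)).union
      (measurable_partOf (measurableSet_singleton GPart.E))).inter
      ((measurable_third.comp measurable_relCoord) hthird)
  exact measurableSet_Ico.inter hcell.compl

section Cells

variable {P : BoundingSequence} {z : ℕ+ → ℝ}

/-- The lower and the upper end of a band, `τ` being the threshold. -/
def Band.ends (P : BoundingSequence) (θ : Bool) (k : ℕ+) (τ : ℝ) : Band → ℝ × ℝ
  | .below => (0, lowerBound P θ k)
  | .low => (lowerBound P θ k, τ)
  | .high => (τ, upperBound P θ k)
  | .above => (upperBound P θ k, 1)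

/-- The lower and the upper end of a band with the division at the threshold removed. -/
def Band.hullEnds (P : BoundingSequence) (θ : Bool) (k : ℕ+) : Band → ℝ × ℝ
  | .below => (0, lowerBound P θ k)
  | .low | .high => (lowerBound P θ k, upperBound P θ k)
  | .above => (upperBound P θ k, 1)

theorem Band.hullEnds_ordered (P : BoundingSequence) (θ : Bool) (k : ℕ+) (β : Band) :
    0 ≤ (β.hullEnds P θ k).1 ∧ (β.hullEnds P θ k).1 ≤ (β.hullEnds P θ k).2 ∧
      (β.hullEnds P θ k).2 ≤ 1 := by
  have h0 := lowerBound_nonneg P θ k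
  have hle := lowerBound_le_upperBound P θ k
  have h1 := upperBound_le_one P θ k
  cases β with
  | below => exact ⟨le_rfl, h0, hle.trans h1⟩
  | low | high => exact ⟨h0, hle, h1⟩
  | above => exact ⟨h0.trans hle, h1, le_rfl⟩

/-- The points that belong to a cell; they depend on `z` through the thresholds. -/
def cellSet (P : BoundingSequence) (z : ℕ+ → ℝ) : Cell → Set ℝ
  | .C b k => region .C b k 0 1
  | .E θ k β =>
    region .E θ k (β.ends P θ k (eval z (threshold P θ k))).1
      (β.ends P θ k (eval z (threshold P θ k))).2
  | .rest => restSet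

/-- The hull of a cell: a set that contains it for all feasible `z`. -/
def hullSet (P : BoundingSequence) : Cell → Set ℝ
  | .C b k => region .C b k 0 1
  | .E θ k β => region .E θ k (β.hullEnds P θ k).1 (β.hullEnds P θ k).2
  | .rest => restSet

theorem measurableSet_cellSet (P : BoundingSequence) (z : ℕ+ → ℝ) (c : Cell) :
    MeasurableSet (cellSet P z c) := by
  cases c with
  | rest => exact measurableSet_restSet
  | _ => exact measurableSet_region _ _ _ _ _

theorem measurableSet_hullSet (P : BoundingSequence) (c : Cell) :
    MeasurableSet (hullSet P c) := by
  cases c with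
  | rest => exact measurableSet_restSet
  | _ => exact measurableSet_region _ _ _ _ _

theorem hullSet_subset (P : BoundingSequence) (c : Cell) : hullSet P c ⊆ Ico 0 1 := by
  cases c <;> exact fun s hs => hs.1

theorem cellSet_subset_hullSet (hz : z ∈ cube) (hf : Feasible P z) (c : Cell) :
    cellSet P z c ⊆ hullSet P c := by
  cases c with
  | E θ k β =>
    obtain ⟨hlower, hupper⟩ := threshold_mem_bounds hz hf θ k
    cases β with
    | low => exact region_mono le_rfl hupper
    | high => exact region_mono hlower le_rfl
    | _ => exact subset_rfl
  | _ => exact subset_rfl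

theorem Band.exists_mem_ends (P : BoundingSequence) (θ : Bool) (k : ℕ+) (τ : ℝ) {a : ℝ}
    (ha : a ∈ Ico (0 : ℝ) 1) : ∃ β, (ends P θ k τ β).1 ≤ a ∧ a < (ends P θ k τ β).2 := by
  by_cases hlower : a < lowerBound P θ k
  · exact ⟨.below, ha.1, hlower⟩
  by_cases hτ : a < τ
  · exact ⟨.low, not_lt.mp hlower, hτ⟩
  by_cases hupper : a < upperBound P θ k
  · exact ⟨.high, not_lt.mp hτ, hupper⟩
  · exact ⟨.above, not_lt.mp hupper, ha.2⟩

theorem Band.eq_of_mem_ends {θ : Bool} {k : ℕ+} {τ a : ℝ}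
    (hτ : τ ∈ Icc (lowerBound P θ k) (upperBound P θ k)) {β β' : Band}
    (h : (ends P θ k τ β).1 ≤ a ∧ a < (ends P θ k τ β).2)
    (h' : (ends P θ k τ β').1 ≤ a ∧ a < (ends P θ k τ β').2) : β = β' := by
  obtain ⟨hlower, hupper⟩ := hτ
  cases β <;> cases β' <;> first
    | rfl
    | exfalso
      simp only [ends] at h h'
      linarith [h.1, h.2, h'.1, h'.2]

theorem iUnion_cellSet (hz : z ∈ cube) (hf : Feasible P z) : ⋃ c, cellSet P z c = Ico 0 1 := by
  refine Subset.antisymm (iUnion_subset fun c =>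
    (cellSet_subset_hullSet hz hf c).trans (hullSet_subset P c)) fun s hs => ?_
  rw [mem_iUnion]
  by_cases h : (partOf s = .C ∨ partOf s = .E) ∧ ∃ b, ⌊3 * relCoord s⌋ = third b
  · obtain ⟨hpart | hpart, b, hb⟩ := h
    · exact ⟨.C b (coord (3 * relCoord s)), hs, hpart, hb, rfl, level_mem _⟩
    · obtain ⟨β, hβ⟩ := Band.exists_mem_ends P b (coord (3 * relCoord s))
        (eval z (threshold P b (coord (3 * relCoord s)))) (level_mem (relCoord s))
      exact ⟨.E b (coord (3 * relCoord s)) β, hs, hpart, hb, rfl, hβ⟩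
  · exact ⟨.rest, hs, h⟩

theorem cell_eq_of_mem_cellSet (hz : z ∈ cube) (hf : Feasible P z) {c c' : Cell} {s : ℝ}
    (h : s ∈ cellSet P z c) (h' : s ∈ cellSet P z c') : c = c' := by
  have class_eq {X X' : GPart} {b b' : Bool} {k k' : ℕ+} {l u l' u' : ℝ}
      (h : s ∈ region X b k l u) (h' : s ∈ region X' b' k' l' u') : X = X' ∧ b = b' ∧ k = k' :=
    ⟨h.2.1.symm.trans h'.2.1, third_injective (h.2.2.1.symm.trans h'.2.2.1),
      h.2.2.2.1.symm.trans h'.2.2.2.1⟩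
  have not_rest {X : GPart} {b : Bool} {k : ℕ+} {l u : ℝ} (hX : X = .C ∨ X = .E)
      (h : s ∈ region X b k l u) : s ∉ restSet := fun h' =>
    h'.2 ⟨h.2.1.symm ▸ hX, b, h.2.2.1⟩
  match c, c' with
  | .C b k, .C b' k' =>
    obtain ⟨-, rfl, rfl⟩ := class_eq h h'
    rfl
  | .E θ k β, .E θ' k' β' =>
    obtain ⟨-, rfl, rfl⟩ := class_eq h h'
    rw [Band.eq_of_mem_ends (threshold_mem_bounds hz hf θ k) h.2.2.2.2 h'.2.2.2.2]
  | .C b k, .E θ k' β => exact absurd (class_eq h h').1 (by simp)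
  | .E θ k β, .C b k' => exact absurd (class_eq h h').1 (by simp)
  | .C b k, .rest => exact absurd h' (not_rest (.inl rfl) h)
  | .rest, .C b k => exact absurd h (not_rest (.inl rfl) h')
  | .E θ k β, .rest => exact absurd h' (not_rest (.inr rfl) h)
  | .rest, .E θ k β => exact absurd h (not_rest (.inr rfl) h')
  | .rest, .rest => rfl

end Cells

/-! ### Coding pairs of cells -/

/-- The pairs of cells whose points form coding pairs. -/
def isCoding : Cell → Cell → Bool
  | .C _ _, .C _ _ => true
  | .C _ _, .E _ _ _ => true
  | .E _ _ _, .C _ _ => true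
  | _, _ => false

/-- The bands on which the points of the second third of `C`, rather than those of the first, are
joined to the points of `E`. -/
def Band.aboveThreshold : Band → Bool
  | .below | .low => false
  | .high | .above => true

/-- The polynomial in `z` giving the value of `W_P(z)` on a coding pair of cells. -/
def pairPoly : Cell → Cell → MvPolynomial ℕ+ ℝ
  | .C b k, .C b' k' => if k = k' then
      if b = b' then monomial (M k) 1 else 1 - monomial (M k) 1 else 0
  | .C b k, .E _ k' β => if k = k' ∧ b = β.aboveThreshold then 1 else 0
  | .E _ k' β, .C b k => if k = k' ∧ b = β.aboveThreshold then 1 else 0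
  | _, _ => 0

section CodingPairs

variable {P : BoundingSequence} {z : ℕ+ → ℝ}

theorem tileCC_eq_eval_pairPoly {s t : ℝ} {b b' : Bool} {k k' : ℕ+}
    (hs : s ∈ cellSet P z (.C b k)) (ht : t ∈ cellSet P z (.C b' k')) :
    tileCC z (relCoord s) (relCoord t) = eval z (pairPoly (.C b k) (.C b' k')) := by
  obtain ⟨-, -, hfloor, rfl, -⟩ := hs
  obtain ⟨-, -, hfloor', rfl, -⟩ := ht
  rw [tileCC_eq z hfloor hfloor']
  simp only [pairPoly, apply_ite (eval z), map_sub, map_one, map_zero, eval_monomial_one]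

theorem Band.threshold_lt_iff {θ : Bool} {k : ℕ+} {τ a : ℝ} {β : Band}
    (hτ : τ ∈ Icc (lowerBound P θ k) (upperBound P θ k)) (ha : a ≠ τ)
    (hβ : (ends P θ k τ β).1 ≤ a ∧ a < (ends P θ k τ β).2) :
    τ < a ↔ β.aboveThreshold = true := by
  obtain ⟨hlower, hupper⟩ := hτ
  obtain ⟨hle, hlt⟩ := hβ
  cases β <;> simp only [ends] at hle hlt <;>
    simp only [aboveThreshold, Bool.false_eq_true, iff_false, iff_true, not_lt]
  · linarith
  · exact hlt.le
  · exact lt_of_le_of_ne hle ha.symm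
  · exact lt_of_le_of_ne (hupper.trans hle) ha.symm

open Classical in
theorem tileCE_eq_eval_pairPoly (hz : z ∈ cube) (hf : Feasible P z) {s t : ℝ} {b θ : Bool}
    {k k' : ℕ+} {β : Band} (hs : s ∈ cellSet P z (.C b k)) (ht : t ∈ cellSet P z (.E θ k' β))
    (hg : Generic P z (relCoord t)) :
    tileCE P z (relCoord s) (relCoord t) = eval z (pairPoly (.C b k) (.E θ k' β)) := by
  obtain ⟨-, -, hfloor, rfl, -⟩ := hs
  obtain ⟨-, -, hfloor', rfl, hlevel⟩ := ht
  have hne := hg.ne_threshold θ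
  have hiff := Band.threshold_lt_iff (threshold_mem_bounds hz hf θ _) hne hlevel
  rw [tileCE_eq P hz hfloor hfloor' hg.ne_zero]
  simp only [pairPoly, apply_ite (eval z), map_one, map_zero]
  refine if_congr (and_congr_right fun _ => ?_) rfl rfl
  rw [hne.le_iff_lt, hne.symm.le_iff_lt, hiff, ← not_le, hne.symm.le_iff_lt, hiff]
  cases b <;> cases β.aboveThreshold <;> simp

theorem WP_eq_eval_pairPoly (U : (ℝ → ℝ → ℝ) → ℝ → ℝ → ℝ) (hz : z ∈ cube) (hf : Feasible P z)
    {c c' : Cell} (hc : isCoding c c' = true) {s t : ℝ} (hs : s ∈ cellSet P z c)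
    (ht : t ∈ cellSet P z c') (hgs : Generic P z (relCoord s)) (hgt : Generic P z (relCoord t)) :
    WP U P z s t = eval z (pairPoly c c') := by
  unfold WP
  match c, c' with
  | .C b k, .C b' k' =>
    rw [hs.2.1, ht.2.1]
    exact (if_pos le_rfl).trans (tileCC_eq_eval_pairPoly hs ht)
  | .C b k, .E θ k' β =>
    rw [hs.2.1, ht.2.1]
    exact (if_pos (by norm_num [GPart.left])).trans (tileCE_eq_eval_pairPoly hz hf hs ht hgt)
  | .E θ k β, .C b k' =>
    rw [hs.2.1, ht.2.1]
    exact (if_neg (by norm_num [GPart.left])).trans (tileCE_eq_eval_pairPoly hz hf ht hs hgs)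

theorem not_isCodingPair_of_mem_hullSet {c c' : Cell} (hc : ¬isCoding c c' = true) {s t : ℝ}
    (hs : s ∈ hullSet P c) (ht : t ∈ hullSet P c') :
    ¬IsCodingPair (partOf s) (partOf t) (relCoord s) (relCoord t) := by
  rintro ⟨hparts, hthird, hthird'⟩
  match c, c' with
  | .rest, _ =>
    obtain ⟨-, hrest⟩ := hs
    exact hrest ⟨by tauto, hthird⟩
  | _, .rest =>
    obtain ⟨-, hrest⟩ := ht
    exact hrest ⟨by tauto, hthird'⟩
  | .E θ k β, .E θ' k' β' =>
    rw [hs.2.1, ht.2.1] at hparts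
    exact absurd hparts (by simp)
  | .C _ _, .C _ _ | .C _ _, .E _ _ _ | .E _ _ _, .C _ _ => exact hc rfl

end CodingPairs

/-! ### Collapsing the cells of `E` -/

section Collapse

variable {P : BoundingSequence} {z : ℕ+ → ℝ}

theorem countable_not_generic_relCoord (P : BoundingSequence) (z : ℕ+ → ℝ) :
    {s | ¬Generic P z (relCoord s)}.Countable := by
  refine (countable_iUnion fun X : GPart =>
    (countable_not_generic P z).image X.iota).mono fun s hs => ?_
  exact mem_iUnion.mpr ⟨partOf s, relCoord s, hs, iota_relCoord s⟩

theorem ae_mem_and_generic (P : BoundingSequence) (z : ℕ+ → ℝ) {S : Set ℝ}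
    (hS : MeasurableSet S) : ∀ᵐ s ∂volume.restrict S, s ∈ S ∧ Generic P z (relCoord s) := by
  filter_upwards [(countable_not_generic_relCoord P z).ae_notMem (volume.restrict S),
    ae_restrict_mem hS] with s hgeneric hs
  exact ⟨hs, not_not.mp hgeneric⟩

/-- The cells that depend on `z`. -/
def IsMiddle : Cell → Prop
  | .E _ _ .low | .E _ _ .high => True
  | _ => False

/-- The polynomial giving the ratio of the measures of a cell and of its hull.  If the hull is
null, the value is `0` for the middle cells, because of `0⁻¹ = 0`. -/
def ratioPoly (P : BoundingSequence) : Cell → MvPolynomial ℕ+ ℝ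
  | .E θ k .low => MvPolynomial.C (upperBound P θ k - lowerBound P θ k)⁻¹ *
      (threshold P θ k - MvPolynomial.C (lowerBound P θ k))
  | .E θ k .high => MvPolynomial.C (upperBound P θ k - lowerBound P θ k)⁻¹ *
      (MvPolynomial.C (upperBound P θ k) - threshold P θ k)
  | _ => 1

theorem cellSet_eq_hullSet (P : BoundingSequence) (z : ℕ+ → ℝ) {c : Cell} (hc : ¬IsMiddle c) :
    cellSet P z c = hullSet P c := by
  match c with
  | .E θ k .low | .E θ k .high => exact absurd trivial hc
  | .C _ _ | .E _ _ .below | .E _ _ .above | .rest => rfl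

theorem ratioPoly_eq_one (P : BoundingSequence) {c : Cell} (hc : ¬IsMiddle c) :
    ratioPoly P c = 1 := by
  match c with
  | .E θ k .low | .E θ k .high => exact absurd trivial hc
  | .C _ _ | .E _ _ .below | .E _ _ .above | .rest => rfl

theorem eval_ratioPoly_nonneg (hz : z ∈ cube) (hf : Feasible P z) (c : Cell) :
    0 ≤ eval z (ratioPoly P c) := by
  match c with
  | .E θ k .low | .E θ k .high =>
    obtain ⟨hlower, hupper⟩ := threshold_mem_bounds hz hf θ k
    have hinv : 0 ≤ (upperBound P θ k - lowerBound P θ k)⁻¹ :=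
      inv_nonneg.mpr (sub_nonneg.mpr (hlower.trans hupper))
    simp only [ratioPoly, map_mul, map_sub, eval_C]
    exact mul_nonneg hinv (by linarith)
  | .C _ _ | .E _ _ .below | .E _ _ .above | .rest => simp [ratioPoly]

theorem volume_cellSet (hz : z ∈ cube) (hf : Feasible P z) (c : Cell) :
    volume.real (cellSet P z c) = eval z (ratioPoly P c) * volume.real (hullSet P c) := by
  by_cases hc : IsMiddle c
  · match c with
    | .E θ k β =>
      obtain ⟨hlower, hupper⟩ := threshold_mem_bounds hz hf θ k
      have h0 := lowerBound_nonneg P θ k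
      have h1 := upperBound_le_one P θ k
      have hull := volume_region .E θ k h0 (hlower.trans hupper) h1
      have cancel {a : ℝ} (ha : upperBound P θ k - lowerBound P θ k = 0 → a = 0) :
          (upperBound P θ k - lowerBound P θ k)⁻¹ * a * (upperBound P θ k - lowerBound P θ k) =
            a := by
        by_cases h : upperBound P θ k - lowerBound P θ k = 0
        · simp [ha h]
        · field_simp
      match β with
      | .low =>
        simp only [cellSet, hullSet, Band.ends, Band.hullEnds, ratioPoly, map_mul, map_sub, eval_C]
        rw [hull, volume_region .E θ k h0 hlower (hupper.trans h1)]
        linear_combination -(GPart.E.size / (3 * 2 ^ (k : ℕ))) *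
          cancel (a := eval z (threshold P θ k) - lowerBound P θ k) fun h => by linarith
      | .high =>
        simp only [cellSet, hullSet, Band.ends, Band.hullEnds, ratioPoly, map_mul, map_sub, eval_C]
        rw [hull, volume_region .E θ k (h0.trans hlower) hupper h1]
        linear_combination -(GPart.E.size / (3 * 2 ^ (k : ℕ))) *
          cancel (a := upperBound P θ k - eval z (threshold P θ k)) fun h => by linarith
  · rw [cellSet_eq_hullSet P z hc, ratioPoly_eq_one P hc, map_one, one_mul]

theorem level_mem_Ioo_of_generic {s : ℝ} {θ : Bool} {k : ℕ+}
    (hs : s ∈ region .E θ k (lowerBound P θ k) (upperBound P θ k))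
    (hg : Generic P z (relCoord s)) (h0 : ⌊3 * relCoord s⌋ = 0) :
    level (relCoord s) ∈ Ioo (P.l k) (P.u k) := by
  obtain ⟨-, -, hfloor, hcoord, hlower, hupper⟩ := hs
  obtain rfl : θ = false := third_injective (hfloor.symm.trans h0)
  exact ⟨lt_of_le_of_ne hlower (hcoord ▸ hg.ne_l).symm, hupper⟩

theorem sameClass_of_mem_hullSet {c : Cell} (hc : IsMiddle c) {s s' : ℝ}
    (hs : s ∈ hullSet P c) (hs' : s' ∈ hullSet P c) (hg : Generic P z (relCoord s))
    (hg' : Generic P z (relCoord s')) :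
    partOf s = .E ∧ partOf s' = .E ∧ SameClass P (relCoord s) (relCoord s') := by
  match c with
  | .E θ k .low | .E θ k .high =>
    have hlevel := level_mem_Ioo_of_generic hs hg
    have hlevel' := level_mem_Ioo_of_generic hs' hg'
    obtain ⟨-, hpart, hfloor, hcoord, -⟩ := hs
    obtain ⟨-, hpart', hfloor', hcoord', -⟩ := hs'
    rw [hfloor] at hlevel
    rw [hfloor'] at hlevel'
    refine ⟨hpart, hpart', hfloor.trans hfloor'.symm, hcoord.trans hcoord'.symm, ?_, ?_⟩ <;>
      (rw [hfloor, hcoord]; assumption)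

instance (P : BoundingSequence) (c : Cell) : IsFiniteMeasure (volume.restrict (hullSet P c)) :=
  isFiniteMeasure_of_le (volume.restrict (Ico 0 1))
    (Measure.restrict_mono (hullSet_subset P c) le_rfl)

theorem volume_cellSet_eq_smul (hz : z ∈ cube) (hf : Feasible P z) (c : Cell) :
    volume (cellSet P z c) = (eval z (ratioPoly P c)).toNNReal • volume (hullSet P c) := by
  have ne_top {S : Set ℝ} (hS : S ⊆ Ico 0 1) : volume S ≠ ⊤ :=
    ((measure_mono hS).trans_lt measure_Ico_lt_top).ne
  have hcell := ne_top ((cellSet_subset_hullSet hz hf c).trans (hullSet_subset P c))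
  have hhull := ne_top (hullSet_subset P c)
  rw [ENNReal.smul_def, smul_eq_mul,
    ← ENNReal.toReal_eq_toReal_iff' hcell (ENNReal.mul_ne_top ENNReal.coe_ne_top hhull),
    ENNReal.toReal_mul, ENNReal.coe_toReal, Real.coe_toNNReal _ (eval_ratioPoly_nonneg hz hf c)]
  exact volume_cellSet hz hf c

/-- A map collapses a cell if it moves generic points within the hull, only if the cell is a middle
cell, and makes the cell and its hull proportional. -/
structure IsCollapse (P : BoundingSequence) (z : ℕ+ → ℝ) (c : Cell) (κ : ℝ → ℝ) : Prop where
  measurable : Measurable κ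
  map_cellSet : (volume.restrict (cellSet P z c)).map κ =
    (eval z (ratioPoly P c)).toNNReal • (volume.restrict (hullSet P c)).map κ
  mem_hullSet : ∀ s ∈ hullSet P c, Generic P 0 (relCoord s) →
    κ s ∈ hullSet P c ∧ Generic P 0 (relCoord (κ s)) ∧ (κ s = s ∨ IsMiddle c)

theorem exists_isCollapse (hz : z ∈ cube) (hf : Feasible P z) (c : Cell) :
    ∃ κ, IsCollapse P z c κ := by
  by_cases hc : IsMiddle c
  · by_cases hex : ∃ p ∈ hullSet P c, Generic P 0 (relCoord p)
    · obtain ⟨p, hp, hgp⟩ := hex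
      refine ⟨fun _ => p, measurable_const, ?_, fun s _ _ => ⟨hp, hgp, .inr hc⟩⟩
      rw [Measure.map_const, Measure.map_const, Measure.restrict_apply_univ,
        Measure.restrict_apply_univ, volume_cellSet_eq_smul hz hf, smul_assoc]
    · have hhull : volume (hullSet P c) = 0 :=
        ((countable_not_generic_relCoord P 0).mono fun s hs hg => hex ⟨s, hs, hg⟩).measure_zero _
      have hcell : volume (cellSet P z c) = 0 :=
        measure_mono_null (cellSet_subset_hullSet hz hf c) hhull
      exact ⟨id, measurable_id, by
        rw [Measure.restrict_eq_zero.mpr hcell, Measure.restrict_eq_zero.mpr hhull]; simp,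
        fun s hs hg => ⟨hs, hg, .inl rfl⟩⟩
  · refine ⟨id, measurable_id, ?_, fun s hs hg => ⟨hs, hg, .inl rfl⟩⟩
    rw [cellSet_eq_hullSet P z hc, ratioPoly_eq_one P hc, map_one, Real.toNNReal_one, one_smul]

end Collapse

/-! ### The expansion of the density over configurations of cells -/

section Expansion

variable {n : ℕ} (H : SimpleGraph (Fin n)) {U : (ℝ → ℝ → ℝ) → ℝ → ℝ → ℝ} {P : BoundingSequence}
  {z : ℕ+ → ℝ}

open Classical in
/-- The factor of the integrand of `τ(H, W)` for the pair `i, j`, if `w` is the value of `W`. -/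
def edgeValue (i j : Fin n) (w : ℝ) : ℝ :=
  if H.Adj i j then w else 1 - w

/-- The part of the integrand of `τ(H, W)` coming from the pairs of vertices in non-coding pairs
of cells; for `W = W_P(z)` it does not depend on `z`. -/
def freeFactor (h : Fin n → Cell) (W : ℝ → ℝ → ℝ) (x : Fin n → ℝ) : ℝ :=
  ∏ e : Fin n × Fin n with e.1 < e.2,
    if isCoding (h e.1) (h e.2) then 1 else edgeValue H e.1 e.2 (W (x e.1) (x e.2))

open Classical in
/-- The part of the integrand of `τ(H, W_P(z))` coming from the pairs of vertices in coding pairs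
of cells, as a polynomial in `z`. -/
def codingFactor (h : Fin n → Cell) : MvPolynomial ℕ+ ℝ :=
  ∏ e : Fin n × Fin n with e.1 < e.2,
    if isCoding (h e.1) (h e.2) then
      if H.Adj e.1 e.2 then pairPoly (h e.1) (h e.2) else 1 - pairPoly (h e.1) (h e.2)
    else 1

/-- The integral of the factors that do not depend on `z`, over the hulls of the cells.  The
argument `0` of `W_P` stands for an arbitrary point of the cube. -/
def freeIntegral (U : (ℝ → ℝ → ℝ) → ℝ → ℝ → ℝ) (P : BoundingSequence) (h : Fin n → Cell) : ℝ :=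
  ∫ x in univ.pi fun i => hullSet P (h i), freeFactor H h (WP U P 0) x

/-- The part of the contribution of a configuration that is polynomial in `z`. -/
def shapePoly (P : BoundingSequence) (h : Fin n → Cell) : MvPolynomial ℕ+ ℝ :=
  (∏ i, ratioPoly P (h i)) * codingFactor H h

/-- The contribution to `τ(H, W_P(z))` of the configurations in which the `i`-th vertex lies in
the cell `h i`. -/
def contribution (U : (ℝ → ℝ → ℝ) → ℝ → ℝ → ℝ) (P : BoundingSequence) (h : Fin n → Cell) :
    MvPolynomial ℕ+ ℝ :=
  MvPolynomial.C (freeIntegral H U P h) * shapePoly H P h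

theorem edgeValue_mem (i j : Fin n) {w : ℝ} (hw : w ∈ Icc (0 : ℝ) 1) :
    edgeValue H i j w ∈ Icc (0 : ℝ) 1 := by
  unfold edgeValue
  split_ifs
  · exact hw
  · exact one_sub_mem_Icc_zero_one hw

theorem measurable_edgeValue_apply {W : ℝ → ℝ → ℝ} (hW : IsPlaneGraphon W) (i j : Fin n) :
    Measurable fun x : Fin n → ℝ => edgeValue H i j (W (x i) (x j)) := by
  have hWx : Measurable fun x : Fin n → ℝ => W (x i) (x j) :=
    hW.meas.comp (f := fun x : Fin n → ℝ => (x i, x j))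
      ((measurable_pi_apply i).prodMk (measurable_pi_apply j))
  unfold edgeValue
  exact .ite (.const _) hWx (measurable_const.sub hWx)

theorem measurable_freeFactor (h : Fin n → Cell) {W : ℝ → ℝ → ℝ} (hW : IsPlaneGraphon W) :
    Measurable (freeFactor H h W) :=
  Finset.measurable_fun_prod _ fun e _ =>
    .ite (.const _) measurable_const (measurable_edgeValue_apply H hW e.1 e.2)

theorem freeFactor_mem (h : Fin n → Cell) {W : ℝ → ℝ → ℝ} (hW : IsPlaneGraphon W)
    (x : Fin n → ℝ) : freeFactor H h W x ∈ Icc (0 : ℝ) 1 := by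
  refine prod_mem_Icc_zero_one fun e _ => ?_
  split_ifs
  · exact right_mem_Icc.mpr zero_le_one
  · exact edgeValue_mem H _ _ (hW.mem _ _)

theorem isCoding_comm (c c' : Cell) : isCoding c c' = isCoding c' c := by
  cases c <;> cases c' <;> rfl

theorem freeFactor_congr (hU : IsPlaneGraphon (U (WF P))) (h : Fin n → Cell) {x x' : Fin n → ℝ}
    (hx : ∀ i, x i ∈ hullSet P (h i) ∧ Generic P 0 (relCoord (x i)))
    (hx' : ∀ i, x' i ∈ hullSet P (h i) ∧ Generic P 0 (relCoord (x' i)) ∧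
      (x' i = x i ∨ IsMiddle (h i))) :
    freeFactor H h (WP U P 0) x = freeFactor H h (WP U P 0) x' := by
  have hsymm := (isPlaneGraphon_WP hU zero_mem_cube).symm
  have move (i : Fin n) {c : Cell} {t : ℝ} (ht : t ∈ hullSet P c) (hc : ¬isCoding (h i) c = true) :
      WP U P 0 (x i) t = WP U P 0 (x' i) t := by
    obtain ⟨hmem, hgeneric⟩ := hx i
    obtain ⟨hmem', hgeneric', heq | hmiddle⟩ := hx' i
    · rw [heq]
    · obtain ⟨hE, hE', hclass⟩ := sameClass_of_mem_hullSet hmiddle hmem hmem' hgeneric hgeneric'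
      exact WP_eq_of_sameClass U zero_mem_cube hE hE' hclass hgeneric hgeneric'
        (not_isCodingPair_of_mem_hullSet hc hmem ht)
  refine Finset.prod_congr rfl fun e _ => ?_
  by_cases hcoding : isCoding (h e.1) (h e.2) = true
  · rw [if_pos hcoding, if_pos hcoding]
  · rw [if_neg hcoding, if_neg hcoding, move e.1 (hx e.2).1 hcoding, hsymm _ (x e.2),
      move e.2 (hx' e.1).1 (by rwa [isCoding_comm]), hsymm]

theorem isFiniteMeasure_restrict_cellSet (hz : z ∈ cube) (hf : Feasible P z) (c : Cell) :
    IsFiniteMeasure (volume.restrict (cellSet P z c)) :=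
  isFiniteMeasure_of_le (volume.restrict (hullSet P c))
    (Measure.restrict_mono (cellSet_subset_hullSet hz hf c) le_rfl)

-- Collapsing each middle cell to a point leaves the integrand unchanged almost everywhere, so that
-- only the measures of the cells matter.
theorem integral_freeFactor (hU : IsPlaneGraphon (U (WF P))) (hz : z ∈ cube) (hf : Feasible P z)
    (h : Fin n → Cell) :
    ∫ x in univ.pi fun i => cellSet P z (h i), freeFactor H h (WP U P 0) x =
      (∏ i, eval z (ratioPoly P (h i))) * freeIntegral H U P h := by
  choose κ hκ using fun i => exists_isCollapse hz hf (h i)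
  have (i : Fin n) := isFiniteMeasure_restrict_cellSet hz hf (h i)
  have hae (S : Fin n → Set ℝ) (hS : ∀ i, MeasurableSet (S i)) (hSh : ∀ i, S i ⊆ hullSet P (h i))
      (_ : ∀ i, IsFiniteMeasure (volume.restrict (S i))) :
      ∀ᵐ x ∂Measure.pi fun i => volume.restrict (S i),
        freeFactor H h (WP U P 0) x = freeFactor H h (WP U P 0) fun i => κ i (x i) := by
    filter_upwards [ae_pi_of_forall_ae fun i => ae_mem_and_generic P 0 (hS i)] with x hx
    exact freeFactor_congr H hU h (fun i => ⟨hSh i (hx i).1, (hx i).2⟩)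
      fun i => (hκ i).mem_hullSet _ (hSh i (hx i).1) (hx i).2
  unfold freeIntegral
  rw [volume_pi, Measure.restrict_pi_pi, Measure.restrict_pi_pi,
    integral_pi_eq_prod_mul_of_map_eq_smul _ _ (fun i => (hκ i).measurable)
      (fun i => (hκ i).map_cellSet) (measurable_freeFactor H h (isPlaneGraphon_WP hU zero_mem_cube))
      (hae _ (fun i => measurableSet_cellSet P z (h i))
        (fun i => cellSet_subset_hullSet hz hf (h i)) this)
      (hae _ (fun i => measurableSet_hullSet P (h i)) (fun i => subset_rfl) fun i => inferInstance)]
  congr 1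
  exact Finset.prod_congr rfl fun i _ => Real.coe_toNNReal _ (eval_ratioPoly_nonneg hz hf _)

theorem prod_edgeValue_eq (hz : z ∈ cube) (hf : Feasible P z) (U : (ℝ → ℝ → ℝ) → ℝ → ℝ → ℝ)
    (h : Fin n → Cell) {x : Fin n → ℝ} (hx : ∀ i, x i ∈ cellSet P z (h i))
    (hg : ∀ i, Generic P z (relCoord (x i)) ∧ Generic P 0 (relCoord (x i))) :
    ∏ e : Fin n × Fin n with e.1 < e.2, edgeValue H e.1 e.2 (WP U P z (x e.1) (x e.2)) =
      eval z (codingFactor H h) * freeFactor H h (WP U P 0) x := by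
  unfold codingFactor freeFactor
  rw [map_prod, ← Finset.prod_mul_distrib]
  refine Finset.prod_congr rfl fun e _ => ?_
  by_cases hcoding : isCoding (h e.1) (h e.2) = true
  · rw [if_pos hcoding, if_pos hcoding, mul_one, apply_ite (eval z), map_sub, map_one,
      WP_eq_eval_pairPoly U hz hf hcoding (hx e.1) (hx e.2) (hg e.1).1 (hg e.2).1]
    rfl
  · have hhull (i : Fin n) := cellSet_subset_hullSet hz hf (h i) (hx i)
    rw [if_neg hcoding, if_neg hcoding, map_one, one_mul,
      WP_eq_of_not_isCodingPair U hz zero_mem_cube (hg e.1) (hg e.2)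
        (not_isCodingPair_of_mem_hullSet hcoding (hhull _) (hhull _))]

theorem setIntegral_prod_edgeValue (hU : IsPlaneGraphon (U (WF P))) (hz : z ∈ cube)
    (hf : Feasible P z) (h : Fin n → Cell) :
    ∫ x in univ.pi fun i => cellSet P z (h i),
        ∏ e : Fin n × Fin n with e.1 < e.2, edgeValue H e.1 e.2 (WP U P z (x e.1) (x e.2)) =
      eval z (contribution H U P h) := by
  have (i : Fin n) := isFiniteMeasure_restrict_cellSet hz hf (h i)
  have hae : ∀ᵐ x ∂(volume : Measure (Fin n → ℝ)).restrict (univ.pi fun i => cellSet P z (h i)),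
      ∏ e : Fin n × Fin n with e.1 < e.2, edgeValue H e.1 e.2 (WP U P z (x e.1) (x e.2)) =
        eval z (codingFactor H h) * freeFactor H h (WP U P 0) x := by
    rw [volume_pi, Measure.restrict_pi_pi]
    have hgeneric (z' : ℕ+ → ℝ) :=
      ae_pi_of_forall_ae fun i => ae_mem_and_generic P z' (measurableSet_cellSet P z (h i))
    filter_upwards [hgeneric z, hgeneric 0] with x hx hx'
    exact prod_edgeValue_eq H hz hf U h (fun i => (hx i).1) fun i => ⟨(hx i).2, (hx' i).2⟩
  rw [integral_congr_ae hae, integral_const_mul, integral_freeFactor H hU hz hf]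
  simp only [contribution, shapePoly, map_mul, map_prod, eval_C]
  ring

theorem hasSum_contribution (hU : IsPlaneGraphon (U (WF P))) (hz : z ∈ cube) (hf : Feasible P z) :
    HasSum (fun h : Fin n → Cell => eval z (contribution H U P h)) (tau H (WP U P z)) := by
  have hW := isPlaneGraphon_WP hU hz
  have hint : IntegrableOn (fun x : Fin n → ℝ =>
      ∏ e : Fin n × Fin n with e.1 < e.2, edgeValue H e.1 e.2 (WP U P z (x e.1) (x e.2)))
      (univ.pi fun _ => ⋃ c, cellSet P z c) := by
    rw [iUnion_cellSet hz hf]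
    refine integrableOn_pi_Ico_of_abs_le (C := 1) (Finset.measurable_fun_prod _ fun e _ =>
      measurable_edgeValue_apply H hW e.1 e.2) fun x => ?_
    exact abs_le_one_of_mem_Icc (prod_mem_Icc_zero_one fun e _ => edgeValue_mem H _ _ (hW.mem _ _))
  have hsum := hasSum_integral_pi_iUnion (fun c => measurableSet_cellSet P z c)
    (fun c c' hne => disjoint_left.mpr fun s hs hs' =>
      hne (cell_eq_of_mem_cellSet hz hf hs hs')) hint
  simp only [iUnion_cellSet hz hf, setIntegral_prod_edgeValue H hU hz hf] at hsum
  exact hsum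

end Expansion

/-! ### Bounds for the contributions of the configurations -/

section Bounds

variable {ρ : ℝ}

theorem norm_coeff_p_mul_pow_le (P : BoundingSequence) (k : ℕ+) (hρ : 1 ≤ ρ) (hρ2 : ρ ≤ 2)
    (m : ℕ+ →₀ ℕ) : ‖coeff m (P.p k)‖ * ρ ^ weight m ≤ 1 / 2 / 2 ^ position m := by
  obtain ⟨j, rfl⟩ : ∃ j, M j = m :=
    ⟨(position m).succPNat, position_injective ((position_M _).trans (Nat.natPred_succPNat _))⟩
  have hj : position (M j) + 1 = j := by rw [position_M, PNat.natPred_add_one]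
  have hpow : ρ ^ weight (M j) ≤ 2 ^ (j : ℕ) :=
    (pow_le_pow_right₀ hρ (weight_M_lt j).le).trans (pow_le_pow_left₀ (by positivity) hρ2 _)
  rw [div_div, ← pow_succ', hj, le_div_iff₀ (by positivity)]
  calc ‖coeff (M j) (P.p k)‖ * ρ ^ weight (M j) * 2 ^ (j : ℕ)
      ≤ ((2 : ℝ) ^ (2 ^ (j : ℕ)))⁻¹ / 9 * 2 ^ (j : ℕ) * 2 ^ (j : ℕ) := by
        gcongr
        exact P.coeff_le k j
    _ = 2 ^ (2 * (j : ℕ)) * ((2 : ℝ) ^ (2 ^ (j : ℕ)))⁻¹ / 9 := by ring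
    _ ≤ 1 := by linarith [two_pow_two_mul_mul_inv_le_one j.ne_zero]

theorem weightedNorm_p_le (P : BoundingSequence) (k : ℕ+) (hρ : 1 ≤ ρ) (hρ2 : ρ ≤ 2) :
    weightedNorm PNat.val ρ (P.p k) ≤ 1 := by
  calc weightedNorm PNat.val ρ (P.p k)
      ≤ ∑ m ∈ (P.p k).support, 1 / 2 / (2 : ℝ) ^ position m :=
        Finset.sum_le_sum fun m _ =>
          (weight_eq_finsuppWeight m).symm ▸ norm_coeff_p_mul_pow_le P k hρ hρ2 m
    _ = ∑ r ∈ (P.p k).support.image position, 1 / 2 / (2 : ℝ) ^ r :=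
        (Finset.sum_image (f := fun r : ℕ => 1 / 2 / (2 : ℝ) ^ r) position_injective.injOn).symm
    _ ≤ 1 := sum_le_hasSum _ (fun _ _ => by positivity) (hasSum_geometric_two' 1)

theorem weightedNorm_threshold_le (P : BoundingSequence) (θ : Bool) (k : ℕ+) (hρ : 1 ≤ ρ)
    (hρ2 : ρ ≤ 2) : weightedNorm PNat.val ρ (threshold P θ k) ≤ 2 := by
  have hp := weightedNorm_p_le P k hρ hρ2
  cases θ
  · exact hp.trans one_le_two
  · have hsub := weightedNorm_sub_le PNat.val (zero_le_one.trans hρ) 1 (P.p k)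
    rw [weightedNorm_one] at hsub
    exact hsub.trans (by linarith)

/-- The index of the dyadic class of a cell, and `0` for the remaining points. -/
def cellIndex : Cell → ℕ
  | .C _ k => k
  | .E _ k _ => k
  | .rest => 0

theorem norm_mul_weightedNorm_C_inv_mul_le {σ R : Type*} [NormedField R] (w : σ → ℕ)
    (hρ : 0 ≤ ρ) (d : R) (q : MvPolynomial σ R) :
    ‖d‖ * weightedNorm w ρ (MvPolynomial.C d⁻¹ * q) ≤ weightedNorm w ρ q := by
  have hq := weightedNorm_nonneg w hρ q
  calc ‖d‖ * weightedNorm w ρ (MvPolynomial.C d⁻¹ * q)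
      ≤ ‖d‖ * (‖d⁻¹‖ * weightedNorm w ρ q) := by
        rw [← weightedNorm_C w ρ d⁻¹]
        gcongr
        exact weightedNorm_mul_le w hρ _ q
    _ = ‖d‖ * ‖d‖⁻¹ * weightedNorm w ρ q := by rw [norm_inv, mul_assoc]
    _ ≤ weightedNorm w ρ q := mul_le_of_le_one_left hq mul_inv_le_one

theorem sub_mul_weightedNorm_ratioPoly_le (P : BoundingSequence) (hρ : 1 ≤ ρ) (hρ2 : ρ ≤ 2)
    (θ : Bool) (k : ℕ+) (β : Band) :
    ((β.hullEnds P θ k).2 - (β.hullEnds P θ k).1) *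
      weightedNorm PNat.val ρ (ratioPoly P (.E θ k β)) ≤ 3 := by
  have hρ0 : 0 ≤ ρ := zero_le_one.trans hρ
  have h0 := lowerBound_nonneg P θ k
  have h1 := upperBound_le_one P θ k
  have hle := lowerBound_le_upperBound P θ k
  have hthreshold := weightedNorm_threshold_le P θ k hρ hρ2
  have hconst {a : ℝ} (ha : a ∈ Icc (0 : ℝ) 1) :
      weightedNorm PNat.val ρ (MvPolynomial.C a : MvPolynomial ℕ+ ℝ) ≤ 1 := by
    rw [weightedNorm_C]
    exact abs_le_one_of_mem_Icc ha
  have hmiddle (q : MvPolynomial ℕ+ ℝ) := norm_mul_weightedNorm_C_inv_mul_le PNat.val hρ0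
    (upperBound P θ k - lowerBound P θ k) q
  rw [Real.norm_of_nonneg (sub_nonneg.mpr hle)] at hmiddle
  cases β with
  | low =>
    refine (hmiddle _).trans ((weightedNorm_sub_le PNat.val hρ0 _ _).trans ?_)
    linarith [hconst ⟨h0, hle.trans h1⟩]
  | high =>
    refine (hmiddle _).trans ((weightedNorm_sub_le PNat.val hρ0 _ _).trans ?_)
    linarith [hconst ⟨h0.trans hle, h1⟩]
  | below | above =>
    simp only [Band.hullEnds, ratioPoly, weightedNorm_one]
    linarith

theorem volume_hullSet_mul_weightedNorm_ratioPoly_le (P : BoundingSequence) (hρ : 1 ≤ ρ)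
    (hρ2 : ρ ≤ 2) (c : Cell) :
    volume.real (hullSet P c) * weightedNorm PNat.val ρ (ratioPoly P c) ≤
      ((2 : ℝ) ^ cellIndex c)⁻¹ := by
  cases c with
  | C b k =>
    rw [ratioPoly_eq_one P id, weightedNorm_one, mul_one, hullSet,
      volume_region _ _ _ le_rfl zero_le_one le_rfl]
    simp only [GPart.size, cellIndex]
    field_simp
    norm_num
  | E θ k β =>
    obtain ⟨h0, hle, h1⟩ := β.hullEnds_ordered P θ k
    have hratio := sub_mul_weightedNorm_ratioPoly_le P hρ hρ2 θ k β
    rw [hullSet, volume_region _ _ _ h0 hle h1]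
    calc _ = ((β.hullEnds P θ k).2 - (β.hullEnds P θ k).1) *
            weightedNorm PNat.val ρ (ratioPoly P (.E θ k β)) / 75 * ((2 : ℝ) ^ (k : ℕ))⁻¹ := by
          simp only [GPart.size]
          ring
      _ ≤ ((2 : ℝ) ^ (k : ℕ))⁻¹ := mul_le_of_le_one_left (by positivity) (by linarith)
  | rest =>
    rw [ratioPoly_eq_one P id, weightedNorm_one, mul_one, cellIndex, pow_zero, inv_one]
    exact (measureReal_mono (hullSet_subset P .rest) (by simp)).trans (by simp)

theorem weightedNorm_pairPoly_le (hρ : 1 ≤ ρ) (c c' : Cell) :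
    weightedNorm PNat.val ρ (pairPoly c c') ≤ 1 + ρ ^ cellIndex c := by
  have hρ0 : 0 ≤ ρ := zero_le_one.trans hρ
  have hnonneg : 0 ≤ ρ ^ cellIndex c := pow_nonneg hρ0 _
  have hzero : weightedNorm PNat.val ρ (0 : MvPolynomial ℕ+ ℝ) ≤ 1 + ρ ^ cellIndex c := by
    rw [weightedNorm_zero]
    linarith
  have hone : weightedNorm PNat.val ρ (1 : MvPolynomial ℕ+ ℝ) ≤ 1 + ρ ^ cellIndex c := by
    rw [weightedNorm_one]
    linarith
  have hmonomial (k : ℕ+) :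
      weightedNorm PNat.val ρ (monomial (M k) (1 : ℝ)) ≤ ρ ^ (k : ℕ) := by
    rw [weightedNorm_monomial, norm_one, one_mul, ← weight_eq_finsuppWeight]
    exact pow_le_pow_right₀ hρ (weight_M_lt k).le
  cases c <;> cases c' <;> simp only [pairPoly] <;> try exact hzero
  all_goals split_ifs
  case pos b k b' k' _ _ => exact (hmonomial k).trans (le_add_of_nonneg_left zero_le_one)
  case neg b k b' k' _ _ =>
    refine (weightedNorm_sub_le PNat.val hρ0 _ _).trans ?_
    rw [weightedNorm_one]
    exact add_le_add le_rfl (hmonomial k)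
  all_goals first | exact hone | exact hzero

variable {n : ℕ} (H : SimpleGraph (Fin n))

theorem weightedNorm_codingFactor_le (hρ : 1 ≤ ρ) (h : Fin n → Cell) :
    weightedNorm PNat.val ρ (codingFactor H h) ≤ ∏ i, (3 * ρ ^ cellIndex (h i)) ^ n := by
  have hρ0 : 0 ≤ ρ := zero_le_one.trans hρ
  have hpow (i : Fin n) : 1 ≤ ρ ^ cellIndex (h i) := one_le_pow₀ hρ
  unfold codingFactor
  refine (weightedNorm_prod_le PNat.val hρ0 _ _).trans ?_
  calc _ ≤ ∏ e : Fin n × Fin n with e.1 < e.2, 3 * ρ ^ cellIndex (h e.1) := by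
        refine Finset.prod_le_prod (fun e _ => weightedNorm_nonneg _ hρ0 _) fun e _ => ?_
        have hpair := weightedNorm_pairPoly_le hρ (h e.1) (h e.2)
        have hsub := weightedNorm_sub_le PNat.val hρ0 1 (pairPoly (h e.1) (h e.2))
        rw [weightedNorm_one] at hsub
        split_ifs
        · linarith [hpow e.1]
        · linarith [hpow e.1]
        · rw [weightedNorm_one]
          linarith [hpow e.1]
    _ ≤ ∏ e : Fin n × Fin n, 3 * ρ ^ cellIndex (h e.1) :=
        Finset.prod_le_prod_of_subset_of_one_le (Finset.filter_subset _ _)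
          (fun e _ => by positivity) fun e _ _ => by linarith [hpow e.1]
    _ = ∏ i, (3 * ρ ^ cellIndex (h i)) ^ n := by
        simp only [Fintype.prod_prod_type, Finset.prod_const, Finset.card_univ, Fintype.card_fin]

variable {U : (ℝ → ℝ → ℝ) → ℝ → ℝ → ℝ} {P : BoundingSequence}

theorem abs_freeIntegral_le (hU : IsPlaneGraphon (U (WF P))) (h : Fin n → Cell) :
    |freeIntegral H U P h| ≤ ∏ i, volume.real (hullSet P (h i)) := by
  have hmem := freeFactor_mem H h (isPlaneGraphon_WP hU zero_mem_cube)
  have hvolume : (volume : Measure (Fin n → ℝ)).real (univ.pi fun i => hullSet P (h i)) =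
      ∏ i, volume.real (hullSet P (h i)) := by
    simp only [measureReal_def, volume_pi_pi, ENNReal.toReal_prod]
  have hfinite : (volume : Measure (Fin n → ℝ)) (univ.pi fun i => hullSet P (h i)) < ⊤ := by
    rw [volume_pi_pi]
    exact ENNReal.prod_lt_top fun i _ =>
      (measure_mono (hullSet_subset P (h i))).trans_lt measure_Ico_lt_top
  have hbound := norm_setIntegral_le_of_norm_le_const (f := freeFactor H h (WP U P 0)) hfinite
    fun x _ => abs_le_one_of_mem_Icc (hmem x)
  rwa [one_mul, hvolume] at hbound

theorem weightedNorm_contribution_le (hU : IsPlaneGraphon (U (WF P))) (hρ : 1 ≤ ρ)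
    (hρ2 : ρ ^ (n + 1) = 2) (h : Fin n → Cell) :
    weightedNorm PNat.val ρ (contribution H U P h) ≤ ∏ i, 3 ^ n * ρ⁻¹ ^ cellIndex (h i) := by
  have hρ0 : 0 ≤ ρ := zero_le_one.trans hρ
  have hle2 : ρ ≤ 2 := hρ2 ▸ le_self_pow₀ hρ n.succ_ne_zero
  have hratio := weightedNorm_prod_le PNat.val hρ0 Finset.univ fun i => ratioPoly P (h i)
  have hnonneg (q : MvPolynomial ℕ+ ℝ) := weightedNorm_nonneg PNat.val hρ0 q
  unfold contribution shapePoly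
  calc _ ≤ |freeIntegral H U P h| * (weightedNorm PNat.val ρ (∏ i, ratioPoly P (h i)) *
          weightedNorm PNat.val ρ (codingFactor H h)) := by
        refine (weightedNorm_mul_le PNat.val hρ0 _ _).trans ?_
        rw [weightedNorm_C, Real.norm_eq_abs]
        gcongr
        exact weightedNorm_mul_le PNat.val hρ0 _ _
    _ ≤ (∏ i, volume.real (hullSet P (h i))) *
          ((∏ i, weightedNorm PNat.val ρ (ratioPoly P (h i))) *
            ∏ i, (3 * ρ ^ cellIndex (h i)) ^ n) := by
        gcongr
        · exact mul_nonneg (hnonneg _) (hnonneg _)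
        · exact abs_freeIntegral_le H hU h
        · exact hnonneg _
        · exact Finset.prod_nonneg fun i _ => hnonneg _
        · exact weightedNorm_codingFactor_le H hρ h
    _ = ∏ i, volume.real (hullSet P (h i)) * weightedNorm PNat.val ρ (ratioPoly P (h i)) *
          (3 * ρ ^ cellIndex (h i)) ^ n := by
        rw [← mul_assoc, ← Finset.prod_mul_distrib, ← Finset.prod_mul_distrib]
    _ ≤ ∏ i, ((2 : ℝ) ^ cellIndex (h i))⁻¹ * (3 * ρ ^ cellIndex (h i)) ^ n := by
        gcongr with i
        · exact fun i _ => mul_nonneg (mul_nonneg measureReal_nonneg (hnonneg _)) (by positivity)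
        · exact volume_hullSet_mul_weightedNorm_ratioPoly_le P hρ hle2 _
    _ = ∏ i, 3 ^ n * ρ⁻¹ ^ cellIndex (h i) := by
        refine Finset.prod_congr rfl fun i _ => ?_
        rw [← hρ2, mul_pow, inv_pow, ← pow_mul, ← pow_mul, mul_comm (cellIndex (h i)) n,
          Nat.add_one_mul, pow_add]
        field_simp

theorem summable_pow_cellIndex {r : ℝ} (hr0 : 0 ≤ r) (hr1 : r < 1) :
    Summable fun c : Cell => r ^ cellIndex c := by
  let f : Cell → Option (Bool × Option (Bool × Band)) × ℕ := fun c =>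
    match c with
    | .C b k => (some (b, none), k)
    | .E θ k β => (some (θ, some (θ, β)), k)
    | .rest => (none, 0)
  have hf : Function.Injective f := by
    rintro (_ | _ | _) (_ | _ | _) h <;> simp_all [f]
  have hsummable : Summable fun x : Option (Bool × Option (Bool × Band)) × ℕ => 1 * r ^ x.2 :=
    Summable.mul_of_nonneg (f := fun _ : Option (Bool × Option (Bool × Band)) => (1 : ℝ))
      .of_finite (summable_geometric_of_lt_one hr0 hr1) (fun _ => zero_le_one)
      fun _ => pow_nonneg hr0 _
  refine (hsummable.comp_injective hf).congr fun c => ?_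
  cases c <;> simp [f, cellIndex]

end Bounds

/-! ### Continuity in the bounding sequence -/

section Continuity

variable {n : ℕ} (H : SimpleGraph (Fin n))

theorem abs_edgeValue_sub_edgeValue (i j : Fin n) (w w' : ℝ) :
    |edgeValue H i j w - edgeValue H i j w'| = |w - w'| := by
  unfold edgeValue
  split_ifs
  · rfl
  · rw [sub_sub_sub_cancel_left, abs_sub_comm]

theorem abs_freeFactor_sub_le (h : Fin n → Cell) {W W' : ℝ → ℝ → ℝ} (hW : IsPlaneGraphon W)
    (hW' : IsPlaneGraphon W') (x : Fin n → ℝ) :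
    |freeFactor H h W x - freeFactor H h W' x| ≤
      ∑ e : Fin n × Fin n with e.1 < e.2, |W (x e.1) (x e.2) - W' (x e.1) (x e.2)| := by
  have hfactor {V : ℝ → ℝ → ℝ} (hV : IsPlaneGraphon V) (e : Fin n × Fin n) :
      ‖if isCoding (h e.1) (h e.2) then 1 else edgeValue H e.1 e.2 (V (x e.1) (x e.2))‖ ≤ 1 := by
    split_ifs
    · exact norm_one.le
    · exact abs_le_one_of_mem_Icc (edgeValue_mem H _ _ (hV.mem _ _))
  refine (norm_prod_sub_prod_le _ (fun e _ => hfactor hW e) fun e _ => hfactor hW' e).trans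
    (Finset.sum_le_sum fun e _ => ?_)
  split_ifs
  · rw [sub_self, norm_zero]
    exact abs_nonneg _
  · exact (abs_edgeValue_sub_edgeValue H _ _ _ _).le

theorem abs_sub_le_one_of_mem_Icc {a b : ℝ} (ha : a ∈ Icc (0 : ℝ) 1) (hb : b ∈ Icc (0 : ℝ) 1) :
    |a - b| ≤ 1 := by
  simpa only [sub_zero] using abs_sub_le_of_le_of_le ha.1 ha.2 hb.1 hb.2

variable {U : (ℝ → ℝ → ℝ) → ℝ → ℝ → ℝ} {P P' : BoundingSequence}

theorem setIntegral_abs_WP_sub_le_l1Dist (hU : IsPlaneGraphon (U (WF P)))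
    (hU' : IsPlaneGraphon (U (WF P'))) {z : ℕ+ → ℝ} (hz : z ∈ cube) :
    ∫ s in Ico (0 : ℝ) 1 ×ˢ Ico (0 : ℝ) 1, |WP U P z s.1 s.2 - WP U P' z s.1 s.2| ≤
      l1Dist U P P' := by
  have hvolume : volume (Ico (0 : ℝ) 1 ×ˢ Ico (0 : ℝ) 1) = 1 := by
    simp [Measure.volume_eq_prod]
  have hbounded : BddAbove (range fun z : cube =>
      ∫ s in Ico (0 : ℝ) 1 ×ˢ Ico (0 : ℝ) 1, |WP U P z s.1 s.2 - WP U P' z s.1 s.2|) := by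
    refine ⟨1, ?_⟩
    rintro _ ⟨z, rfl⟩
    have hnorm := norm_setIntegral_le_of_norm_le_const
      (f := fun s => |WP U P z s.1 s.2 - WP U P' z s.1 s.2|)
      (hvolume.trans_lt ENNReal.one_lt_top) fun s _ => (abs_abs _).trans_le
        (abs_sub_le_one_of_mem_Icc ((isPlaneGraphon_WP hU z.2).mem s.1 s.2)
          ((isPlaneGraphon_WP hU' z.2).mem s.1 s.2))
    rw [measureReal_def, hvolume, ENNReal.toReal_one, one_mul] at hnorm
    exact (Real.le_norm_self _).trans hnorm
  exact le_ciSup hbounded ⟨z, hz⟩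

theorem l1Dist_nonneg (hU : IsPlaneGraphon (U (WF P))) (hU' : IsPlaneGraphon (U (WF P'))) :
    0 ≤ l1Dist U P P' :=
  (integral_nonneg fun _ => abs_nonneg _).trans
    (setIntegral_abs_WP_sub_le_l1Dist hU hU' zero_mem_cube)

theorem abs_freeIntegral_sub_le (hU : IsPlaneGraphon (U (WF P)))
    (hU' : IsPlaneGraphon (U (WF P'))) {h : Fin n → Cell}
    (hh : ∀ i, hullSet P (h i) = hullSet P' (h i)) :
    |freeIntegral H U P h - freeIntegral H U P' h| ≤ n * n * l1Dist U P P' := by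
  have hW := isPlaneGraphon_WP hU zero_mem_cube
  have hW' := isPlaneGraphon_WP hU' zero_mem_cube
  let T : Set (Fin n → ℝ) := univ.pi fun _ => Ico 0 1
  let d : ℝ × ℝ → ℝ := fun s => |WP U P 0 s.1 s.2 - WP U P' 0 s.1 s.2|
  have hd : Measurable d := (hW.meas.sub hW'.meas).abs
  have hfree {V : ℝ → ℝ → ℝ} (hV : IsPlaneGraphon V) : IntegrableOn (freeFactor H h V) T :=
    integrableOn_pi_Ico_of_abs_le (measurable_freeFactor H h hV)
      fun x => abs_le_one_of_mem_Icc (freeFactor_mem H h hV x)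
  have hpair (e : Fin n × Fin n) : IntegrableOn (fun x => d (x e.1, x e.2)) T :=
    integrableOn_pi_Ico_of_abs_le
      (hd.comp ((measurable_pi_apply e.1).prodMk (measurable_pi_apply e.2)))
      fun x => (abs_abs _).trans_le (abs_sub_le_one_of_mem_Icc (hW.mem _ _) (hW'.mem _ _))
  have hsubset : (univ.pi fun i => hullSet P (h i)) ⊆ T :=
    pi_mono fun i _ => hullSet_subset P (h i)
  simp only [freeIntegral, ← hh]
  rw [← integral_sub ((hfree hW).mono_set hsubset) ((hfree hW').mono_set hsubset)]
  refine abs_integral_le_integral_abs.trans ?_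
  calc _ ≤ ∫ x in T, |freeFactor H h (WP U P 0) x - freeFactor H h (WP U P' 0) x| :=
        setIntegral_mono_set ((hfree hW).sub (hfree hW')).abs
          (ae_of_all _ fun x => abs_nonneg _) hsubset.eventuallyLE
    _ ≤ ∫ x in T, ∑ e : Fin n × Fin n with e.1 < e.2, d (x e.1, x e.2) :=
        integral_mono ((hfree hW).sub (hfree hW')).abs (integrable_finsetSum _ fun e _ => hpair e)
          fun x => abs_freeFactor_sub_le H h hW hW' x
    _ = ∑ e : Fin n × Fin n with e.1 < e.2, ∫ x in T, d (x e.1, x e.2) :=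
        integral_finsetSum _ fun e _ => hpair e
    _ ≤ ∑ e : Fin n × Fin n with e.1 < e.2, l1Dist U P P' :=
        Finset.sum_le_sum fun e he => (setIntegral_pi_Ico_eval_pair
          (Finset.mem_filter.mp he).2.ne hd).trans_le
          (setIntegral_abs_WP_sub_le_l1Dist hU hU' zero_mem_cube)
    _ ≤ ∑ _e : Fin n × Fin n, l1Dist U P P' :=
        Finset.sum_le_sum_of_subset_of_nonneg (Finset.filter_subset _ _)
          fun _ _ _ => l1Dist_nonneg hU hU'
    _ = n * n * l1Dist U P P' := by simp

theorem AgreeUpTo.hullSet_eq_and_ratioPoly_eq {k : ℕ} (hP : AgreeUpTo k P P') {c : Cell}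
    (hc : cellIndex c ≤ k) : hullSet P c = hullSet P' c ∧ ratioPoly P c = ratioPoly P' c := by
  cases c with
  | E θ i β =>
    obtain ⟨hp, hl, hu⟩ := hP i hc
    have hlower : lowerBound P θ i = lowerBound P' θ i := by rw [lowerBound, hl, lowerBound]
    have hupper : upperBound P θ i = upperBound P' θ i := by rw [upperBound, hu, upperBound]
    have hthreshold : threshold P θ i = threshold P' θ i := by rw [threshold, hp, threshold]
    cases β <;>
      simp only [hullSet, Band.hullEnds, ratioPoly, hlower, hupper, hthreshold, and_self]
  | _ => exact ⟨rfl, rfl⟩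

theorem epsClose_C_mul {a a' B ε : ℝ} {q : MvPolynomial ℕ+ ℝ}
    (hB : ∀ z ∈ cube, |eval z q| ≤ B ∧ ∀ i, |eval z (pderiv i q)| ≤ B) (hε : |a - a'| * B ≤ ε) :
    EpsClose ε (MvPolynomial.C a * q) (MvPolynomial.C a' * q) := by
  have hclose {b : ℝ} (hb : |b| ≤ B) : |a * b - a' * b| ≤ ε := by
    rw [← sub_mul, abs_mul]
    exact (mul_le_mul_of_nonneg_left hb (abs_nonneg _)).trans hε
  intro z hz
  simp only [pderiv_C_mul, map_mul, eval_C]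
  exact ⟨hclose (hB z hz).1, fun i => hclose ((hB z hz).2 i)⟩

theorem exists_forall_epsClose_contribution (hU : ∀ P, IsPlaneGraphon (U (WF P)))
    (P : BoundingSequence) (h : Fin n → Cell) {ε : ℝ} (hε : 0 < ε) :
    ∃ k : ℕ, ∃ δ : ℝ, 0 < δ ∧ ∀ P', AgreeUpTo k P P' → l1Dist U P P' ≤ δ →
      EpsClose ε (contribution H U P h) (contribution H U P' h) := by
  obtain ⟨B, hB0, hB⟩ := exists_forall_norm_eval_and_pderiv_le (shapePoly H P h)
  refine ⟨∑ i, cellIndex (h i), ε / (n * n * B + 1), by positivity, fun P' hP' hdist => ?_⟩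
  have hcell (i : Fin n) := hP'.hullSet_eq_and_ratioPoly_eq (c := h i)
    (Finset.single_le_sum (f := fun i => cellIndex (h i)) (fun _ _ => Nat.zero_le _)
      (Finset.mem_univ i))
  have hshape : shapePoly H P' h = shapePoly H P h := by
    simp only [shapePoly, (hcell _).2]
  unfold contribution
  rw [hshape]
  refine epsClose_C_mul (fun z hz => hB z fun i => abs_le_one_of_mem_Icc (hz i)) ?_
  calc |freeIntegral H U P h - freeIntegral H U P' h| * B
      ≤ n * n * l1Dist U P P' * B := by
        gcongr
        exact abs_freeIntegral_sub_le H (hU P) (hU P') fun i => (hcell i).1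
    _ ≤ l1Dist U P P' * (n * n * B + 1) := by linarith [l1Dist_nonneg (hU P) (hU P')]
    _ ≤ ε := (le_div_iff₀ (by positivity)).mp hdist

end Continuity

/-! ### The majorant of the coefficients -/

section Majorant

/-- The `2 * (n + 1)`-th root of `2`.  Its square `ρ` is the base of the weighted norms bounding the
coefficients, and its inverse is the constant `c_H` for graphs with `n` vertices. -/
def growthBase (n : ℕ) : ℝ :=
  2 ^ ((2 * (n + 1) : ℕ) : ℝ)⁻¹

theorem growthBase_sq_pow (n : ℕ) : (growthBase n ^ 2) ^ (n + 1) = 2 := by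
  rw [← pow_mul]
  exact Real.rpow_inv_natCast_pow zero_le_two (by lia)

theorem one_lt_growthBase (n : ℕ) : 1 < growthBase n :=
  Real.one_lt_rpow one_lt_two (by positivity)

/-- The bounds `β_{H',i}` for graphs with `n` vertices. -/
def majorant (n : ℕ) (h : Fin n → Cell) (i : ℕ+) : ℝ :=
  (∏ j, 3 ^ n * (growthBase n ^ 2)⁻¹ ^ cellIndex (h j)) * (growthBase n ^ 2)⁻¹ ^ weight (M i)

theorem summable_majorant (n : ℕ) (i : ℕ+) : Summable fun h => majorant n h i := by
  have hsq : 1 < growthBase n ^ 2 := one_lt_pow₀ (one_lt_growthBase n) two_ne_zero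
  have hinv : 0 ≤ (growthBase n ^ 2)⁻¹ := by positivity
  exact (summable_prod_apply (fun _ _ => by positivity) fun _ =>
    (summable_pow_cellIndex hinv (inv_lt_one_of_one_lt₀ hsq)).mul_left _).mul_right _

theorem tendsto_weight_M : Filter.Tendsto (fun i => weight (M i)) Filter.cofinite Filter.atTop := by
  have hM : Function.Injective M := (Equiv.injective _).comp PNat.natPred_injective
  refine Filter.tendsto_atTop.mpr fun w => ?_
  filter_upwards [((finite_weight_le w).preimage hM.injOn).compl_mem_cofinite] with i hi
  exact (not_le.mp fun h => hi h).le

theorem eventually_tsum_majorant_le (n : ℕ) :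
    ∀ᶠ i in Filter.cofinite, ∑' h, majorant n h i ≤ (growthBase n)⁻¹ ^ weight (M i) := by
  have hσ := one_lt_growthBase n
  have hσ0 : 0 < growthBase n := zero_lt_one.trans hσ
  simp only [majorant, tsum_mul_right]
  filter_upwards [tendsto_weight_M.eventually
    ((tendsto_pow_atTop_atTop_of_one_lt hσ).eventually_ge_atTop
      (∑' h : Fin n → Cell, ∏ j, 3 ^ n * (growthBase n ^ 2)⁻¹ ^ cellIndex (h j)))] with i hi
  calc _ ≤ growthBase n ^ weight (M i) * (growthBase n ^ 2)⁻¹ ^ weight (M i) := by gcongr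
    _ = (growthBase n)⁻¹ ^ weight (M i) := by
      rw [← mul_pow, sq, mul_inv, mul_inv_cancel_left₀ hσ0.ne']

theorem abs_coeff_contribution_le_majorant {n : ℕ} (H : SimpleGraph (Fin n))
    {U : (ℝ → ℝ → ℝ) → ℝ → ℝ → ℝ} {P : BoundingSequence} (hU : IsPlaneGraphon (U (WF P)))
    (h : Fin n → Cell) (i : ℕ+) : |coeff (M i) (contribution H U P h)| ≤ majorant n h i := by
  have hρ : 1 ≤ growthBase n ^ 2 := one_le_pow₀ (one_lt_growthBase n).le
  have hρ0 : 0 < growthBase n ^ 2 := zero_lt_one.trans_le hρ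
  unfold majorant
  rw [inv_pow _ (weight _), ← div_eq_mul_inv, le_div_iff₀ (by positivity),
    weight_eq_finsuppWeight]
  exact (norm_coeff_mul_pow_le_weightedNorm _ hρ0.le _ _).trans
    (weightedNorm_contribution_le H hU hρ (growthBase_sq_pow n) h)

end Majorant

end GraphonFamily

end

open GraphonFamily in
theorem mainTheorem5_general (n : ℕ) (H : SimpleGraph (Fin n)) :
    ∃ (ℋ : Type) (_ : Countable ℋ) (c : ℝ) (β : ℋ → ℕ+ → ℝ),
      0 < c ∧ c < 1 ∧
      (∀ i, Summable fun h => β h i) ∧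
      (∀ᶠ i in Filter.cofinite, ∑' h, β h i ≤ c ^ weight (M i)) ∧
      ∀ U : (ℝ → ℝ → ℝ) → ℝ → ℝ → ℝ, (∀ P, IsGraphon (U (WF P))) →
        ∃ q : BoundingSequence → ℋ → MvPolynomial ℕ+ ℝ,
          (∀ P, ∀ z ∈ cube, Feasible P z →
            HasSum (fun h => MvPolynomial.eval z (q P h)) (tau H (WP U P z))) ∧
          (∀ P h i, |MvPolynomial.coeff (M i) (q P h)| ≤ β h i) ∧
          (∀ P h, ∀ ε : ℝ, 0 < ε → ∃ k : ℕ, ∃ δ : ℝ, 0 < δ ∧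
            ∀ P', AgreeUpTo k P P' → l1Dist U P P' ≤ δ → EpsClose ε (q P h) (q P' h)) := by
  have hσ := one_lt_growthBase n
  refine ⟨Fin n → Cell, inferInstance, (growthBase n)⁻¹, majorant n,
    inv_pos.mpr (zero_lt_one.trans hσ), inv_lt_one_of_one_lt₀ hσ, summable_majorant n,
    eventually_tsum_majorant_le n, fun U hU => ?_⟩
  let U₀ (W : ℝ → ℝ → ℝ) : ℝ → ℝ → ℝ := zeroExtension (U W)
  have hU₀ (P) : IsPlaneGraphon (U₀ (WF P)) := (hU P).isPlaneGraphon_zeroExtension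
  refine ⟨contribution H U₀, fun P z hz hf => ?_,
    fun P h i => abs_coeff_contribution_le_majorant H (hU₀ P) h i, fun P h ε hε => ?_⟩
  · rw [← tau_congr H fun s hs t ht => WP_zeroExtension U P z hs ht]
    exact hasSum_contribution H (hU₀ P) hz hf
  · simpa only [U₀, l1Dist_zeroExtension] using
      exists_forall_epsClose_contribution H hU₀ P h hε

theorem mainTheorem5 (n : ℕ) (H : SimpleGraph (Fin n)) :
    ∃ (ℋ : Type) (_ : Countable ℋ) (c : ℝ) (β : ℋ → ℕ+ → ℝ),
      0 < c ∧ c < 1 ∧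
      (∀ i, Summable fun h => β h i) ∧
      (∀ᶠ i in Filter.cofinite, ∑' h, β h i ≤ c ^ GraphonFamily.weight (GraphonFamily.M i)) ∧
      ∀ U : (ℝ → ℝ → ℝ) → ℝ → ℝ → ℝ, GraphonFamily.IsUniversalEmbedding U →
        ∃ q : GraphonFamily.BoundingSequence → ℋ → MvPolynomial ℕ+ ℝ,
          (∀ P, ∀ z ∈ GraphonFamily.cube, GraphonFamily.Feasible P z →
            HasSum (fun h => MvPolynomial.eval z (q P h))
              (GraphonFamily.tau H (GraphonFamily.WP U P z))) ∧
          (∀ P h i, |MvPolynomial.coeff (GraphonFamily.M i) (q P h)| ≤ β h i) ∧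
          (∀ P h, ∀ ε : ℝ, 0 < ε → ∃ k : ℕ, ∃ δ : ℝ, 0 < δ ∧
            ∀ P', GraphonFamily.AgreeUpTo k P P' → GraphonFamily.l1Dist U P P' ≤ δ →
              GraphonFamily.EpsClose ε (q P h) (q P' h)) := by
  obtain ⟨ℋ, hℋ, c, β, hc0, hc1, hβ, hβc, hq⟩ := mainTheorem5_general n H
  exact ⟨ℋ, hℋ, c, β, hc0, hc1, hβ, hβc, fun U hU =>
    hq U fun P => (hU _ (GraphonFamily.isPlaneGraphon_WF P).isGraphon).1⟩
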